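/- **Setting.** Let $\beta>0$, $0<L_0<L$, $\sigma>1$. For a probability density $f$ on $\mathbb R$ write $\Phi_f(u)=\int e^{ixu}f(x)\,dx$, and let $W(\beta,L)$ be the set of probability densities $f\in\mathbb L_2(\mathbb R)$ with $\int|\Phi_f(u)|^2|u|^{2\beta}\,du\le 2\pi L$. Let $g$ be a known probability density with $\Phi_g(u)\neq0$ for all $u\in\mathbb R$ and $|\Phi_g(u)|\sim|u|^{-\sigma}$ as $|u|\to\infty$, and let $f_0\in W(\beta,L_0)$. One observes $Y_i=X_i+\varepsilon_i$, $i=1,\dots,n$, where the $X_i$ are i.i.d. with density $f$, the $\varepsilon_i$ are i.i.d. with density $g$, and all of them are independent; $P_f$ denotes the law of $(Y_1,\dots,Y_n)$. One tests $H_0:f=f_0$ against $H_1(C,\psi_n):\ f\in W(\beta,L),\ \int(f-f_0)^2\ge C\psi_n^2$. Put $$h=h_n=n^{-2/(4\beta+4\sigma+1)},\qquad t_n=\psi_n=n^{-2\beta/(4\beta+4\sigma+1)}.$$ Let $K_n(x)=\frac1{2\pi}\int_{-1}^{1}e^{-ixu}\,\Phi_g(u/h)^{-1}\,du$ (a real-valued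 function), $K_{n,h}(x)=h^{-1}K_n(x/h)$, $$T_n^*=\frac1{n(n-1)}\sum_{k\ne j}\int\bigl(K_{n,h}(x-Y_k)-f_0(x)\bigr)\bigl(K_{n,h}(x-Y_j)-f_0(x)\bigr)\,dx,$$ and, for $\kappa>0$, $\Delta_n^*=\Delta_n^*(\kappa)=I[\,|T_n^*|>\kappa t_n^2\,]$. **Theorem 5.** Let $0<\xi<1$. (i) (The test attains the rate $\psi_n$.) There is $\kappa_0>0$ such that for every $\kappa\ge\kappa_0$ the maps $\Delta_n^*(\kappa)$ are measurable and there is $C^*>0$ such that, for all $C>C^*$, $$\limsup_{n\to\infty}\Bigl\{P_{f_0}[\Delta_n^*=1]+\sup_{f\in H_1(C,\psi_n)}P_f[\Delta_n^*=0]\Bigr\}\le\xi .$$ (ii) (The rate is minimax.) Suppose moreover that * (P) $\Phi_g$ is three times continuously differentiable and there are $A_1,A_2>1$ and $u_0,u_1,u_2>0$ such that $|\Phi_g(u)|\ge u_0$ for $|u|\le A_1$ and $|\Phi_g^{(k)}(u)|\le u_k|u|^{-\sigma-k}$ for $k=1,2$ and $|u|\ge A_2$; * (tail condition) there is $c_0>0$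 with $f_0(x)\ge c_0/(1+|x|^2)$ for all $x\in\mathbb R$. Then there is $C_*>0$ such that, for all $0<C<C_*$, $$\liminf_{n\to\infty}\ \inf_{\Delta_n}\Bigl\{P_{f_0}[\Delta_n=1]+\sup_{f\in H_1(C,\psi_n)}P_f[\Delta_n=0]\Bigr\}\ge\xi ,$$ where the infimum is over all tests (measurable $\{0,1\}$-valued functions of $Y_1,\dots,Y_n$). The same holds, for some $C_*>0$, if the supremum is restricted to those $f\in H_1(C,\psi_n)$ for which $f-f_0$ is infinitely differentiable. -/

import Mathlib

open MeasureTheory Filter Topology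
open scoped ENNReal

noncomputable section

namespace NoisyTesting

/-- Probability densities on the real line. -/
structure IsDensity (f : ℝ → ℝ) : Prop where
  measurable : Measurable f
  nonneg : ∀ x, 0 ≤ f x
  integral_eq_one : ∫ x, f x = 1

/-- The characteristic function `Φ(u) = ∫ e^{ixu} f(x) dx` of a density `f`. -/
def cf (f : ℝ → ℝ) (u : ℝ) : ℂ :=
  ∫ x : ℝ, Complex.exp (Complex.I * ((x * u : ℝ) : ℂ)) * ((f x : ℝ) : ℂ)

/-- The Sobolev class `W(β, L)`: square-integrable probability densities `f` whose characteristic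
function satisfies `∫ |Φ(u)|² |u|^{2β} du ≤ 2πL`. -/
def sobolevClass (β L : ℝ) : Set (ℝ → ℝ) :=
  {f | IsDensity f ∧ MemLp f 2 volume ∧
    ∫⁻ u : ℝ, ENNReal.ofReal (‖cf f u‖ ^ 2 * |u| ^ (2 * β)) ≤ ENNReal.ofReal (2 * Real.pi * L)}

/-- The functions of `W(β, L)` that differ from `f₀` by an infinitely differentiable function; they
have the same local smoothness as `f₀`. -/
def smoothPerturbationClass (β L : ℝ) (f₀ : ℝ → ℝ) : Set (ℝ → ℝ) :=
  {f | f ∈ sobolevClass β L ∧ ContDiff ℝ (⊤ : ℕ∞) (fun x => f x - f₀ x)}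

/-- Polynomial noise of order `σ > 1`: the noise density `g` has a nowhere vanishing characteristic
function such that `|Φ^g(u)| ∼ |u|^{-σ}` as `|u| → ∞`. -/
structure IsPolynomialNoise (σ : ℝ) (g : ℝ → ℝ) : Prop where
  density : IsDensity g
  one_lt : 1 < σ
  cf_ne_zero : ∀ u, cf g u ≠ 0
  cf_decay : Asymptotics.IsEquivalent (cocompact ℝ) (fun u => ‖cf g u‖) (fun u => |u| ^ (-σ))

/-- The regularity assumption on the noise density: `Φ^g` is three times continuously differentiable, bounded
away from zero on some `[-A₁, A₁]`, and its first two derivatives decay like `|u|^{-σ-k}`. -/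
def AssumptionP (σ : ℝ) (g : ℝ → ℝ) : Prop :=
  ContDiff ℝ 3 (cf g) ∧
  ∃ A₁ A₂ u₀ u₁ u₂ : ℝ, 1 < A₁ ∧ 1 < A₂ ∧ 0 < u₀ ∧ 0 < u₁ ∧ 0 < u₂ ∧
    (∀ u, |u| ≤ A₁ → u₀ ≤ ‖cf g u‖) ∧
    (∀ u, A₂ ≤ |u| → ‖iteratedDeriv 1 (cf g) u‖ ≤ u₁ / |u| ^ (σ + 1)) ∧
    (∀ u, A₂ ≤ |u| → ‖iteratedDeriv 2 (cf g) u‖ ≤ u₂ / |u| ^ (σ + 2))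

/-- The tail condition `f₀(x) ≥ c₀ / (1 + |x|²)` for all real `x`, for some `c₀ > 0`. -/
def TailCondition (f₀ : ℝ → ℝ) : Prop :=
  ∃ c₀ : ℝ, 0 < c₀ ∧ ∀ x, c₀ / (1 + |x| ^ 2) ≤ f₀ x

/-- The probability measure with density `f`. -/
def densityLaw (f : ℝ → ℝ) : Measure ℝ :=
  volume.withDensity (fun x => ENNReal.ofReal (f x))

/-- `P_f`: the law of `(Y₁, …, Yₙ)`, where the `Yᵢ = Xᵢ + εᵢ` are i.i.d., `Xᵢ` has density `f`,
`εᵢ` has density `g`, and `Xᵢ`, `εᵢ` are independent. -/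
def obsLaw (g f : ℝ → ℝ) (n : ℕ) : Measure (Fin n → ℝ) :=
  Measure.pi (fun _ : Fin n => (densityLaw f).conv (densityLaw g))

/-- Fourier transform of the deconvolution kernel: `Φ^{K_n}(u) = Φ^g(u/h)⁻¹ I[|u| ≤ 1]`. -/
def cfKernel (g : ℝ → ℝ) (h u : ℝ) : ℂ :=
  (cf g (u / h))⁻¹ * (if |u| ≤ 1 then 1 else 0)

/-- The inverse Fourier transform `x ↦ (2π)⁻¹ ∫ e^{-ixu} Φ^{K_n}(u) du`. -/
def kernelC (g : ℝ → ℝ) (h x : ℝ) : ℂ :=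
  ((2 * Real.pi : ℝ) : ℂ)⁻¹ *
    ∫ u : ℝ, Complex.exp (-(Complex.I * ((x * u : ℝ) : ℂ))) * cfKernel g h u

/-- The deconvolution kernel `K_n` as a real function; `kernelC` is real-valued, see
`ofReal_kernel`. -/
def kernel (g : ℝ → ℝ) (h x : ℝ) : ℝ := (kernelC g h x).re

lemma conj_cf (f : ℝ → ℝ) (u : ℝ) : (starRingEnd ℂ) (cf f u) = cf f (-u) := by
  unfold cf
  rw [← integral_conj]
  congr 1
  funext x
  simp [← Complex.exp_conj]

lemma conj_kernelC (g : ℝ → ℝ) (h x : ℝ) :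
    (starRingEnd ℂ) (kernelC g h x) = kernelC g h x := by
  unfold kernelC
  rw [map_mul, ← integral_conj]
  congr 1
  · rw [map_inv₀, Complex.conj_ofReal]
  · rw [← integral_neg_eq_self]
    congr 1
    funext u
    simp only [cfKernel, map_mul, map_inv₀, conj_cf, ← Complex.exp_conj]
    congr 2
    · simp
    · simp [neg_div]
    · split_ifs <;> simp_all

lemma ofReal_kernel (g : ℝ → ℝ) (h x : ℝ) : ((kernel g h x : ℝ) : ℂ) = kernelC g h x :=
  Complex.conj_eq_iff_re.1 (conj_kernelC g h x)

/-- The rescaled kernel `K_{n,h}(x) = h⁻¹ K_n(x / h)`. -/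
def scaledKernel (g : ℝ → ℝ) (h x : ℝ) : ℝ := h⁻¹ * kernel g h (x / h)

/-- The test statistic
`T_n^* = (n(n-1))⁻¹ ∑_{k ≠ j} ⟨K_{n,h}(· - Y_k) - f₀, K_{n,h}(· - Y_j) - f₀⟩`. -/
def testStat (g f₀ : ℝ → ℝ) (h : ℝ) (n : ℕ) (Y : Fin n → ℝ) : ℝ :=
  ((n : ℝ) * ((n : ℝ) - 1))⁻¹ *
    ∑ k : Fin n, ∑ j : Fin n, if k ≠ j then
      ∫ x : ℝ, (scaledKernel g h (x - Y k) - f₀ x) * (scaledKernel g h (x - Y j) - f₀ x)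
    else 0

/-- Rejection region `{Δ_n^* = 1}` of the test `Δ_n^* = I[|T_n^*| > κ t²]`. -/
def rejectionRegion (g f₀ : ℝ → ℝ) (h t κ : ℝ) (n : ℕ) : Set (Fin n → ℝ) :=
  {Y | κ * t ^ 2 < |testStat g f₀ h n Y|}

/-- The alternative `H₁(C, ψ)` over a smoothness class `F`. -/
def alternative (F : Set (ℝ → ℝ)) (f₀ : ℝ → ℝ) (C ψ : ℝ) : Set (ℝ → ℝ) :=
  {f | f ∈ F ∧ C * ψ ^ 2 ≤ ∫ x : ℝ, (f x - f₀ x) ^ 2}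

/-- `P_{f₀}[Δ_n = 1] + sup_{f ∈ H₁(C, ψ)} P_f[Δ_n = 0]` for the test with rejection region
`R = {Δ_n = 1}`. -/
def testingRisk (F : Set (ℝ → ℝ)) (g f₀ : ℝ → ℝ) (C ψ : ℝ) (n : ℕ) (R : Set (Fin n → ℝ)) :
    ℝ≥0∞ :=
  obsLaw g f₀ n R + ⨆ f ∈ alternative F f₀ C ψ, obsLaw g f n Rᶜ

/-- The sequence of tests with (measurable) rejection regions `R n` attains the testing rate `ψ` at
level `ξ`. -/
def AttainsTestingRate (F : Set (ℝ → ℝ)) (g f₀ : ℝ → ℝ) (ξ : ℝ) (ψ : ℕ → ℝ)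
    (R : (n : ℕ) → Set (Fin n → ℝ)) : Prop :=
  (∀ n, MeasurableSet (R n)) ∧
  ∃ Cup : ℝ, 0 < Cup ∧ ∀ C : ℝ, Cup < C →
    limsup (fun n : ℕ => testingRisk F g f₀ C (ψ n) n (R n)) atTop ≤ ENNReal.ofReal ξ

/-- The minimax lower bound for the testing rate `ψ` at level `ξ`; the infimum is over all tests,
identified with their measurable rejection regions. -/
def TestingLowerBound (F : Set (ℝ → ℝ)) (g f₀ : ℝ → ℝ) (ξ : ℝ) (ψ : ℕ → ℝ) : Prop :=
  ∃ Clow : ℝ, 0 < Clow ∧ ∀ C : ℝ, 0 < C → C < Clow →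
    ENNReal.ofReal ξ ≤
      liminf (fun n : ℕ => ⨅ R : {R : Set (Fin n → ℝ) // MeasurableSet R},
        testingRisk F g f₀ C (ψ n) n R.1) atTop

/-- The bandwidth `h_* = n^{-2/(4β+4σ+1)}`. -/
def bandwidth (β σ : ℝ) (n : ℕ) : ℝ := (n : ℝ) ^ (-2 / (4 * β + 4 * σ + 1))

/-- The threshold and testing rate `t_n = ψ_n = n^{-2β/(4β+4σ+1)}`. -/
def testingRate (β σ : ℝ) (n : ℕ) : ℝ := (n : ℝ) ^ (-(2 * β) / (4 * β + 4 * σ + 1))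

end NoisyTesting

end

/-! Upper bound. On the Fourier side the kernel of `testStat` divides by the characteristic function
of the noise and cuts off at |u| ≤ 1/h. The statistic is therefore an order-two U-statistic with
mean m = `truncBias f f₀ h`, the squared L² distance from f₀ to the low-frequency part of f. Under
the null hypothesis m is a Sobolev tail, at most L₀ h^{2β} = L₀ t² (`truncBias_self_le`); under the
alternative m ≥ (C/2 - L) t² (`truncBias_null_le`). Hoeffding's decomposition bounds the variance by
a linear part of order n⁻¹ h^{-2σ} m and a degenerate part of order n⁻² h^{-4σ-1}
(`integral_kernel_uStatistic_sub_sq_le`). Both rest on `integral_norm_sq_fourierInv_le`: second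
moments of a Fourier integral under the law of Y cost only the L¹ norm of the characteristic
function of Y, which is at most ∫|Φ_g|, finite since σ > 1 and independent of f. The bandwidth
balances n⁻² h^{-4σ-1} with t⁴, and Chebyshev's inequality with κ and C large makes each error at
most ξ/2.

Lower bound. The null density is tested against the uniform mixture, over sign vectors θ, of f₀ + a
∑ θ_j G(x/h - j), with M ≈ 1/h terms, a of order √C ψ, and G a Schwartz function whose Fourier
transform is a window supported in 1 ≤ |v| ≤ 4. The transform of a perturbation is a window times a
trigonometric polynomial, so Parseval over whole periods shows that its squared L² norm is
comparable to h ∑ θ_j². All its frequencies exceed 1/h, so convolution with g damps it by h^σ; the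
bound on the derivative of Φ_g gives the same damping in the weight 1 + x², and the tail condition
says that this weight dominates 1/(g∗f₀) up to a constant (`exists_integral_smear_pert_le`,
`integral_relPert_sq_le`).

Hence the Gram matrix B of the relative perturbations satisfies 0 ≤ B ≤ λ with λ of order a²
h^{2σ+1}. The terms need not be orthogonal: averaging over signs already bounds the χ²-divergence of
the mixture by exp(n²λ²M/2) - 1 (`sum_sum_exp_form_le`), and n²λ²M is of order C². For small C this
is at most (1 - ξ)², so every test has risk at least ξ at some θ. The perturbations are smooth, so
the restricted statement comes directly and the other one by monotonicity. -/

namespace NoisyTesting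

open FourierTransform SchwartzMap ComplexInnerProductSpace

/-! ### Plancherel's theorem for Fourier integrals on L¹ ∩ L². -/

section Plancherel

/-- The multiplication formula is how the distributional transform, which governs the L² transform,
is compared with the Fourier integral. -/
lemma integral_schwartz_mul_fourier (φ : 𝓢(ℝ, ℂ)) {f : ℝ → ℂ} (hf : Integrable f) :
    ∫ x, (𝓕 φ : 𝓢(ℝ, ℂ)) x • f x = ∫ x, φ x • 𝓕 f x := by
  have h := VectorFourier.integral_fourierIntegral_smul_eq_flip (μ := (volume : Measure ℝ))
    (ν := (volume : Measure ℝ)) (L := innerₗ ℝ) (f := (φ : ℝ → ℂ)) (g := f)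
    Real.continuous_fourierChar continuous_inner φ.integrable hf
  rw [flip_innerₗ] at h
  exact h

lemma continuous_fourier {f : ℝ → ℂ} (hf : Integrable f) : Continuous (𝓕 f) :=
  VectorFourier.fourierIntegral_continuous Real.continuous_fourierChar
    continuous_inner hf

/-- On `L¹ ∩ L²` the `L²` Fourier transform is given by the Fourier integral. -/
lemma coeFn_fourier_toLp {f : ℝ → ℂ} (h1 : Integrable f) (h2 : MemLp f 2) :
    ((𝓕 (h2.toLp f) : Lp ℂ 2 (volume : Measure ℝ)) : ℝ → ℂ) =ᵐ[volume] 𝓕 f := by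
  -- Both sides are locally integrable, so it suffices to test against smooth compactly supported
  -- functions, where each side becomes a pairing of f with the transform of the test function.
  apply ae_eq_of_integral_contDiff_smul_eq
  · exact (Lp.memLp _).locallyIntegrable (by norm_num)
  · exact (continuous_fourier h1).locallyIntegrable
  · intro φ hφ hc
    have hg₁ : HasCompactSupport (Complex.ofRealCLM ∘ φ) := hc.comp_left rfl
    have hg₂ : ContDiff ℝ ((⊤ : ℕ∞)) (Complex.ofRealCLM ∘ φ) := by fun_prop
    set ψ := hg₁.toSchwartzMap hg₂ with hψ
    have hψx : ∀ x, ψ x = (φ x : ℂ) := fun x => by simp [hψ]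
    have key := Lp.fourier_toTemperedDistribution_eq (h2.toLp f)
    have k2 := congrArg (fun T => T ψ) key
    simp only [TemperedDistribution.fourier_apply, Lp.toTemperedDistribution_apply] at k2
    have e1 : ∫ x, φ x • ((𝓕 (h2.toLp f) : Lp ℂ 2 (volume : Measure ℝ)) : ℝ → ℂ) x =
        ∫ x, ψ x • ((𝓕 (h2.toLp f) : Lp ℂ 2 (volume : Measure ℝ)) : ℝ → ℂ) x := by
      refine integral_congr_ae (ae_of_all _ fun x => ?_)
      simp [hψx]
    have e2 : ∫ x, φ x • 𝓕 f x = ∫ x, ψ x • 𝓕 f x := by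
      refine integral_congr_ae (ae_of_all _ fun x => ?_)
      simp [hψx]
    rw [e1, e2, ← k2, ← integral_schwartz_mul_fourier ψ h1]
    refine integral_congr_ae ?_
    filter_upwards [h2.coeFn_toLp] with x hx
    rw [hx]

lemma memLp_fourier {f : ℝ → ℂ} (h1 : Integrable f) (h2 : MemLp f 2) : MemLp (𝓕 f) 2 :=
  (memLp_congr_ae (coeFn_fourier_toLp h1 h2)).1 (Lp.memLp _)

lemma fourier_toLp {f : ℝ → ℂ} (h1 : Integrable f) (h2 : MemLp f 2) :
    𝓕 (h2.toLp f) = (memLp_fourier h1 h2).toLp (𝓕 f) := by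
  ext1
  exact (coeFn_fourier_toLp h1 h2).trans (memLp_fourier h1 h2).coeFn_toLp.symm

lemma integrable_comp_neg {f : ℝ → ℂ} (h : Integrable f) : Integrable (fun x => f (-x)) := h.comp_neg

lemma memLp_comp_neg {f : ℝ → ℂ} (h : MemLp f 2) : MemLp (fun x => f (-x)) 2 :=
  h.comp_measurePreserving (Measure.measurePreserving_neg volume)

lemma memLp_fourierInv {f : ℝ → ℂ} (h1 : Integrable f) (h2 : MemLp f 2) : MemLp (𝓕⁻ f) 2 := by
  rw [Real.fourierInv_eq_fourier_comp_neg]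
  exact memLp_fourier (integrable_comp_neg h1) (memLp_comp_neg h2)

lemma inner_toLp {f g : ℝ → ℂ} (hf : MemLp f 2) (hg : MemLp g 2) :
    ⟪hf.toLp f, hg.toLp g⟫ = ∫ x, (starRingEnd ℂ) (f x) * g x := by
  rw [L2.inner_def]
  refine integral_congr_ae ?_
  filter_upwards [hf.coeFn_toLp, hg.coeFn_toLp] with x h1 h2
  rw [h1, h2]
  simp [mul_comm]

/-- Plancherel's identity in polarised form for functions in `L¹ ∩ L²`. -/
lemma integral_conj_fourier_mul_fourier {f g : ℝ → ℂ} (hf1 : Integrable f) (hf2 : MemLp f 2)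
    (hg1 : Integrable g) (hg2 : MemLp g 2) :
    ∫ x, (starRingEnd ℂ) (𝓕 f x) * 𝓕 g x = ∫ x, (starRingEnd ℂ) (f x) * g x := by
  rw [← inner_toLp hf2 hg2, ← Lp.inner_fourier_eq, fourier_toLp hf1 hf2, fourier_toLp hg1 hg2,
    inner_toLp]

lemma integral_conj_fourierInv_mul_fourierInv {f g : ℝ → ℂ} (hf1 : Integrable f)
    (hf2 : MemLp f 2) (hg1 : Integrable g) (hg2 : MemLp g 2) :
    ∫ x, (starRingEnd ℂ) (𝓕⁻ f x) * 𝓕⁻ g x = ∫ x, (starRingEnd ℂ) (f x) * g x := by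
  rw [← integral_conj_fourier_mul_fourier hf1 hf2 hg1 hg2,
    ← integral_neg_eq_self (fun x => (starRingEnd ℂ) (𝓕 f x) * 𝓕 g x)]
  simp only [Real.fourierInv_eq_fourier_neg]

/-- Pairing an inverse Fourier integral with a function in `L¹ ∩ L²`. -/
lemma integral_conj_fourierInv_mul {f g : ℝ → ℂ} (hf1 : Integrable f)
    (hg1 : Integrable g) :
    ∫ x, (starRingEnd ℂ) (𝓕⁻ f x) * g x = ∫ x, (starRingEnd ℂ) (f x) * 𝓕 g x := by
  have h := VectorFourier.integral_fourierIntegral_smul_eq_flip (μ := (volume : Measure ℝ))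
    (ν := (volume : Measure ℝ)) (L := innerₗ ℝ) (f := fun x => (starRingEnd ℂ) (f x)) (g := g)
    Real.continuous_fourierChar continuous_inner
    ((LinearIsometryEquiv.integrable_comp_iff Complex.conjLIE).2 hf1) hg1
  rw [flip_innerₗ] at h
  change _ = ∫ x, (starRingEnd ℂ) (f x) • 𝓕 g x at h
  simp only [smul_eq_mul] at h
  rw [← h]
  congr 1
  funext x
  congr 1
  rw [Real.fourierInv_eq, ← integral_conj]
  refine integral_congr_ae (ae_of_all _ fun v => ?_)
  simp [Circle.smul_def, ← Circle.coe_inv_eq_conj, AddChar.map_neg_eq_inv]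

lemma integral_norm_sq_fourier {f : ℝ → ℂ} (hf1 : Integrable f) (hf2 : MemLp f 2) :
    ∫ x, ‖𝓕 f x‖ ^ 2 = ∫ x, ‖f x‖ ^ 2 := by
  have h := integral_conj_fourier_mul_fourier hf1 hf2 hf1 hf2
  simp only [Complex.conj_mul'] at h
  exact_mod_cast h

lemma integral_norm_sq_fourierInv {f : ℝ → ℂ} (hf1 : Integrable f) (hf2 : MemLp f 2) :
    ∫ x, ‖𝓕⁻ f x‖ ^ 2 = ∫ x, ‖f x‖ ^ 2 := by
  have h := integral_conj_fourierInv_mul_fourierInv hf1 hf2 hf1 hf2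
  simp only [Complex.conj_mul'] at h
  exact_mod_cast h

end Plancherel

end NoisyTesting

namespace NoisyTesting

/-! ### Variance of U-statistics of order two. -/

section UStatistic

variable {X : Type*} [MeasurableSpace X] {μ : Measure X} [IsProbabilityMeasure μ] {n : ℕ}

/-- Resampling one coordinate preserves a product measure. -/
lemma map_update_prod (k : Fin n) :
    MeasurePreserving (fun p : (Fin n → X) × X => Function.update p.1 k p.2)
      ((Measure.pi fun _ : Fin n => μ).prod μ) (Measure.pi fun _ : Fin n => μ) := by
  have hm : Measurable (fun p : (Fin n → X) × X => Function.update p.1 k p.2) := by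
    refine measurable_pi_lambda _ fun i => ?_
    by_cases h : i = k
    · subst h; simpa using measurable_snd
    · simp only [Function.update_of_ne h]
      exact (measurable_pi_apply i).comp measurable_fst
  refine ⟨hm, (Measure.pi_eq fun s hs => ?_).symm⟩
  rw [Measure.map_apply hm (MeasurableSet.univ_pi hs)]
  have : (fun p : (Fin n → X) × X => Function.update p.1 k p.2) ⁻¹' (Set.univ.pi s) =
      (Set.univ.pi (Function.update s k Set.univ)) ×ˢ s k := by
    ext ⟨y, x⟩
    simp only [Set.mem_preimage, Set.mem_pi, Set.mem_univ, true_implies, Set.mem_prod]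
    constructor
    · intro h
      refine ⟨fun i => ?_, by simpa using h k⟩
      by_cases hi : i = k
      · subst hi; simp
      · simpa [Function.update_of_ne hi] using h i
    · rintro ⟨h1, h2⟩ i
      by_cases hi : i = k
      · subst hi; simpa using h2
      · simpa [Function.update_of_ne hi] using h1 i
  rw [this, Measure.prod_prod, Measure.pi_pi, ← Finset.mul_prod_erase _ _ (Finset.mem_univ k),
    ← Finset.mul_prod_erase _ (fun i => μ (s i)) (Finset.mem_univ k)]
  simp only [Function.update_self, measure_univ, one_mul]
  rw [mul_comm]
  congr 1
  refine Finset.prod_congr rfl fun i hi => ?_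
  rw [Function.update_of_ne (Finset.ne_of_mem_erase hi)]

/-- This is conditioning on all coordinates but one: redraw coordinate k independently, which
preserves the law, and integrate the new value first. -/
lemma integral_pi_eq_zero_of_update {F : (Fin n → X) → ℝ} (hF : Measurable F) {C : ℝ}
    (hC : ∀ y, |F y| ≤ C) (k : Fin n)
    (h : ∀ y, ∫ x, F (Function.update y k x) ∂μ = 0) :
    ∫ y, F y ∂(Measure.pi fun _ : Fin n => μ) = 0 := by
  have mp := map_update_prod (μ := μ) k
  rw [← mp.map_eq, integral_map mp.measurable.aemeasurable hF.aestronglyMeasurable,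
    integral_prod]
  · simp [h]
  · exact Integrable.of_bound (hF.comp mp.measurable).aestronglyMeasurable C
      (ae_of_all _ fun p => by simpa using hC _)

lemma measurePreserving_eval_pair {k j : Fin n} (hkj : k ≠ j) :
    MeasurePreserving (fun y : Fin n → X => (y k, y j)) (Measure.pi fun _ : Fin n => μ)
      (μ.prod μ) := by
  have hi : ProbabilityTheory.iIndepFun (fun (i : Fin n) (y : Fin n → X) => y i)
      (Measure.pi fun _ : Fin n => μ) :=
    ProbabilityTheory.iIndepFun_pi (X := fun _ : Fin n => (id : X → X))
      (fun _ => aemeasurable_id)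
  have h2 := hi.indepFun hkj
  rw [ProbabilityTheory.indepFun_iff_map_prod_eq_prod_map_map
    (measurable_pi_apply k).aemeasurable (measurable_pi_apply j).aemeasurable] at h2
  refine ⟨(measurable_pi_apply k).prodMk (measurable_pi_apply j), ?_⟩
  rw [h2, (measurePreserving_eval (fun _ : Fin n => μ) k).map_eq,
    (measurePreserving_eval (fun _ : Fin n => μ) j).map_eq]

/-- Variance of a sum of independent centred variables. -/
lemma integral_sum_sq {s : X → ℝ} (hs : Measurable s) {C : ℝ} (hC : ∀ x, |s x| ≤ C)
    (h0 : ∫ x, s x ∂μ = 0) :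
    ∫ y, (∑ k, s (y k)) ^ 2 ∂(Measure.pi fun _ : Fin n => μ) = n * ∫ x, s x ^ 2 ∂μ := by
  have hb : ∀ x x' : X, |s x * s x'| ≤ C * C := fun x x' => by
    rw [abs_mul]; exact mul_le_mul (hC _) (hC _) (abs_nonneg _) ((abs_nonneg _).trans (hC x))
  have hm : ∀ k j : Fin n, Measurable fun y : Fin n → X => s (y k) * s (y j) := fun k j =>
    (hs.comp (measurable_pi_apply k)).mul (hs.comp (measurable_pi_apply j))
  have hint : ∀ k j : Fin n, Integrable (fun y : Fin n → X => s (y k) * s (y j))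
      (Measure.pi fun _ : Fin n => μ) := fun k j =>
    Integrable.of_bound (hm k j).aestronglyMeasurable (C * C) (ae_of_all _ fun y => hb _ _)
  simp_rw [sq, Finset.sum_mul_sum]
  rw [integral_finsetSum _ fun k _ => integrable_finsetSum _ fun j _ => hint k j]
  have : ∀ k : Fin n, ∫ y, ∑ j, s (y k) * s (y j) ∂(Measure.pi fun _ : Fin n => μ) =
      ∫ x, s x * s x ∂μ := by
    intro k
    rw [integral_finsetSum _ fun j _ => hint k j, Finset.sum_eq_single k]
    · exact integral_comp_eval (μ := fun _ : Fin n => μ) (i := k) (f := fun x => s x * s x)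
        (hs.mul hs).aestronglyMeasurable
    · intro j _ hj
      refine integral_pi_eq_zero_of_update (hm k j) (fun y => hb _ _) k fun y => ?_
      simp [Function.update_of_ne hj, integral_mul_const, h0]
    · simp
  simp [this]

/-- Second moment of a degenerate U-statistic of order two. -/
lemma integral_sum_offDiag_sq {h : X → X → ℝ} (hm : Measurable (Function.uncurry h)) {C : ℝ}
    (hC : ∀ x y, |h x y| ≤ C) (hsymm : ∀ x y, h x y = h y x) (h0 : ∀ y, ∫ x, h x y ∂μ = 0) :
    ∫ y, (∑ p ∈ Finset.univ.offDiag, h (y p.1) (y p.2)) ^ 2 ∂(Measure.pi fun _ : Fin n => μ) =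
      2 * (n * (n - 1)) * ∫ p, h p.1 p.2 ^ 2 ∂(μ.prod μ) := by
  classical
  have hb : ∀ x x' z z' : X, |h x x' * h z z'| ≤ C * C := fun x x' z z' => by
    rw [abs_mul]
    exact mul_le_mul (hC _ _) (hC _ _) (abs_nonneg _) ((abs_nonneg _).trans (hC x x))
  have hm1 : ∀ p : Fin n × Fin n, Measurable fun y : Fin n → X => h (y p.1) (y p.2) := fun p =>
    Measurable.comp (g := Function.uncurry h) (f := fun y : Fin n → X => (y p.1, y p.2)) hm
      ((measurable_pi_apply p.1).prodMk (measurable_pi_apply p.2))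
  have hm2 : ∀ p q : Fin n × Fin n, Measurable
      fun y : Fin n → X => h (y p.1) (y p.2) * h (y q.1) (y q.2) := fun p q =>
    (hm1 p).mul (hm1 q)
  have hint : ∀ p q : Fin n × Fin n, Integrable
      (fun y : Fin n → X => h (y p.1) (y p.2) * h (y q.1) (y q.2))
      (Measure.pi fun _ : Fin n => μ) := fun p q =>
    Integrable.of_bound (hm2 p q).aestronglyMeasurable (C * C) (ae_of_all _ fun y => hb _ _ _ _)
  have hself : ∀ p : Fin n × Fin n, p.1 ≠ p.2 →
      ∫ y, h (y p.1) (y p.2) * h (y p.1) (y p.2) ∂(Measure.pi fun _ : Fin n => μ) =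
        ∫ p, h p.1 p.2 ^ 2 ∂(μ.prod μ) := by
    intro p hp
    have mp := measurePreserving_eval_pair (μ := μ) hp
    rw [← mp.map_eq, integral_map mp.measurable.aemeasurable
      (f := fun p : X × X => h p.1 p.2 ^ 2) (hm.pow_const 2).aestronglyMeasurable]
    simp [sq]
  -- If q is neither p nor its swap, some index of p does not occur in q; integrating out that
  -- coordinate kills the product by degeneracy.
  have hvan : ∀ p q : Fin n × Fin n, p.1 ≠ p.2 → q.1 ≠ q.2 → q ≠ p → q ≠ p.swap →
      ∫ y, h (y p.1) (y p.2) * h (y q.1) (y q.2) ∂(Measure.pi fun _ : Fin n => μ) = 0 := by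
    rintro ⟨a, b⟩ ⟨c, d⟩ hp hq h1 h2
    simp only [ne_eq, Prod.mk.injEq, Prod.swap_prod_mk, not_and] at h1 h2 hp hq
    by_cases hac : a = c ∨ a = d
    · have hbc : b ≠ c ∧ b ≠ d := by
        rcases hac with rfl | rfl
        · exact ⟨fun e => hp e.symm, fun e => h1 rfl e.symm⟩
        · exact ⟨fun e => h2 e.symm rfl, fun e => hp e.symm⟩
      refine integral_pi_eq_zero_of_update (hm2 (a, b) (c, d)) (fun y => hb _ _ _ _) b fun y => ?_
      simp only [Function.update_of_ne (show a ≠ b from hp), Function.update_of_ne hbc.1.symm,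
        Function.update_of_ne hbc.2.symm, Function.update_self, integral_mul_const]
      simp [hsymm (y a), h0]
    · push Not at hac
      refine integral_pi_eq_zero_of_update (hm2 (a, b) (c, d)) (fun y => hb _ _ _ _) a fun y => ?_
      simp only [Function.update_of_ne (show b ≠ a from fun e => hp e.symm),
        Function.update_of_ne hac.1.symm,
        Function.update_of_ne hac.2.symm, Function.update_self, integral_mul_const]
      simp [h0]
  simp_rw [sq (∑ _ ∈ _, _), Finset.sum_mul_sum]
  rw [integral_finsetSum _ fun p _ => integrable_finsetSum _ fun q _ => hint p q]
  have : ∀ p ∈ (Finset.univ : Finset (Fin n)).offDiag,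
      ∫ y, ∑ q ∈ (Finset.univ : Finset (Fin n)).offDiag, h (y p.1) (y p.2) * h (y q.1) (y q.2)
        ∂(Measure.pi fun _ : Fin n => μ) = 2 * ∫ p, h p.1 p.2 ^ 2 ∂(μ.prod μ) := by
    intro p hp
    rw [Finset.mem_offDiag] at hp
    have hp' := hp.2.2
    rw [integral_finsetSum _ fun q _ => hint p q]
    -- For fixed p only q = p and q = p.swap survive, and they contribute equally: this is the
    -- factor 2.
    have hsub : ({p, p.swap} : Finset (Fin n × Fin n)) ⊆ Finset.univ.offDiag := by
      intro q hq
      rw [Finset.mem_insert, Finset.mem_singleton] at hq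
      rcases hq with rfl | rfl
      · simpa using hp'
      · simpa using hp'.symm
    rw [← Finset.sum_subset hsub, Finset.sum_pair]
    · have : ∀ y : Fin n → X, h (y p.swap.1) (y p.swap.2) = h (y p.1) (y p.2) := fun y => by
        simp [hsymm]
      simp only [this, hself p hp']
      ring
    · intro e
      exact hp' (by simpa using congrArg Prod.fst e)
    · intro q hq hq'
      simp only [Finset.mem_insert, Finset.mem_singleton, not_or] at hq'
      exact hvan p q hp' (Finset.mem_offDiag.1 hq).2.2 hq'.1 hq'.2
  rw [Finset.sum_congr rfl this, Finset.sum_const, Finset.offDiag_card, Finset.card_univ,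
    Fintype.card_fin, nsmul_eq_mul, Nat.cast_sub (Nat.le_mul_self n)]
  push_cast
  ring

/-- The degenerate part of a symmetric kernel has second moment at most that of any kernel which
differs from it by functions of a single variable. -/
lemma integral_degenerate_sq_le {h B : X → X → ℝ} {φ ψ : X → ℝ}
    (hm : Measurable (Function.uncurry h)) {C : ℝ} (hC : ∀ x y, |h x y| ≤ C)
    (hsymm : ∀ x y, h x y = h y x) (h0 : ∀ y, ∫ x, h x y ∂μ = 0)
    (hBm : Measurable (Function.uncurry B)) {C' : ℝ} (hB : ∀ x y, |B x y| ≤ C')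
    (hφ : Measurable φ) {C₁ : ℝ} (hφC : ∀ x, |φ x| ≤ C₁)
    (hψ : Measurable ψ) {C₂ : ℝ} (hψC : ∀ x, |ψ x| ≤ C₂)
    (hdec : ∀ x y, h x y = B x y + φ x + ψ y) :
    ∫ p, h p.1 p.2 ^ 2 ∂(μ.prod μ) ≤ ∫ p, B p.1 p.2 ^ 2 ∂(μ.prod μ) := by
  have hmul : ∀ {a b A A' : ℝ}, |a| ≤ A → |b| ≤ A' → |a * b| ≤ A * A' := fun {a b A A'} ha hb => by
    rw [abs_mul]; exact mul_le_mul ha hb (abs_nonneg _) ((abs_nonneg _).trans ha)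
  have hm' : Measurable fun p : X × X => h p.1 p.2 := hm
  have hBm' : Measurable fun p : X × X => B p.1 p.2 := hBm
  have iφ : Integrable (fun p : X × X => h p.1 p.2 * φ p.1) (μ.prod μ) :=
    Integrable.of_bound (hm'.mul (hφ.comp measurable_fst)).aestronglyMeasurable (C * C₁)
      (ae_of_all _ fun p => hmul (hC _ _) (hφC _))
  have iψ : Integrable (fun p : X × X => h p.1 p.2 * ψ p.2) (μ.prod μ) :=
    Integrable.of_bound (hm'.mul (hψ.comp measurable_snd)).aestronglyMeasurable (C * C₂)
      (ae_of_all _ fun p => hmul (hC _ _) (hψC _))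
  have iB : Integrable (fun p : X × X => h p.1 p.2 * B p.1 p.2) (μ.prod μ) :=
    Integrable.of_bound (hm'.mul hBm').aestronglyMeasurable (C * C')
      (ae_of_all _ fun p => hmul (hC _ _) (hB _ _))
  have iBB : Integrable (fun p : X × X => B p.1 p.2 ^ 2) (μ.prod μ) :=
    Integrable.of_bound (hBm'.pow_const 2).aestronglyMeasurable (C' * C')
      (ae_of_all _ fun p => by rw [sq]; exact hmul (hB _ _) (hB _ _))
  have ihh : Integrable (fun p : X × X => h p.1 p.2 ^ 2) (μ.prod μ) :=
    Integrable.of_bound (hm'.pow_const 2).aestronglyMeasurable (C * C)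
      (ae_of_all _ fun p => by rw [sq]; exact hmul (hC _ _) (hC _ _))
  have zφ : ∫ p, h p.1 p.2 * φ p.1 ∂(μ.prod μ) = 0 := by
    rw [integral_prod _ iφ]
    simp only [integral_mul_const]
    refine integral_eq_zero_of_ae (ae_of_all _ fun x => ?_)
    have : ∫ y, h x y ∂μ = 0 := by rw [← h0 x]; exact integral_congr_ae (ae_of_all _ fun y => hsymm _ _)
    simp [this]
  have zψ : ∫ p, h p.1 p.2 * ψ p.2 ∂(μ.prod μ) = 0 := by
    rw [integral_prod_symm _ iψ]
    simp only [integral_mul_const]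
    simp [h0]
  -- A degenerate kernel is orthogonal to functions of one variable, so h is the orthogonal
  -- projection of B and cannot have larger norm.
  have e1 : ∫ p, h p.1 p.2 ^ 2 ∂(μ.prod μ) = ∫ p, h p.1 p.2 * B p.1 p.2 ∂(μ.prod μ) := by
    have : ∀ p : X × X, h p.1 p.2 ^ 2 =
        h p.1 p.2 * B p.1 p.2 + h p.1 p.2 * φ p.1 + h p.1 p.2 * ψ p.2 := fun p => by
      rw [sq]; nth_rewrite 2 [hdec]; ring
    simp only [this]
    rw [integral_add (by exact iB.add iφ) iψ, integral_add iB iφ, zφ, zψ, add_zero, add_zero]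
  have e2 : ∫ p, h p.1 p.2 * B p.1 p.2 ∂(μ.prod μ) ≤
      ∫ p, (1 / 2 * h p.1 p.2 ^ 2 + 1 / 2 * B p.1 p.2 ^ 2) ∂(μ.prod μ) := by
    refine integral_mono iB ((ihh.const_mul _).add (iBB.const_mul _)) fun p => ?_
    dsimp only
    nlinarith [sq_nonneg (h p.1 p.2 - B p.1 p.2)]
  rw [integral_add (ihh.const_mul _) (iBB.const_mul _), integral_const_mul, integral_const_mul,
    ← e1] at e2
  linarith

/-- Variance bound for a U-statistic of order two with Hoeffding decomposition
`H x y = m + s x + s y + h x y`. -/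
lemma integral_uStatistic_sub_sq_le (hn : 2 ≤ n) {H h : X → X → ℝ} {s : X → ℝ} {m : ℝ}
    (hm : Measurable (Function.uncurry h)) {C : ℝ}
    (hC : ∀ x y, |h x y| ≤ C) (hsymm : ∀ x y, h x y = h y x) (h0 : ∀ y, ∫ x, h x y ∂μ = 0)
    (hs : Measurable s) {C' : ℝ} (hsC : ∀ x, |s x| ≤ C') (hs0 : ∫ x, s x ∂μ = 0)
    (hH : ∀ x y, H x y = m + s x + s y + h x y) :
    Integrable (fun y : Fin n → X => (((n : ℝ) * ((n : ℝ) - 1))⁻¹ *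
        ∑ k : Fin n, ∑ j : Fin n, (if k ≠ j then H (y k) (y j) else 0) - m) ^ 2)
        (Measure.pi fun _ : Fin n => μ) ∧
    ∫ y, (((n : ℝ) * ((n : ℝ) - 1))⁻¹ *
        ∑ k : Fin n, ∑ j : Fin n, (if k ≠ j then H (y k) (y j) else 0) - m) ^ 2
        ∂(Measure.pi fun _ : Fin n => μ) ≤
      8 / n * ∫ x, s x ^ 2 ∂μ + 4 / (n * (n - 1)) * ∫ p, h p.1 p.2 ^ 2 ∂(μ.prod μ) := by
  classical
  have hn' : (2 : ℝ) ≤ n := by exact_mod_cast hn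
  have hn0 : (0 : ℝ) < n := by linarith
  have hn1 : (0 : ℝ) < (n : ℝ) - 1 := by linarith
  -- Each index lies in 2(n-1) ordered pairs, hence the weight 2/n on the linear part.
  have hT : ∀ y : Fin n → X, ((n : ℝ) * ((n : ℝ) - 1))⁻¹ *
        ∑ k : Fin n, ∑ j : Fin n, (if k ≠ j then H (y k) (y j) else 0) - m =
      2 / n * ∑ k, s (y k) +
        ((n : ℝ) * ((n : ℝ) - 1))⁻¹ * ∑ p ∈ Finset.univ.offDiag, h (y p.1) (y p.2) := by
    intro y
    have e1 : ∑ k : Fin n, ∑ j : Fin n, (if k ≠ j then H (y k) (y j) else 0) =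
        ∑ p ∈ Finset.univ.offDiag, H (y p.1) (y p.2) := by
      rw [← Finset.sum_product', ← Finset.sum_filter]
      refine Finset.sum_congr ?_ fun _ _ => rfl
      ext p; simp
    have e2 : ∀ a : Fin n → ℝ, ∑ p ∈ (Finset.univ : Finset (Fin n)).offDiag, a p.1 =
        (n - 1) * ∑ k, a k := by
      intro a
      have h1 := Finset.sum_union (f := fun p : Fin n × Fin n => a p.1)
        (Finset.disjoint_diag_offDiag (Finset.univ : Finset (Fin n)))
      rw [Finset.diag_union_offDiag, Finset.sum_product, Finset.sum_diag] at h1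
      simp only [Finset.sum_const, Finset.card_univ, Fintype.card_fin, nsmul_eq_mul,
        ← Finset.mul_sum] at h1
      linarith
    have e3 : ∀ a : Fin n → ℝ, ∑ p ∈ (Finset.univ : Finset (Fin n)).offDiag, a p.2 =
        (n - 1) * ∑ k, a k := by
      intro a
      have h1 := Finset.sum_union (f := fun p : Fin n × Fin n => a p.2)
        (Finset.disjoint_diag_offDiag (Finset.univ : Finset (Fin n)))
      rw [Finset.diag_union_offDiag, Finset.sum_product, Finset.sum_diag] at h1
      simp only [Finset.sum_const, Finset.card_univ, Fintype.card_fin, nsmul_eq_mul] at h1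
      linarith
    have e4 := e2 fun _ => m
    have e5 : ∑ _k : Fin n, m = n * m := by simp
    rw [e5] at e4
    rw [e1]
    simp only [hH, Finset.sum_add_distrib]
    rw [e4, e2 fun k => s (y k), e3 fun k => s (y k)]
    field_simp
    ring
  simp only [hT]
  have hm1 : Measurable fun y : Fin n → X =>
      ∑ p ∈ (Finset.univ : Finset (Fin n)).offDiag, h (y p.1) (y p.2) :=
    Finset.measurable_fun_sum _ fun p _ =>
      Measurable.comp (g := Function.uncurry h) (f := fun y : Fin n → X => (y p.1, y p.2)) hm
        ((measurable_pi_apply p.1).prodMk (measurable_pi_apply p.2))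
  have hm2 : Measurable fun y : Fin n → X => ∑ k, s (y k) :=
    Finset.measurable_fun_sum _ fun p _ => hs.comp (measurable_pi_apply p)
  have b1 : ∀ y : Fin n → X, |∑ p ∈ (Finset.univ : Finset (Fin n)).offDiag, h (y p.1) (y p.2)| ≤
      ∑ p ∈ (Finset.univ : Finset (Fin n)).offDiag, C := fun y =>
    (Finset.abs_sum_le_sum_abs _ _).trans (Finset.sum_le_sum fun _ _ => hC _ _)
  have b2 : ∀ y : Fin n → X, |∑ k, s (y k)| ≤ ∑ k : Fin n, C' := fun y =>
    (Finset.abs_sum_le_sum_abs _ _).trans (Finset.sum_le_sum fun _ _ => hsC _)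
  have sqb : ∀ {a b : ℝ}, |a| ≤ b → |a ^ 2| ≤ b ^ 2 := fun {a b} hab => by
    rw [abs_pow]; exact pow_le_pow_left₀ (abs_nonneg _) hab 2
  have i1 : Integrable (fun y : Fin n → X =>
      (∑ p ∈ (Finset.univ : Finset (Fin n)).offDiag, h (y p.1) (y p.2)) ^ 2)
      (Measure.pi fun _ : Fin n => μ) :=
    Integrable.of_bound (hm1.pow_const 2).aestronglyMeasurable _
      (ae_of_all _ fun y => sqb (b1 y))
  have i2 : Integrable (fun y : Fin n → X => (∑ k, s (y k)) ^ 2)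
      (Measure.pi fun _ : Fin n => μ) :=
    Integrable.of_bound (hm2.pow_const 2).aestronglyMeasurable _
      (ae_of_all _ fun y => sqb (b2 y))
  -- The crude bound (a + b)² ≤ 2a² + 2b² spares the orthogonality of the two parts; it only doubles
  -- the constants, to 8 and 4.
  have le : ∀ y : Fin n → X, (2 / n * ∑ k, s (y k) +
        ((n : ℝ) * ((n : ℝ) - 1))⁻¹ * ∑ p ∈ Finset.univ.offDiag, h (y p.1) (y p.2)) ^ 2 ≤
      2 * (2 / n) ^ 2 * (∑ k, s (y k)) ^ 2 + 2 * (((n : ℝ) * ((n : ℝ) - 1))⁻¹) ^ 2 *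
        (∑ p ∈ Finset.univ.offDiag, h (y p.1) (y p.2)) ^ 2 := by
    intro y
    have := sq_nonneg (2 / n * ∑ k, s (y k) -
        ((n : ℝ) * ((n : ℝ) - 1))⁻¹ * ∑ p ∈ Finset.univ.offDiag, h (y p.1) (y p.2))
    nlinarith
  have i3 := (i2.const_mul (2 * (2 / n) ^ 2)).add
    (i1.const_mul (2 * (((n : ℝ) * ((n : ℝ) - 1))⁻¹) ^ 2))
  have i4 : Integrable (fun y : Fin n → X => (2 / n * ∑ k, s (y k) +
        ((n : ℝ) * ((n : ℝ) - 1))⁻¹ * ∑ p ∈ Finset.univ.offDiag, h (y p.1) (y p.2)) ^ 2)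
      (Measure.pi fun _ : Fin n => μ) :=
    i3.mono' (((hm2.const_mul _).add (hm1.const_mul _)).pow_const 2).aestronglyMeasurable
      (ae_of_all _ fun y => by
        rw [Real.norm_eq_abs, abs_of_nonneg (sq_nonneg _)]
        exact le y)
  refine ⟨i4, (integral_mono i4 i3 le).trans ?_⟩
  simp only [Pi.add_apply]
  rw [integral_add (i2.const_mul _) (i1.const_mul _), integral_const_mul, integral_const_mul,
    integral_sum_sq hs hsC hs0, integral_sum_offDiag_sq hm hC hsymm h0]
  refine le_of_eq ?_
  field_simp
  ring

end UStatistic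

end NoisyTesting

namespace NoisyTesting

open FourierTransform

/-! ### Moments of Fourier integrals under a probability law. -/

section FourierMoments

/-- The additive character `t ↦ e^{2πit}`. -/
noncomputable def expi (t : ℝ) : ℂ := Complex.exp (((2 * Real.pi * t : ℝ) : ℂ) * Complex.I)

lemma expi_add (s t : ℝ) : expi (s + t) = expi s * expi t := by
  rw [expi, expi, expi, ← Complex.exp_add]
  congr 1
  push_cast
  ring

@[simp] lemma expi_zero : expi 0 = 1 := by simp [expi]

lemma conj_expi (t : ℝ) : (starRingEnd ℂ) (expi t) = expi (-t) := by
  rw [expi, expi, ← Complex.exp_conj]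
  rw [map_mul, Complex.conj_ofReal, Complex.conj_I]
  congr 1
  push_cast
  ring

@[simp] lemma norm_expi (t : ℝ) : ‖expi t‖ = 1 := Complex.norm_exp_ofReal_mul_I _

@[fun_prop] lemma continuous_expi : Continuous expi := by
  unfold expi
  fun_prop

lemma fourierChar_smul (t : ℝ) (z : ℂ) : Real.fourierChar t • z = expi t * z := by
  rw [Circle.smul_def, smul_eq_mul, Real.fourierChar_apply, expi]

/-- The function `v ↦ ∫ e^{2πivy} dμ(y)`. -/
noncomputable def chf (μ : Measure ℝ) (v : ℝ) : ℂ := charFun μ (2 * Real.pi * v)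

lemma chf_eq (μ : Measure ℝ) (v : ℝ) : chf μ v = ∫ y, expi (v * y) ∂μ := by
  rw [chf, charFun_apply_real]
  refine integral_congr_ae (ae_of_all _ fun y => ?_)
  simp only [expi]
  congr 1
  push_cast
  ring

lemma continuous_chf (μ : Measure ℝ) [IsProbabilityMeasure μ] : Continuous (chf μ) :=
  continuous_charFun.comp (continuous_const.mul continuous_id)

lemma norm_chf_le (μ : Measure ℝ) [IsProbabilityMeasure μ] (v : ℝ) : ‖chf μ v‖ ≤ 1 :=
  norm_charFun_le_one _

lemma conj_chf (μ : Measure ℝ) (v : ℝ) : (starRingEnd ℂ) (chf μ v) = chf μ (-v) := by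
  rw [chf, chf, ← charFun_neg]
  congr 1
  ring

lemma continuous_fourierInv {b : ℝ → ℂ} (hb : Integrable b) : Continuous (𝓕⁻ b) := by
  rw [Real.fourierInv_eq_fourier_comp_neg]
  exact continuous_fourier hb.comp_neg

lemma fourierInv_real_eq (b : ℝ → ℂ) (y : ℝ) :
    𝓕⁻ b y = ∫ v, expi (v * y) * b v := by
  rw [Real.fourierInv_eq]
  refine integral_congr_ae (ae_of_all _ fun v => ?_)
  simp [fourierChar_smul, mul_comm y v]

lemma norm_fourierInv_le (b : ℝ → ℂ) (y : ℝ) : ‖𝓕⁻ b y‖ ≤ ∫ v, ‖b v‖ := by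
  rw [fourierInv_real_eq]
  refine (norm_integral_le_integral_norm _).trans (le_of_eq ?_)
  simp

lemma integrable_fourierInv {μ : Measure ℝ} [IsProbabilityMeasure μ] {b : ℝ → ℂ}
    (hb : Integrable b) : Integrable (𝓕⁻ b) μ :=
  Integrable.of_bound (continuous_fourierInv hb).aestronglyMeasurable _
    (ae_of_all _ fun y => norm_fourierInv_le b y)

lemma integral_fourierInv {μ : Measure ℝ} [IsProbabilityMeasure μ] {b : ℝ → ℂ}
    (hb : Integrable b) : ∫ y, 𝓕⁻ b y ∂μ = ∫ v, chf μ v * b v := by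
  simp only [fourierInv_real_eq, chf_eq]
  rw [integral_integral_swap]
  · simp only [integral_mul_const]
  · have : Integrable (fun p : ℝ × ℝ => b p.2) (μ.prod volume) := hb.comp_snd μ
    refine this.bdd_mul (c := 1) (Continuous.aestronglyMeasurable ?_) (ae_of_all _ fun p => by simp)
    fun_prop

/-- Expanding the square and integrating over y first leaves the double integral of χ(v - v') b(v)
conj(b(v')). The bound |b(v) b(v')| ≤ (|b(v)|² + |b(v')|²)/2 then separates the variables, as in
Schur's test. This replaces a sup bound on the density of μ by the L¹ norm of its characteristic
function. -/
lemma integral_norm_sq_fourierInv_le {μ : Measure ℝ} [IsProbabilityMeasure μ] {b : ℝ → ℂ}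
    (hb : Integrable b) (hb2 : Integrable fun v => ‖b v‖ ^ 2) (hX : Integrable (chf μ)) :
    ∫ y, ‖𝓕⁻ b y‖ ^ 2 ∂μ ≤ (∫ v, ‖b v‖ ^ 2) * ∫ v, ‖chf μ v‖ := by
  have hbb : Integrable (fun p : ℝ × ℝ => b p.1 * (starRingEnd ℂ) (b p.2))
      (volume.prod volume) :=
    hb.mul_prod ((LinearIsometryEquiv.integrable_comp_iff Complex.conjLIE).2 hb)
  have e1 : ∀ y, ((‖𝓕⁻ b y‖ ^ 2 : ℝ) : ℂ) = ∫ p : ℝ × ℝ,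
      expi ((p.1 - p.2) * y) * (b p.1 * (starRingEnd ℂ) (b p.2))
        ∂(volume.prod volume) := by
    intro y
    push_cast
    rw [← Complex.mul_conj', fourierInv_real_eq, ← integral_conj, ← integral_prod_mul]
    refine integral_congr_ae (ae_of_all _ fun p => ?_)
    dsimp only
    rw [map_mul, conj_expi, sub_mul, sub_eq_add_neg, expi_add]
    ring
  have e2 : ((∫ y, ‖𝓕⁻ b y‖ ^ 2 ∂μ : ℝ) : ℂ) = ∫ p : ℝ × ℝ,
      chf μ (p.1 - p.2) * (b p.1 * (starRingEnd ℂ) (b p.2)) ∂(volume.prod volume) := by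
    rw [← integral_complex_ofReal]
    simp only [e1]
    rw [integral_integral_swap]
    · simp only [integral_mul_const, chf_eq]
    · have := hbb.comp_snd μ
      refine this.bdd_mul (c := 1) (Continuous.aestronglyMeasurable ?_)
        (ae_of_all _ fun p => by simp)
      fun_prop
  have c1 := Integrable.convolution_integrand (ContinuousLinearMap.mul ℝ ℝ) (μ := volume)
    (ν := volume) hb2 hX.norm
  have c1' : Integrable (fun p : ℝ × ℝ => ‖b p.2‖ ^ 2 * ‖chf μ (p.1 - p.2)‖)
    (volume.prod volume) := c1
  have c2' : Integrable (fun p : ℝ × ℝ => ‖b p.1‖ ^ 2 * ‖chf μ (p.1 - p.2)‖)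
      (volume.prod volume) := by
    refine c1'.swap.congr (ae_of_all _ fun p => ?_)
    simp only [Function.comp, Prod.fst_swap, Prod.snd_swap]
    rw [← neg_sub p.1 p.2, ← conj_chf, RCLike.norm_conj]
  have v1 : ∫ p : ℝ × ℝ, ‖b p.2‖ ^ 2 * ‖chf μ (p.1 - p.2)‖ ∂(volume.prod volume) =
      (∫ v, ‖b v‖ ^ 2) * ∫ v, ‖chf μ v‖ := by
    rw [integral_prod_symm _ c1']
    simp only [integral_const_mul]
    simp only [integral_sub_right_eq_self (fun v => ‖chf μ v‖)]
    rw [integral_mul_const]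
  have v2 : ∫ p : ℝ × ℝ, ‖b p.1‖ ^ 2 * ‖chf μ (p.1 - p.2)‖ ∂(volume.prod volume) =
      (∫ v, ‖b v‖ ^ 2) * ∫ v, ‖chf μ v‖ := by
    rw [integral_prod _ c2']
    simp only [integral_const_mul]
    simp only [integral_sub_left_eq_self (fun v => ‖chf μ v‖)]
    rw [integral_mul_const]
  have e3 : ∫ y, ‖𝓕⁻ b y‖ ^ 2 ∂μ ≤ ∫ p : ℝ × ℝ, (1 / 2 * (‖b p.2‖ ^ 2 * ‖chf μ (p.1 - p.2)‖) +
      1 / 2 * (‖b p.1‖ ^ 2 * ‖chf μ (p.1 - p.2)‖)) ∂(volume.prod volume) := by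
    have h0 : 0 ≤ ∫ y, ‖𝓕⁻ b y‖ ^ 2 ∂μ := integral_nonneg fun y => by positivity
    have h1 : ∫ y, ‖𝓕⁻ b y‖ ^ 2 ∂μ = ‖((∫ y, ‖𝓕⁻ b y‖ ^ 2 ∂μ : ℝ) : ℂ)‖ := by
      rw [Complex.norm_real, Real.norm_of_nonneg h0]
    rw [h1, e2]
    refine norm_integral_le_of_norm_le ((c1'.const_mul _).add (c2'.const_mul _))
      (ae_of_all _ fun p => ?_)
    simp only [norm_mul, RCLike.norm_conj]
    nlinarith [mul_nonneg (norm_nonneg (chf μ (p.1 - p.2))) (sq_nonneg (‖b p.1‖ - ‖b p.2‖))]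
  rw [integral_add (c1'.const_mul _) (c2'.const_mul _), integral_const_mul, integral_const_mul,
    v1, v2] at e3
  linarith

end FourierMoments

/-! ### Characteristic functions of densities and of noisy observations. -/

section Densities

lemma IsDensity.integrable {f : ℝ → ℝ} (hf : IsDensity f) : Integrable f :=
  Integrable.of_integral_ne_zero (by rw [hf.integral_eq_one]; exact one_ne_zero)

lemma IsDensity.isProbabilityMeasure {f : ℝ → ℝ} (hf : IsDensity f) :
    IsProbabilityMeasure (densityLaw f) := by
  refine ⟨?_⟩
  rw [densityLaw, withDensity_apply _ MeasurableSet.univ, Measure.restrict_univ,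
    ← ofReal_integral_eq_lintegral_ofReal hf.integrable (ae_of_all _ hf.nonneg),
    hf.integral_eq_one, ENNReal.ofReal_one]

lemma integral_densityLaw {f : ℝ → ℝ} (hf : IsDensity f) (φ : ℝ → ℂ) :
    ∫ x, φ x ∂(densityLaw f) = ∫ x, (f x : ℂ) * φ x := by
  rw [densityLaw, integral_withDensity_eq_integral_toReal_smul
    (hf.measurable.ennreal_ofReal) (ae_of_all _ fun _ => ENNReal.ofReal_lt_top)]
  refine integral_congr_ae (ae_of_all _ fun x => ?_)
  simp [ENNReal.toReal_ofReal (hf.nonneg x)]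

lemma charFun_densityLaw {f : ℝ → ℝ} (hf : IsDensity f) (u : ℝ) :
    charFun (densityLaw f) u = cf f u := by
  rw [charFun_apply_real, integral_densityLaw hf, cf]
  refine integral_congr_ae (ae_of_all _ fun x => ?_)
  dsimp only
  rw [mul_comm]
  congr 2
  push_cast
  ring

lemma fourier_ofReal_eq_cf (f : ℝ → ℝ) (v : ℝ) :
    𝓕 (fun x => (f x : ℂ)) v = cf f (-(2 * Real.pi * v)) := by
  rw [Real.fourier_real_eq_integral_exp_smul, cf]
  refine integral_congr_ae (ae_of_all _ fun x => ?_)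
  simp only [smul_eq_mul]
  congr 2
  push_cast
  ring

/-- The marginal law of the observations. -/
noncomputable def noisyLaw (g f : ℝ → ℝ) : Measure ℝ := (densityLaw f).conv (densityLaw g)

lemma isProbabilityMeasure_noisyLaw {g f : ℝ → ℝ} (hg : IsDensity g) (hf : IsDensity f) :
    IsProbabilityMeasure (noisyLaw g f) := by
  have := hf.isProbabilityMeasure
  have := hg.isProbabilityMeasure
  unfold noisyLaw
  infer_instance

lemma chf_noisyLaw {g f : ℝ → ℝ} (hg : IsDensity g) (hf : IsDensity f) (v : ℝ) :
    chf (noisyLaw g f) v = cf f (2 * Real.pi * v) * cf g (2 * Real.pi * v) := by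
  have := hf.isProbabilityMeasure
  have := hg.isProbabilityMeasure
  rw [chf, noisyLaw, charFun_conv, charFun_densityLaw hf, charFun_densityLaw hg]

lemma norm_cf_le_one {f : ℝ → ℝ} (hf : IsDensity f) (u : ℝ) : ‖cf f u‖ ≤ 1 := by
  have := hf.isProbabilityMeasure
  rw [← charFun_densityLaw hf]
  exact norm_charFun_le_one _

lemma continuous_cf {f : ℝ → ℝ} (hf : IsDensity f) : Continuous (cf f) := by
  have := hf.isProbabilityMeasure
  have h : cf f = charFun (densityLaw f) := funext fun u => (charFun_densityLaw hf u).symm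
  rw [h]
  exact continuous_charFun

end Densities

end NoisyTesting

namespace NoisyTesting

open FourierTransform

/-! ### Parseval's identity for the U-statistic kernel. -/

section KernelPairing

local notation "conj" => starRingEnd ℂ

lemma memLp_conj {b : ℝ → ℂ} (hb : MemLp b 2) : MemLp (fun v => conj (b v)) 2 :=
  (memLp_congr_norm (Complex.continuous_conj.comp_aestronglyMeasurable hb.1) hb.1
    (ae_of_all _ fun _ => RCLike.norm_conj _)).2 hb

lemma integrable_conj_mul {a b : ℝ → ℂ} (ha : MemLp a 2) (hb : MemLp b 2) :
    Integrable fun v => conj (a v) * b v :=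
  MemLp.integrable_mul (memLp_conj ha) hb

lemma integrable_norm_sq {a : ℝ → ℂ} (ha : MemLp a 2) : Integrable fun v => ‖a v‖ ^ 2 :=
  (memLp_two_iff_integrable_sq_norm ha.1).1 ha

/-- Parseval's identity for differences of an inverse Fourier integral and a function. -/
lemma integral_conj_fourierInv_sub {w₁ w₂ φ : ℝ → ℂ} (h1 : Integrable w₁) (h1' : MemLp w₁ 2)
    (h2 : Integrable w₂) (h2' : MemLp w₂ 2) (hφ : Integrable φ) (hφ' : MemLp φ 2) :
    ∫ x, conj (𝓕⁻ w₁ x - φ x) * (𝓕⁻ w₂ x - φ x) =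
      (∫ v, conj (w₁ v) * w₂ v) - (∫ v, conj (w₁ v) * 𝓕 φ v) -
        conj (∫ v, conj (w₂ v) * 𝓕 φ v) + ∫ v, ((‖𝓕 φ v‖ ^ 2 : ℝ) : ℂ) := by
  have m1 := memLp_fourierInv h1 h1'
  have m2 := memLp_fourierInv h2 h2'
  have i12 := integrable_conj_mul m1 m2
  have i1 := integrable_conj_mul m1 hφ'
  have i2 := integrable_conj_mul hφ' m2
  have i0 := integrable_conj_mul hφ' hφ'
  have e : ∀ x, conj (𝓕⁻ w₁ x - φ x) * (𝓕⁻ w₂ x - φ x) =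
      conj (𝓕⁻ w₁ x) * 𝓕⁻ w₂ x - conj (𝓕⁻ w₁ x) * φ x - conj (φ x) * 𝓕⁻ w₂ x +
        conj (φ x) * φ x := fun x => by rw [map_sub]; ring
  have e3 : ∫ x, conj (φ x) * 𝓕⁻ w₂ x = conj (∫ v, conj (w₂ v) * 𝓕 φ v) := by
    rw [← integral_conj_fourierInv_mul h2 hφ, ← integral_conj]
    refine integral_congr_ae (ae_of_all _ fun x => ?_)
    simp [mul_comm]
  simp only [e]
  rw [integral_add (by exact (i12.sub i1).sub i2) i0, integral_sub (by exact i12.sub i1) i2,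
    integral_sub i12 i1, integral_conj_fourierInv_mul_fourierInv h1 h1' h2 h2',
    integral_conj_fourierInv_mul h1 hφ, e3, ← integral_conj_fourier_mul_fourier hφ hφ' hφ hφ']
  congr 1
  refine integral_congr_ae (ae_of_all _ fun x => ?_)
  simp [Complex.conj_mul']

end KernelPairing

/-! ### Variance of the deconvolution U-statistic. -/

section KernelVariance

local notation "conj" => starRingEnd ℂ

variable {μ : Measure ℝ} [IsProbabilityMeasure μ] {D φ : ℝ → ℂ} {K : ℝ}

lemma memLp_two_of_bdd (hD : Integrable D) (hK : ∀ v, ‖D v‖ ≤ K) : MemLp D 2 := by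
  rw [memLp_two_iff_integrable_sq_norm hD.1]
  have := hD.norm.bdd_mul (c := K) hD.norm.1 (ae_of_all _ fun v => by simpa using hK v)
  simpa only [sq] using this

/-- By independence the transform of a difference is χ times its conjugate. Since |χ|² ≤ |χ|,
second-moment bounds for one observation carry over to differences. -/
lemma chf_diff (v : ℝ) :
    chf ((μ.prod μ).map fun p : ℝ × ℝ => p.1 - p.2) v = ((‖chf μ v‖ ^ 2 : ℝ) : ℂ) := by
  rw [chf_eq, integral_map (by fun_prop)
    (Continuous.aestronglyMeasurable (by fun_prop))]
  push_cast
  rw [← Complex.mul_conj', chf_eq, ← integral_conj, ← integral_prod_mul]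
  refine integral_congr_ae (ae_of_all _ fun p => ?_)
  dsimp only
  rw [conj_expi, ← expi_add]
  congr 1
  ring

/-- Second moment of `P(Y₁ - Y₂)` for an inverse Fourier integral `P`. -/
lemma integral_norm_sq_fourierInv_diff_le {b : ℝ → ℂ} (hb : Integrable b)
    (hb2 : Integrable fun v => ‖b v‖ ^ 2) (hX : Integrable (chf μ)) :
    ∫ p : ℝ × ℝ, ‖𝓕⁻ b (p.1 - p.2)‖ ^ 2 ∂(μ.prod μ) ≤
      (∫ v, ‖b v‖ ^ 2) * ∫ v, ‖chf μ v‖ := by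
  have hm : Measurable fun p : ℝ × ℝ => p.1 - p.2 := by fun_prop
  set ν := (μ.prod μ).map fun p : ℝ × ℝ => p.1 - p.2 with hν
  have : IsProbabilityMeasure ν := Measure.isProbabilityMeasure_map hm.aemeasurable
  have hle : ∀ v, ‖chf ν v‖ ≤ ‖chf μ v‖ := fun v => by
    rw [hν, chf_diff, Complex.norm_real, Real.norm_of_nonneg (by positivity)]
    nlinarith [norm_nonneg (chf μ v), norm_chf_le μ v]
  have hXν : Integrable (chf ν) :=
    hX.norm.mono' (continuous_chf ν).aestronglyMeasurable (ae_of_all _ hle)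
  have h := integral_norm_sq_fourierInv_le hb hb2 hXν
  rw [hν, integral_map (f := fun y => ‖𝓕⁻ b y‖ ^ 2) hm.aemeasurable
    ((continuous_fourierInv hb).norm.pow 2).aestronglyMeasurable, ← hν] at h
  exact h.trans (mul_le_mul_of_nonneg_left (integral_mono hXν.norm hX.norm hle)
    (integral_nonneg fun v => by positivity))

lemma conj_fourierInv_of_real {b : ℝ → ℂ} (hb : ∀ v, conj (b v) = b v) (y : ℝ) :
    conj (𝓕⁻ b y) = 𝓕⁻ b (-y) := by
  rw [fourierInv_real_eq, fourierInv_real_eq, ← integral_conj]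
  refine integral_congr_ae (ae_of_all _ fun v => ?_)
  simp [hb, conj_expi]

/-- Averaging over a shift multiplies the Fourier density by the conjugate characteristic function.
It yields the Hoeffding projection of a difference kernel, and also the convolution of a
perturbation with the noise. -/
lemma integral_fourierInv_sub {b : ℝ → ℂ} (hb : Integrable b) (y : ℝ) :
    ∫ x, 𝓕⁻ b (y - x) ∂μ = 𝓕⁻ (fun v => conj (chf μ v) * b v) y := by
  simp only [fourierInv_real_eq, chf_eq]
  rw [integral_integral_swap]
  · refine integral_congr_ae (ae_of_all _ fun v => ?_)
    dsimp only
    rw [integral_mul_const, ← mul_assoc, ← integral_conj, ← integral_const_mul]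
    congr 1
    refine integral_congr_ae (ae_of_all _ fun x => ?_)
    dsimp only
    rw [conj_expi, ← expi_add]
    congr 1
    ring
  · have : Integrable (fun p : ℝ × ℝ => b p.2) (μ.prod volume) := hb.comp_snd μ
    refine this.bdd_mul (c := 1) (Continuous.aestronglyMeasurable ?_) (ae_of_all _ fun p => by simp)
    fun_prop

/-- Variance of the U-statistic with kernel `⟨k_y - φ, k_{y'} - φ⟩`, where
`k_y` has Fourier transform `v ↦ e^{-2πivy} D(v)`. -/
lemma integral_kernel_uStatistic_sub_sq_le {n : ℕ} (hn : 2 ≤ n) (hX : Integrable (chf μ))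
    (hD : Integrable D) (hK : ∀ v, ‖D v‖ ≤ K) {f₀ : ℝ → ℝ} (hφ : Integrable f₀)
    (hφ2 : MemLp f₀ 2) {k : ℝ → ℝ → ℝ}
    (hk : ∀ y x, (k y x : ℂ) = 𝓕⁻ (fun v => expi (-(v * y)) * D v) x) :
    let m := ∫ v, ‖conj (chf μ v) * D v - 𝓕 (fun x => (f₀ x : ℂ)) v‖ ^ 2
    let T := fun Y : Fin n → ℝ => ((n : ℝ) * ((n : ℝ) - 1))⁻¹ *
      ∑ i : Fin n, ∑ j : Fin n, if i ≠ j then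
        ∫ x : ℝ, (k (Y i) x - f₀ x) * (k (Y j) x - f₀ x) else 0
    Integrable (fun Y => (T Y - m) ^ 2) (Measure.pi fun _ : Fin n => μ) ∧
    ∫ Y, (T Y - m) ^ 2 ∂(Measure.pi fun _ : Fin n => μ) ≤
      8 / n * (K ^ 2 * m * ∫ v, ‖chf μ v‖) +
        4 / (n * (n - 1)) * ((∫ v, ‖D v‖ ^ 4) * ∫ v, ‖chf μ v‖) := by
  intro m T
  set F : ℝ → ℂ := 𝓕 (fun x => (f₀ x : ℂ)) with hF
  have hφ' : Integrable (fun x => (f₀ x : ℂ)) := hφ.ofReal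
  have hφ2' : MemLp (fun x => (f₀ x : ℂ)) 2 := hφ2.ofReal
  have hFc : Continuous F := continuous_fourier hφ'
  have hF2 : MemLp F 2 := memLp_fourier hφ' hφ2'
  have hD2 : MemLp D 2 := memLp_two_of_bdd hD hK
  have hχc : Continuous (chf μ) := continuous_chf μ
  -- the three Fourier densities
  set p : ℝ → ℂ := fun v => conj (D v) * D v with hp
  set q : ℝ → ℂ := fun v => conj (chf μ v) * (conj (D v) * D v) with hq
  set r : ℝ → ℂ := fun v => conj (D v) * F v with hr
  have ip : Integrable p := integrable_conj_mul hD2 hD2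
  have iq : Integrable q := ip.bdd_mul (c := 1)
    (Complex.continuous_conj.comp hχc).aestronglyMeasurable
    (ae_of_all _ fun v => by simpa using norm_chf_le μ v)
  have ir : Integrable r := integrable_conj_mul hD2 hF2
  have mDy : ∀ y, Integrable (fun v => expi (-(v * y)) * D v) := fun y =>
    hD.bdd_mul (c := 1) (Continuous.aestronglyMeasurable (by fun_prop))
      (ae_of_all _ fun v => by simp)
  have mDy2 : ∀ y, MemLp (fun v => expi (-(v * y)) * D v) 2 := fun y =>
    memLp_two_of_bdd (mDy y) (K := K) fun v => by simpa using hK v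
  have pconj : ∀ v, conj (p v) = p v := fun v => by simp [hp, mul_comm]
  -- the kernel of the U-statistic
  set H : ℝ → ℝ → ℝ := fun y z => ∫ x : ℝ, (k y x - f₀ x) * (k z x - f₀ x) with hH
  set c₀ : ℝ := ∫ v, ‖F v‖ ^ 2 with hc₀
  -- The two phases combine into one depending on y - z only, so the genuinely bivariate part of the
  -- kernel is a difference kernel with Fourier density |D|².
  have Heq : ∀ y z, H y z = (𝓕⁻ p (y - z)).re - (𝓕⁻ r y).re - (𝓕⁻ r z).re + c₀ := by
    intro y z
    have h1 := integral_conj_fourierInv_sub (mDy y) (mDy2 y) (mDy z) (mDy2 z) hφ' hφ2'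
    have e1 : ∫ x, conj (𝓕⁻ (fun v => expi (-(v * y)) * D v) x - (f₀ x : ℂ)) *
        (𝓕⁻ (fun v => expi (-(v * z)) * D v) x - (f₀ x : ℂ)) = ((H y z : ℝ) : ℂ) := by
      rw [hH, ← integral_complex_ofReal]
      refine integral_congr_ae (ae_of_all _ fun x => ?_)
      dsimp only
      rw [← hk, ← hk]
      push_cast
      simp
    have e2 : ∫ v, conj (expi (-(v * y)) * D v) * (expi (-(v * z)) * D v) = 𝓕⁻ p (y - z) := by
      rw [fourierInv_real_eq]
      refine integral_congr_ae (ae_of_all _ fun v => ?_)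
      dsimp only [hp]
      rw [map_mul, conj_expi, mul_sub, sub_eq_add_neg, expi_add, neg_neg]
      ring
    have e3 : ∀ y, ∫ v, conj (expi (-(v * y)) * D v) * F v = 𝓕⁻ r y := fun y => by
      rw [fourierInv_real_eq]
      refine integral_congr_ae (ae_of_all _ fun v => ?_)
      dsimp only [hr]
      rw [map_mul, conj_expi, neg_neg]
      ring
    rw [← hF, e1, e2, e3, e3, integral_complex_ofReal] at h1
    have h2 := congrArg Complex.re h1
    simpa using h2
  -- Hoeffding decomposition
  have iX : ∀ {b : ℝ → ℂ}, Integrable b → ∫ y, (𝓕⁻ b y).re ∂μ = (∫ v, chf μ v * b v).re :=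
    fun {b} hb => by
      rw [← integral_fourierInv hb]
      exact integral_re (integrable_fourierInv hb)
  set t : ℝ := ∫ v, ‖conj (chf μ v) * D v‖ ^ 2 with ht
  set s₁ : ℝ := (∫ v, conj (conj (chf μ v) * D v) * F v).re with hs₁
  have mχD : MemLp (fun v => conj (chf μ v) * D v) 2 :=
    memLp_two_of_bdd (K := K) (hD.bdd_mul (c := 1)
      (Complex.continuous_conj.comp hχc).aestronglyMeasurable
      (ae_of_all _ fun v => by simpa using norm_chf_le μ v)) fun v => by
        rw [norm_mul, RCLike.norm_conj]
        exact (mul_le_of_le_one_left (norm_nonneg _) (norm_chf_le μ v)).trans (hK v)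
  have hQ : ∫ y, (𝓕⁻ q y).re ∂μ = t := by
    rw [iX iq]
    have : ∫ v, chf μ v * q v = ((t : ℝ) : ℂ) := by
      rw [ht, ← integral_complex_ofReal]
      refine integral_congr_ae (ae_of_all _ fun v => ?_)
      dsimp only [hq]
      push_cast
      rw [← Complex.conj_mul']
      simp only [map_mul, Complex.conj_conj]
      ring
    rw [this, Complex.ofReal_re]
  have hS : ∫ y, (𝓕⁻ r y).re ∂μ = s₁ := by
    rw [iX ir, hs₁]
    congr 1
    refine integral_congr_ae (ae_of_all _ fun v => ?_)
    simp only [hr, map_mul, Complex.conj_conj]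
    ring
  have hm : m = t - 2 * s₁ + c₀ := by
    have i1 := integrable_norm_sq mχD
    have i2 := (integrable_conj_mul mχD hF2).re
    have i3 := integrable_norm_sq hF2
    have e : ∀ v, ‖conj (chf μ v) * D v - F v‖ ^ 2 = ‖conj (chf μ v) * D v‖ ^ 2 -
        2 * (conj (conj (chf μ v) * D v) * F v).re + ‖F v‖ ^ 2 := fun v => by
      have := norm_sub_sq (𝕜 := ℂ) (conj (chf μ v) * D v) (F v)
      rw [this, RCLike.inner_apply']
      rfl
    change ∫ v, ‖conj (chf μ v) * D v - F v‖ ^ 2 = _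
    simp only [e]
    rw [integral_add (by exact i1.sub (i2.const_mul 2)) i3, integral_sub i1 (by exact i2.const_mul 2),
      integral_const_mul]
    congr 3
    exact integral_re (integrable_conj_mul mχD hF2)
  -- The density q is p after averaging one variable, so s is the centred first projection of H and
  -- h the degenerate remainder.
  set s : ℝ → ℝ := fun y => (𝓕⁻ q y).re - (𝓕⁻ r y).re - (t - s₁) with hs
  set h : ℝ → ℝ → ℝ := fun y z => (𝓕⁻ p (y - z)).re - (𝓕⁻ q y).re - (𝓕⁻ q z).re + t with hh
  have cont : ∀ {b : ℝ → ℂ}, Integrable b → Continuous fun y => (𝓕⁻ b y).re := fun hb =>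
    Complex.continuous_re.comp (continuous_fourierInv hb)
  have bdd : ∀ (b : ℝ → ℂ) y, |(𝓕⁻ b y).re| ≤ ∫ v, ‖b v‖ := fun b y =>
    (Complex.abs_re_le_norm _).trans (norm_fourierInv_le b y)
  have cp := cont ip
  have cq := cont iq
  have cr := cont ir
  have ireμ : ∀ {b : ℝ → ℂ}, Integrable b → Integrable (fun y => (𝓕⁻ b y).re) μ := fun hb =>
    (integrable_fourierInv hb).re
  have cp2 : Continuous fun z : ℝ × ℝ => (𝓕⁻ p (z.1 - z.2)).re :=
    cp.comp (continuous_fst.sub continuous_snd)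
  have hhm : Measurable (Function.uncurry h) := by
    have : Continuous (Function.uncurry h) := by
      have c1 := cq.comp (continuous_fst (X := ℝ) (Y := ℝ))
      have c2 := cq.comp (continuous_snd (X := ℝ) (Y := ℝ))
      exact ((cp2.sub c1).sub c2).add continuous_const
    exact this.measurable
  have peven : ∀ y, (𝓕⁻ p (-y)).re = (𝓕⁻ p y).re := fun y => by
    rw [← conj_fourierInv_of_real pconj, Complex.conj_re]
  have hsymm : ∀ y z, h y z = h z y := fun y z => by
    simp only [hh]
    rw [← neg_sub z y, peven]
    ring
  have hhC : ∀ y z, |h y z| ≤ (∫ v, ‖p v‖) + (∫ v, ‖q v‖) + (∫ v, ‖q v‖) + |t| := fun y z => by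
    simp only [hh]
    refine (abs_add_le _ _).trans (add_le_add ((abs_sub _ _).trans (add_le_add
      ((abs_sub _ _).trans (add_le_add (bdd _ _) (bdd _ _))) (bdd _ _))) le_rfl)
  have hh0 : ∀ y, ∫ x, h x y ∂μ = 0 := by
    intro y
    have e : ∀ x, h x y = (𝓕⁻ p (y - x)).re - (𝓕⁻ q y).re - (𝓕⁻ q x).re + t := fun x => by
      rw [hsymm]
    have ipx : Integrable (fun x => 𝓕⁻ p (y - x)) μ :=
      Integrable.of_bound ((continuous_fourierInv ip).comp
        (continuous_const.sub continuous_id)).aestronglyMeasurable _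
        (ae_of_all _ fun x => norm_fourierInv_le p _)
    have e2 : ∫ x, (𝓕⁻ p (y - x)).re ∂μ = (𝓕⁻ q y).re := by
      rw [hq, ← integral_fourierInv_sub ip]
      exact integral_re ipx
    simp only [e]
    rw [integral_add (by exact (ipx.re.sub (integrable_const _)).sub (ireμ iq)) (integrable_const _),
      integral_sub (by exact ipx.re.sub (integrable_const _)) (ireμ iq),
      integral_sub (by exact ipx.re) (integrable_const _), hQ, e2]
    simp
  have hsm : Measurable s := ((cq.sub cr).sub continuous_const).measurable
  have hsC : ∀ y, |s y| ≤ (∫ v, ‖q v‖) + (∫ v, ‖r v‖) + |t - s₁| := fun y =>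
    (abs_sub _ _).trans (add_le_add ((abs_sub _ _).trans (add_le_add (bdd _ _) (bdd _ _))) le_rfl)
  have hs0 : ∫ y, s y ∂μ = 0 := by
    simp only [hs]
    rw [integral_sub (by exact (ireμ iq).sub (ireμ ir)) (integrable_const _),
      integral_sub (ireμ iq) (ireμ ir), hQ, hS]
    simp
  have hdec : ∀ y z, H y z = m + s y + s z + h y z := fun y z => by
    rw [Heq, hm]
    simp only [hs, hh]
    ring
  obtain ⟨hint, hvar⟩ := integral_uStatistic_sub_sq_le (μ := μ) hn hhm hhC hsymm hh0 hsm hsC hs0 hdec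
  refine ⟨hint, hvar.trans ?_⟩
  have hn2 : (2 : ℝ) ≤ n := by exact_mod_cast hn
  have hc2 : 0 ≤ 4 / ((n : ℝ) * (n - 1)) := div_nonneg (by norm_num)
    (mul_nonneg (by linarith) (by linarith))
  refine add_le_add (mul_le_mul_of_nonneg_left ?_ (by positivity))
    (mul_le_mul_of_nonneg_left ?_ hc2)
  · -- linear part
    set a : ℝ → ℂ := fun v => conj (chf μ v) * D v - F v with ha
    have ma : MemLp a 2 := mχD.sub hF2
    have iDa : Integrable fun v => conj (D v) * a v := integrable_conj_mul hD2 ma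
    have hle : ∀ v, ‖conj (D v) * a v‖ ^ 2 ≤ K ^ 2 * ‖a v‖ ^ 2 := fun v => by
      rw [norm_mul, RCLike.norm_conj, mul_pow]
      exact mul_le_mul_of_nonneg_right (pow_le_pow_left₀ (norm_nonneg _) (hK v) 2) (by positivity)
    have iDa2 : Integrable fun v => ‖conj (D v) * a v‖ ^ 2 :=
      ((integrable_norm_sq ma).const_mul (K ^ 2)).mono' (iDa.1.norm.pow 2)
        (ae_of_all _ fun v => by
          rw [Real.norm_of_nonneg (by positivity)]
          exact hle v)
    -- The projection factors through a, whose squared L² norm is m. The linear variance is thus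
    -- proportional to the mean, which lets large alternatives be detected by Chebyshev's
    -- inequality.
    have e : ∀ y, (𝓕⁻ q y).re - (𝓕⁻ r y).re = (𝓕⁻ (fun v => conj (D v) * a v) y).re := fun y => by
      have : 𝓕⁻ (fun v => conj (D v) * a v) y = 𝓕⁻ q y - 𝓕⁻ r y := by
        simp only [fourierInv_real_eq]
        rw [← integral_sub]
        · refine integral_congr_ae (ae_of_all _ fun v => ?_)
          simp only [ha, hq, hr]
          ring
        · exact iq.bdd_mul (c := 1) (Continuous.aestronglyMeasurable (by fun_prop))
            (ae_of_all _ fun v => by simp)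
        · exact ir.bdd_mul (c := 1) (Continuous.aestronglyMeasurable (by fun_prop))
            (ae_of_all _ fun v => by simp)
      rw [this, Complex.sub_re]
    set w : ℝ → ℝ := fun y => (𝓕⁻ (fun v => conj (D v) * a v) y).re with hw
    have cw : Continuous w := cont iDa
    have iw : Integrable w μ := ireμ iDa
    have iw2 : Integrable (fun y => w y ^ 2) μ :=
      Integrable.of_bound (cw.pow 2).aestronglyMeasurable _ (ae_of_all _ fun y => by
        rw [Real.norm_eq_abs, abs_pow]
        exact pow_le_pow_left₀ (abs_nonneg _) (bdd _ y) 2)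
    have hwm : ∫ y, w y ∂μ = t - s₁ := by
      have : w = fun y => (𝓕⁻ q y).re - (𝓕⁻ r y).re := funext fun y => (e y).symm
      rw [this, integral_sub (ireμ iq) (ireμ ir), hQ, hS]
    have hsw : ∀ y, s y ^ 2 = w y ^ 2 - 2 * (t - s₁) * w y + (t - s₁) ^ 2 := fun y => by
      simp only [hs, e]
      ring
    -- A variance is at most the second moment.
    have e3 : ∫ y, s y ^ 2 ∂μ ≤ ∫ y, w y ^ 2 ∂μ := by
      simp only [hsw]
      rw [integral_add (by exact iw2.sub (iw.const_mul _)) (integrable_const _),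
        integral_sub iw2 (iw.const_mul _), integral_const_mul, hwm]
      simp only [integral_const, probReal_univ, one_smul]
      nlinarith [sq_nonneg (t - s₁)]
    have e4 : ∫ y, w y ^ 2 ∂μ ≤ ∫ y, ‖𝓕⁻ (fun v => conj (D v) * a v) y‖ ^ 2 ∂μ := by
      refine integral_mono iw2 ?_ fun y => ?_
      · exact Integrable.of_bound ((continuous_fourierInv iDa).norm.pow 2).aestronglyMeasurable _
          (ae_of_all _ fun y => by
            rw [Real.norm_of_nonneg (by positivity)]
            exact pow_le_pow_left₀ (norm_nonneg _) (norm_fourierInv_le _ y) 2)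
      · dsimp only
        rw [← sq_abs]
        exact pow_le_pow_left₀ (abs_nonneg _) (Complex.abs_re_le_norm _) 2
    refine e3.trans (e4.trans ((integral_norm_sq_fourierInv_le iDa iDa2 hX).trans ?_))
    refine mul_le_mul_of_nonneg_right ?_ (integral_nonneg fun v => norm_nonneg _)
    have e5 := integral_mono iDa2 ((integrable_norm_sq ma).const_mul (K ^ 2)) hle
    rwa [integral_const_mul] at e5
  · -- degenerate part
    have np : ∀ v, ‖p v‖ = ‖D v‖ ^ 2 := fun v => by simp [hp, sq]
    have np4 : ∀ v, ‖p v‖ ^ 2 = ‖D v‖ ^ 4 := fun v => by rw [np]; ring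
    have ip2 : Integrable fun v => ‖p v‖ ^ 2 := by
      have hpK : ∀ v, ‖p v‖ ≤ K ^ 2 := fun v => by
        rw [np]; exact pow_le_pow_left₀ (norm_nonneg _) (hK v) 2
      exact integrable_norm_sq (memLp_two_of_bdd ip hpK)
    -- The comparison kernel is the uncentred difference kernel, to which the second-moment bound
    -- for differences applies.
    have e1 := integral_degenerate_sq_le (μ := μ) (B := fun y z => (𝓕⁻ p (y - z)).re)
      (φ := fun y => -(𝓕⁻ q y).re) (ψ := fun y => -(𝓕⁻ q y).re + t) hhm hhC hsymm hh0
      cp2.measurable (C' := ∫ v, ‖p v‖) (fun y z => bdd _ _) cq.neg.measurable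
      (C₁ := ∫ v, ‖q v‖) (fun y => by rw [abs_neg]; exact bdd _ _)
      (cq.neg.add continuous_const).measurable (C₂ := (∫ v, ‖q v‖) + |t|)
      (fun y => (abs_add_le _ _).trans (add_le_add (by rw [abs_neg]; exact bdd _ _) le_rfl))
      (fun y z => by simp only [hh]; ring)
    refine e1.trans ?_
    have e2 := integral_norm_sq_fourierInv_diff_le (μ := μ) ip ip2 hX
    simp only [np4] at e2
    refine le_trans (integral_mono ?_ ?_ fun z => ?_) e2
    · exact Integrable.of_bound (cp2.pow 2).aestronglyMeasurable _ (ae_of_all _ fun z => by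
        rw [Real.norm_eq_abs, abs_pow]
        exact pow_le_pow_left₀ (abs_nonneg _) (bdd p _) 2)
    · exact Integrable.of_bound (((continuous_fourierInv ip).comp
          (continuous_fst.sub continuous_snd)).norm.pow 2).aestronglyMeasurable _
          (ae_of_all _ fun z => by
            rw [Real.norm_of_nonneg (by positivity)]
            exact pow_le_pow_left₀ (norm_nonneg _) (norm_fourierInv_le p _) 2)
    · dsimp only
      rw [← sq_abs]
      exact pow_le_pow_left₀ (abs_nonneg _) (Complex.abs_re_le_norm _) 2

end KernelVariance

end NoisyTesting

namespace NoisyTesting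

open FourierTransform

/-! ### Polynomial bounds on the characteristic function of the noise. -/

section NoiseBounds

/-- Two-sided polynomial bounds for the characteristic function of the noise. -/
lemma IsPolynomialNoise.exists_bounds {σ : ℝ} {g : ℝ → ℝ} (hg : IsPolynomialNoise σ g) :
    ∃ c C : ℝ, 0 < c ∧ 0 < C ∧ ∀ u, c * (1 + |u|) ^ (-σ) ≤ ‖cf g u‖ ∧
      ‖cf g u‖ ≤ C * (1 + |u|) ^ (-σ) := by
  have hσ : 0 < σ := lt_trans one_pos hg.one_lt
  have hcont : Continuous fun u => ‖cf g u‖ := (continuous_cf hg.density).norm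
  have hev : ∀ᶠ u in cocompact ℝ, |‖cf g u‖ - |u| ^ (-σ)| ≤ 1 / 2 * |u| ^ (-σ) := by
    have := hg.cf_decay.isLittleO.def (c := 1 / 2) (by norm_num)
    filter_upwards [this] with u hu
    rw [Pi.sub_apply, Real.norm_eq_abs, Real.norm_eq_abs,
      abs_of_nonneg (Real.rpow_nonneg (abs_nonneg u) _)] at hu
    exact hu
  obtain ⟨R, hR⟩ : ∃ R : ℝ, ∀ u : ℝ, R ≤ |u| → |‖cf g u‖ - |u| ^ (-σ)| ≤ 1 / 2 * |u| ^ (-σ) := by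
    rw [← Metric.cobounded_eq_cocompact, ← comap_norm_atTop, eventually_comap] at hev
    obtain ⟨R, hR⟩ := eventually_atTop.1 hev
    exact ⟨R, fun u hu => hR |u| hu u rfl⟩
  set R' := max R 1 with hR'
  have hR1 : 1 ≤ R' := le_max_right _ _
  obtain ⟨u₀, -, hu₀⟩ := (isCompact_Icc (a := -R') (b := R')).exists_isMinOn
    ⟨0, by constructor <;> linarith⟩ hcont.continuousOn
  have hc1 : 0 < ‖cf g u₀‖ := norm_pos_iff.2 (hg.cf_ne_zero u₀)
  -- On the compact interval the minimum is positive because there are no zeros, and the upper bound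
  -- is 1. Outside it the equivalence costs a factor 1/2 or 2, and trading |u| for 1 + |u| costs
  -- 2^σ.
  refine ⟨min (1 / 2) ‖cf g u₀‖, max (2 * 2 ^ σ) ((1 + R') ^ σ), by positivity, by positivity,
    fun u => ?_⟩
  have hu1 : 0 < 1 + |u| := by positivity
  have hpos : 0 < (1 + |u|) ^ (-σ) := Real.rpow_pos_of_pos hu1 _
  rcases le_total |u| R' with h | h
  · have hmem : u ∈ Set.Icc (-R') R' := abs_le.1 h
    constructor
    · have h1 : (1 + |u|) ^ (-σ) ≤ 1 :=
        Real.rpow_le_one_of_one_le_of_nonpos (by linarith [abs_nonneg u]) (by linarith)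
      calc min (1 / 2) ‖cf g u₀‖ * (1 + |u|) ^ (-σ) ≤ ‖cf g u₀‖ * 1 :=
            mul_le_mul (min_le_right _ _) h1 hpos.le hc1.le
        _ ≤ ‖cf g u‖ := by rw [mul_one]; exact hu₀ hmem
    · have h1 : (1 + R') ^ (-σ) ≤ (1 + |u|) ^ (-σ) :=
        Real.rpow_le_rpow_of_nonpos hu1 (by linarith) (by linarith)
      calc ‖cf g u‖ ≤ 1 := norm_cf_le_one hg.density u
        _ = (1 + R') ^ σ * (1 + R') ^ (-σ) := by
            rw [← Real.rpow_add (by linarith)]; simp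
        _ ≤ _ := mul_le_mul (le_max_right _ _) h1 (by positivity) (by positivity)
  · have hu := hR u ((le_max_left _ _).trans h)
    have hupos : 0 < |u| := by linarith
    rw [abs_le] at hu
    constructor
    · have h1 : (1 + |u|) ^ (-σ) ≤ |u| ^ (-σ) :=
        Real.rpow_le_rpow_of_nonpos hupos (by linarith) (by linarith)
      calc min (1 / 2) ‖cf g u₀‖ * (1 + |u|) ^ (-σ) ≤ 1 / 2 * |u| ^ (-σ) :=
            mul_le_mul (min_le_left _ _) h1 hpos.le (by norm_num)
        _ ≤ ‖cf g u‖ := by linarith [hu.1]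
    · have h1 : |u| ^ (-σ) ≤ ((1 + |u|) / 2) ^ (-σ) :=
        Real.rpow_le_rpow_of_nonpos (by linarith) (by linarith) (by linarith)
      have h2 : ((1 + |u|) / 2) ^ (-σ) = 2 ^ σ * (1 + |u|) ^ (-σ) := by
        rw [Real.div_rpow hu1.le (by norm_num), Real.rpow_neg (by norm_num : (0:ℝ) ≤ 2), div_inv_eq_mul,
          mul_comm]
      have h3 : 0 ≤ |u| ^ (-σ) := by positivity
      calc ‖cf g u‖ ≤ 2 * |u| ^ (-σ) := by linarith [hu.2]
        _ ≤ 2 * 2 ^ σ * (1 + |u|) ^ (-σ) := by rw [mul_assoc, ← h2]; linarith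
        _ ≤ _ := mul_le_mul_of_nonneg_right (le_max_left _ _) hpos.le

/-- Decay of order σ > 1 is integrable at infinity. The resulting constant ∫|Φ_g| makes every
variance bound uniform in f. -/
lemma IsPolynomialNoise.integrable_cf {σ : ℝ} {g : ℝ → ℝ} (hg : IsPolynomialNoise σ g) :
    Integrable (cf g) := by
  obtain ⟨c, C, -, -, h⟩ := hg.exists_bounds
  have hi : Integrable fun u : ℝ => (1 + ‖u‖) ^ (-σ) :=
    integrable_one_add_norm (by simpa using hg.one_lt)
  exact (hi.const_mul C).mono' (continuous_cf hg.density).aestronglyMeasurable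
    (ae_of_all _ fun u => (h u).2)

end NoiseBounds

/-! ### The deconvolution kernel and its cutoff in frequency. -/

section Truncation

/-- The indicator of the frequencies `|2πv| ≤ 1/h`. -/
noncomputable def cutoff (h v : ℝ) : ℂ := if |2 * Real.pi * h * v| ≤ 1 then 1 else 0

/-- Fourier transform of the deconvolution kernel with bandwidth `h`. -/
noncomputable def deconv (g : ℝ → ℝ) (h v : ℝ) : ℂ := (cf g (-(2 * Real.pi * v)))⁻¹ * cutoff h v

/-- Squared `L²` distance of `f₀` to the low-frequency part of `f`. -/
noncomputable def truncBias (f f₀ : ℝ → ℝ) (h : ℝ) : ℝ :=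
  ∫ v, ‖cutoff h v * cf f (-(2 * Real.pi * v)) - cf f₀ (-(2 * Real.pi * v))‖ ^ 2

lemma measurable_cutoff (h : ℝ) : Measurable (cutoff h) :=
  Measurable.ite (measurableSet_le (by fun_prop) measurable_const) measurable_const measurable_const

lemma norm_cutoff_le (h v : ℝ) : ‖cutoff h v‖ ≤ 1 := by
  unfold cutoff; split_ifs <;> simp

/-- The substitution u = -2πhv passes from the convention e^{-ixu} to e^{2πixv} and absorbs both the
bandwidth and the factor 1/(2π). -/
lemma scaledKernel_eq_fourierInv (g : ℝ → ℝ) {h : ℝ} (hh : 0 < h) (y x : ℝ) :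
    ((scaledKernel g h (x - y) : ℝ) : ℂ) =
      𝓕⁻ (fun v => expi (-(v * y)) * deconv g h v) x := by
  have hπ := Real.pi_pos
  rw [scaledKernel, Complex.ofReal_mul, ofReal_kernel, kernelC, fourierInv_real_eq]
  have hsub := Measure.integral_comp_mul_left (fun u : ℝ =>
    Complex.exp (-(Complex.I * (((x - y) / h * u : ℝ) : ℂ))) * cfKernel g h u) (-(2 * Real.pi * h))
  have habs : |(-(2 * Real.pi * h))⁻¹| = (2 * Real.pi * h)⁻¹ := by
    rw [abs_inv, abs_neg, abs_of_pos (by positivity)]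
  rw [habs, Complex.real_smul] at hsub
  have e : ((h⁻¹ : ℝ) : ℂ) * (((2 * Real.pi : ℝ) : ℂ)⁻¹ * ∫ u : ℝ,
      Complex.exp (-(Complex.I * (((x - y) / h * u : ℝ) : ℂ))) * cfKernel g h u) =
      (((2 * Real.pi * h)⁻¹ : ℝ) : ℂ) * ∫ u : ℝ,
      Complex.exp (-(Complex.I * (((x - y) / h * u : ℝ) : ℂ))) * cfKernel g h u := by
    push_cast
    rw [mul_inv]
    ring
  rw [e, ← hsub]
  refine integral_congr_ae (ae_of_all _ fun v => ?_)
  dsimp only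
  rw [← mul_assoc (expi _), ← expi_add, expi, cfKernel, deconv, cutoff]
  have h1 : -(2 * Real.pi * h) * v / h = -(2 * Real.pi * v) := by field_simp
  have h2 : |(-(2 * Real.pi * h) * v)| = |2 * Real.pi * h * v| := by rw [neg_mul, abs_neg]
  have h3 : (x - y) / h * (-(2 * Real.pi * h) * v) = -(2 * Real.pi * (v * x + -(v * y))) := by
    field_simp
    ring
  rw [h1, h2, h3]
  congr 2
  push_cast
  ring

/-- Inside the cutoff |u| ≤ 1/h, and h ≤ 1 gives 1 + |u| ≤ 2/h; inverting the noise thus costs at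
most a factor of order h^{-σ}. -/
lemma norm_deconv_le {σ c : ℝ} {g : ℝ → ℝ} (hσ : 0 < σ) (hc : 0 < c)
    (hg : ∀ u, c * (1 + |u|) ^ (-σ) ≤ ‖cf g u‖) {h : ℝ} (hh : 0 < h) (h1 : h ≤ 1) (v : ℝ) :
    ‖deconv g h v‖ ≤ c⁻¹ * 2 ^ σ * h ^ (-σ) := by
  have hpos : 0 ≤ c⁻¹ * 2 ^ σ * h ^ (-σ) := by positivity
  unfold deconv cutoff
  split_ifs with hv
  · rw [mul_one, norm_inv]
    set u := -(2 * Real.pi * v) with hu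
    have hu1 : |u| ≤ 1 / h := by
      have e : |2 * Real.pi * h * v| = |2 * Real.pi * v| * h := by
        rw [show 2 * Real.pi * h * v = 2 * Real.pi * v * h by ring, abs_mul, abs_of_pos hh]
      rw [le_div_iff₀ hh, hu, abs_neg, ← e]
      exact hv
    have hu2 : 1 + |u| ≤ 2 / h := by
      have : 1 ≤ 1 / h := by rw [le_div_iff₀ hh]; linarith
      calc 1 + |u| ≤ 1 / h + 1 / h := add_le_add this hu1
        _ = 2 / h := by ring
    have hl : c * (2 / h) ^ (-σ) ≤ ‖cf g u‖ :=
      (mul_le_mul_of_nonneg_left (Real.rpow_le_rpow_of_nonpos (by positivity) hu2 (by linarith))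
        hc.le).trans (hg u)
    have hl0 : 0 < c * (2 / h) ^ (-σ) := by positivity
    refine (inv_anti₀ hl0 hl).trans (le_of_eq ?_)
    rw [mul_inv, Real.rpow_neg (by positivity), inv_inv, Real.div_rpow (by norm_num) hh.le,
      Real.rpow_neg hh.le]
    ring
  · simpa using hpos

lemma measurable_deconv {g : ℝ → ℝ} (hg : IsDensity g) (h : ℝ) : Measurable (deconv g h) := by
  have := (continuous_cf hg).measurable
  exact ((this.comp (by fun_prop)).inv).mul (measurable_cutoff h)

lemma cutoff_eq_indicator {h : ℝ} (hh : 0 < h) (v : ℝ) : cutoff h v =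
    (Set.Icc (-(2 * Real.pi * h)⁻¹) (2 * Real.pi * h)⁻¹).indicator (fun _ => (1 : ℂ)) v := by
  have hπ := Real.pi_pos
  have : |2 * Real.pi * h * v| ≤ 1 ↔
      v ∈ Set.Icc (-(2 * Real.pi * h)⁻¹) (2 * Real.pi * h)⁻¹ := by
    rw [Set.mem_Icc, ← abs_le, abs_mul, abs_of_pos (by positivity : 0 < 2 * Real.pi * h),
      ← one_div, le_div_iff₀' (by positivity)]
  unfold cutoff Set.indicator
  simp only [this]

end Truncation

end NoisyTesting

namespace NoisyTesting

open FourierTransform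

/-! ### Mean, variance and measurability of the test statistic. -/

section TestBounds

lemma integrable_deconv {σ c : ℝ} {g : ℝ → ℝ} (hg : IsDensity g) (hσ : 0 < σ) (hc : 0 < c)
    (hgc : ∀ u, c * (1 + |u|) ^ (-σ) ≤ ‖cf g u‖) {h : ℝ} (hh : 0 < h) (h1 : h ≤ 1) :
    Integrable (deconv g h) ∧
    ∫ v, ‖deconv g h v‖ ^ 4 ≤ (c⁻¹ * 2 ^ σ * h ^ (-σ)) ^ 4 * h⁻¹ := by
  have hπ := Real.pi_pos
  set K := c⁻¹ * 2 ^ σ * h ^ (-σ) with hK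
  have hK0 : 0 ≤ K := by positivity
  set S := Set.Icc (-(2 * Real.pi * h)⁻¹) (2 * Real.pi * h)⁻¹ with hS
  have hind : ∀ a : ℝ, Integrable (S.indicator fun _ => a) := fun a =>
    (integrable_indicator_iff measurableSet_Icc).2
      (integrableOn_const (μ := volume) (s := S) (C := a) isCompact_Icc.measure_lt_top.ne (by simp))
  have hle : ∀ v, ‖deconv g h v‖ ≤ S.indicator (fun _ => K) v := fun v => by
    by_cases hv : v ∈ S
    · rw [Set.indicator_of_mem hv]
      exact norm_deconv_le hσ hc hgc hh h1 v
    · rw [Set.indicator_of_notMem hv, deconv, cutoff_eq_indicator hh, Set.indicator_of_notMem hv]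
      simp
  have hle4 : ∀ v, ‖deconv g h v‖ ^ 4 ≤ S.indicator (fun _ => K ^ 4) v := fun v => by
    refine (pow_le_pow_left₀ (norm_nonneg _) (hle v) 4).trans (le_of_eq ?_)
    by_cases hv : v ∈ S
    · simp [Set.indicator_of_mem hv]
    · simp [Set.indicator_of_notMem hv]
  have hm := (measurable_deconv hg h).aestronglyMeasurable (μ := (volume : Measure ℝ))
  refine ⟨(hind K).mono' hm (ae_of_all _ hle), ?_⟩
  have hi4 : Integrable fun v => ‖deconv g h v‖ ^ 4 :=
    (hind (K ^ 4)).mono' (hm.norm.pow 4) (ae_of_all _ fun v => by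
      rw [Real.norm_of_nonneg (by positivity)]; exact hle4 v)
  refine (integral_mono hi4 (hind _) hle4).trans ?_
  rw [integral_indicator_const _ measurableSet_Icc, smul_eq_mul, mul_comm, measureReal_def,
    Real.volume_Icc, ENNReal.toReal_ofReal (by
      have : 0 < (2 * Real.pi * h)⁻¹ := by positivity
      linarith)]
  refine mul_le_mul_of_nonneg_left ?_ (by positivity)
  have : (2 * Real.pi * h)⁻¹ - -(2 * Real.pi * h)⁻¹ = Real.pi⁻¹ * h⁻¹ := by
    field_simp; ring
  rw [this]
  have : Real.pi⁻¹ ≤ 1 := inv_le_one_of_one_le₀ (by linarith [Real.pi_gt_three])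
  exact mul_le_of_le_one_left (by positivity) this

/-- Division by Φ_g exactly undoes the noise: in the mean the kernel estimator is the low-frequency
part of f. -/
lemma deconv_mul_chf {g f : ℝ → ℝ} (hg : IsDensity g) (hf : IsDensity f)
    (hg0 : ∀ u, cf g u ≠ 0) (h v : ℝ) :
    (starRingEnd ℂ) (chf (noisyLaw g f) v) * deconv g h v =
      cutoff h v * cf f (-(2 * Real.pi * v)) := by
  rw [chf_noisyLaw hg hf, map_mul, conj_cf, conj_cf, deconv]
  have := hg0 (-(2 * Real.pi * v))
  field_simp

/-- Variance bound for the test statistic, uniform over the class of all densities. -/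
lemma integral_testStat_sub_sq_le {σ c : ℝ} {g : ℝ → ℝ} (hg : IsPolynomialNoise σ g) (hc : 0 < c)
    (hgc : ∀ u, c * (1 + |u|) ^ (-σ) ≤ ‖cf g u‖) {f f₀ : ℝ → ℝ} (hf : IsDensity f)
    (hf₀ : IsDensity f₀) (hf₀2 : MemLp f₀ 2) {n : ℕ} (hn : 2 ≤ n) {h : ℝ} (hh : 0 < h)
    (h1 : h ≤ 1) :
    Integrable (fun Y => (testStat g f₀ h n Y - truncBias f f₀ h) ^ 2) (obsLaw g f n) ∧
    ∫ Y, (testStat g f₀ h n Y - truncBias f f₀ h) ^ 2 ∂(obsLaw g f n) ≤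
      8 / n * ((c⁻¹ * 2 ^ σ * h ^ (-σ)) ^ 2 * truncBias f f₀ h * ∫ u, ‖cf g u‖) +
        4 / (n * (n - 1)) * ((c⁻¹ * 2 ^ σ * h ^ (-σ)) ^ 4 * h⁻¹ * ∫ u, ‖cf g u‖) := by
  have hπ := Real.pi_pos
  have hσ : 0 < σ := lt_trans one_pos hg.one_lt
  have hgi := hg.integrable_cf
  have := isProbabilityMeasure_noisyLaw hg.density hf
  -- Bounding |Φ_f| by 1 removes f from the variance constants.
  have hXle : ∀ v, ‖chf (noisyLaw g f) v‖ ≤ ‖cf g (2 * Real.pi * v)‖ := fun v => by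
    rw [chf_noisyLaw hg.density hf, norm_mul]
    exact mul_le_of_le_one_left (norm_nonneg _) (norm_cf_le_one hf _)
  have hgi' : Integrable fun v => ‖cf g (2 * Real.pi * v)‖ :=
    (hgi.comp_mul_left' (by positivity : 2 * Real.pi ≠ 0)).norm
  have hX : Integrable (chf (noisyLaw g f)) :=
    hgi'.mono' (continuous_chf _).aestronglyMeasurable (ae_of_all _ hXle)
  have hJ : ∫ v, ‖chf (noisyLaw g f) v‖ ≤ ∫ u, ‖cf g u‖ := by
    refine (integral_mono hX.norm hgi' hXle).trans ?_
    rw [Measure.integral_comp_mul_left (fun u => ‖cf g u‖), smul_eq_mul]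
    refine mul_le_of_le_one_left (integral_nonneg fun _ => norm_nonneg _) ?_
    rw [abs_of_pos (by positivity)]
    exact inv_le_one_of_one_le₀ (by linarith [Real.pi_gt_three])
  obtain ⟨hD, hD4⟩ := integrable_deconv hg.density hσ hc hgc hh h1
  have key := integral_kernel_uStatistic_sub_sq_le (μ := noisyLaw g f) hn hX hD
    (norm_deconv_le hσ hc hgc hh h1) hf₀.integrable hf₀2
    (k := fun y x => scaledKernel g h (x - y)) (fun y x => scaledKernel_eq_fourierInv g hh y x)
  have hm : ∫ v, ‖(starRingEnd ℂ) (chf (noisyLaw g f) v) * deconv g h v -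
      𝓕 (fun x => (f₀ x : ℂ)) v‖ ^ 2 = truncBias f f₀ h := by
    rw [truncBias]
    refine integral_congr_ae (ae_of_all _ fun v => ?_)
    dsimp only
    rw [deconv_mul_chf hg.density hf hg.cf_ne_zero, fourier_ofReal_eq_cf]
  simp only [hm] at key
  refine ⟨key.1, key.2.trans ?_⟩
  have hn2 : (2 : ℝ) ≤ n := by exact_mod_cast hn
  have hc2 : 0 ≤ 4 / ((n : ℝ) * (n - 1)) := div_nonneg (by norm_num)
    (mul_nonneg (by linarith) (by linarith))
  have hb0 : 0 ≤ truncBias f f₀ h := integral_nonneg fun _ => by positivity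
  have hX0 : 0 ≤ ∫ v, ‖chf (noisyLaw g f) v‖ := integral_nonneg fun _ => norm_nonneg _
  have hD0 : 0 ≤ ∫ v, ‖deconv g h v‖ ^ 4 := integral_nonneg fun _ => by positivity
  gcongr

lemma measurable_testStat {g f₀ : ℝ → ℝ} (hg : IsDensity g) (hf₀ : Measurable f₀) (h : ℝ) (n : ℕ) :
    Measurable (testStat g f₀ h n) := by
  have hcf := (continuous_cf hg).measurable
  have hK : Measurable (kernelC g h) := by
    have hcfK : Measurable (cfKernel g h) := by
      unfold cfKernel
      exact ((hcf.comp (by fun_prop)).inv).mul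
        (Measurable.ite (measurableSet_le (by fun_prop) measurable_const) measurable_const
          measurable_const)
    refine Measurable.const_mul ?_ _
    refine (StronglyMeasurable.integral_prod_right (f := fun x u =>
      Complex.exp (-(Complex.I * ((x * u : ℝ) : ℂ))) * cfKernel g h u) ?_).measurable
    refine Measurable.stronglyMeasurable ?_
    exact Measurable.mul (by fun_prop) (hcfK.comp measurable_snd)
  have hk : Measurable (scaledKernel g h) :=
    ((Complex.measurable_re.comp hK).comp (measurable_id.div_const h)).const_mul _
  refine Measurable.const_mul ?_ _
  refine Finset.measurable_fun_sum _ fun i _ => Finset.measurable_fun_sum _ fun j _ => ?_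
  split_ifs
  · refine (StronglyMeasurable.integral_prod_right (f := fun (Y : Fin n → ℝ) x =>
      (scaledKernel g h (x - Y i) - f₀ x) * (scaledKernel g h (x - Y j) - f₀ x)) ?_).measurable
    refine Measurable.stronglyMeasurable ?_
    have : ∀ i, Measurable fun p : (Fin n → ℝ) × ℝ => scaledKernel g h (p.2 - p.1 i) - f₀ p.2 :=
      fun i => (hk.comp (by fun_prop)).sub (hf₀.comp measurable_snd)
    exact (this i).mul (this j)
  · exact measurable_const

lemma measurableSet_rejectionRegion {g f₀ : ℝ → ℝ} (hg : IsDensity g) (hf₀ : Measurable f₀)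
    (h t κ : ℝ) (n : ℕ) : MeasurableSet (rejectionRegion g f₀ h t κ n) :=
  measurableSet_lt measurable_const (measurable_testStat hg hf₀ h n).abs

/-- Chebyshev's inequality. -/
lemma measure_le_of_forall_sq_le {Ω : Type*} [MeasurableSpace Ω] {P : Measure Ω} {Z : Ω → ℝ}
    (hZ : Integrable (fun y => Z y ^ 2) P) {S : Set Ω} {δ : ℝ} (hδ : 0 < δ)
    (hS : ∀ y ∈ S, δ ≤ Z y ^ 2) : P S ≤ ENNReal.ofReal ((∫ y, Z y ^ 2 ∂P) / δ) := by
  have h1 := mul_meas_ge_le_lintegral₀ (hZ.1.aemeasurable.ennreal_ofReal) (ENNReal.ofReal δ)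
  rw [← ofReal_integral_eq_lintegral_ofReal hZ (ae_of_all _ fun y => sq_nonneg _)] at h1
  rw [ENNReal.ofReal_div_of_pos hδ, ENNReal.le_div_iff_mul_le (by simp [hδ]) (by simp), mul_comm]
  refine le_trans (mul_le_mul_right (measure_mono fun y hy => ?_) _) h1
  exact ENNReal.ofReal_le_ofReal (hS y hy)

end TestBounds

/-! ### Bias of the truncation over Sobolev classes. -/

section SobolevTail

lemma integrable_of_mem_sobolevClass {β L : ℝ} (hL : 0 ≤ L) {f : ℝ → ℝ}
    (hf : f ∈ sobolevClass β L) :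
    Integrable (fun u => ‖cf f u‖ ^ 2 * |u| ^ (2 * β)) ∧
      ∫ u, ‖cf f u‖ ^ 2 * |u| ^ (2 * β) ≤ 2 * Real.pi * L := by
  obtain ⟨hd, -, hb⟩ := hf
  have hm : Measurable fun u => ‖cf f u‖ ^ 2 * |u| ^ (2 * β) :=
    ((continuous_cf hd).measurable.norm.pow_const 2).mul (measurable_id.abs.pow_const _)
  have h0 : ∀ u, 0 ≤ ‖cf f u‖ ^ 2 * |u| ^ (2 * β) := fun u => by positivity
  have hi : Integrable (fun u => ‖cf f u‖ ^ 2 * |u| ^ (2 * β)) := by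
    refine ⟨hm.aestronglyMeasurable, ?_⟩
    rw [hasFiniteIntegral_iff_ofReal (ae_of_all _ h0)]
    exact hb.trans_lt ENNReal.ofReal_lt_top
  refine ⟨hi, ?_⟩
  rw [integral_eq_lintegral_of_nonneg_ae (ae_of_all _ h0) hm.aestronglyMeasurable]
  exact ENNReal.toReal_le_of_le_ofReal (by positivity) hb

lemma memLp_cf {f : ℝ → ℝ} (hf : IsDensity f) (hf2 : MemLp f 2) :
    MemLp (fun v => cf f (-(2 * Real.pi * v))) 2 := by
  have := memLp_fourier hf.integrable.ofReal (hf2.ofReal (K := ℂ))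
  refine (memLp_congr_ae (ae_of_all _ fun v => ?_)).1 this
  exact fourier_ofReal_eq_cf f v

lemma memLp_cutoff_mul {b : ℝ → ℂ} (hb : MemLp b 2) (h : ℝ) :
    MemLp (fun v => cutoff h v * b v) 2 := by
  refine hb.of_le ((measurable_cutoff h).aestronglyMeasurable.mul hb.1) (ae_of_all _ fun v => ?_)
  rw [norm_mul]
  exact mul_le_of_le_one_left (norm_nonneg _) (norm_cutoff_le h v)

/-- The high-frequency part of a function of the Sobolev class. -/
lemma truncBias_self_le {β L : ℝ} (hβ : 0 < β) (hL : 0 ≤ L) {f : ℝ → ℝ}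
    (hf : f ∈ sobolevClass β L) {h : ℝ} (hh : 0 < h) : truncBias f f h ≤ L * h ^ (2 * β) := by
  have hπ := Real.pi_pos
  obtain ⟨hi, hb⟩ := integrable_of_mem_sobolevClass hL hf
  have hF := memLp_cf hf.1 hf.2.1
  have hi' : Integrable fun v => h ^ (2 * β) *
      (‖cf f (-(2 * Real.pi * v))‖ ^ 2 * |-(2 * Real.pi * v)| ^ (2 * β)) := by
    have := (hi.comp_mul_left' (R := -(2 * Real.pi)) (by
      rw [neg_ne_zero]; positivity)).const_mul (h ^ (2 * β))
    simpa only [neg_mul] using this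
  have hle : ∀ v, ‖cutoff h v * cf f (-(2 * Real.pi * v)) - cf f (-(2 * Real.pi * v))‖ ^ 2 ≤
      h ^ (2 * β) * (‖cf f (-(2 * Real.pi * v))‖ ^ 2 * |-(2 * Real.pi * v)| ^ (2 * β)) := fun v => by
    unfold cutoff
    split_ifs with hv
    · rw [one_mul, sub_self, norm_zero, zero_pow two_ne_zero]
      positivity
    · rw [zero_mul, zero_sub, norm_neg]
      push Not at hv
      -- Discarded frequencies satisfy h|u| > 1, so the Sobolev weight can be inserted at the price
      -- h^{2β}.
      have h1 : 1 ≤ h ^ (2 * β) * |-(2 * Real.pi * v)| ^ (2 * β) := by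
        rw [← Real.mul_rpow hh.le (abs_nonneg _)]
        refine Real.one_le_rpow ?_ (by positivity)
        rw [abs_neg]
        have : |2 * Real.pi * h * v| = h * |2 * Real.pi * v| := by
          rw [show 2 * Real.pi * h * v = h * (2 * Real.pi * v) by ring, abs_mul, abs_of_pos hh]
        linarith
      nlinarith [sq_nonneg ‖cf f (-(2 * Real.pi * v))‖]
  refine (integral_mono (integrable_norm_sq ((memLp_cutoff_mul hF h).sub hF)) hi' hle).trans ?_
  rw [integral_const_mul]
  have hsub := Measure.integral_comp_mul_left (fun u => ‖cf f u‖ ^ 2 * |u| ^ (2 * β))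
    (-(2 * Real.pi))
  simp only [neg_mul] at hsub
  rw [hsub, smul_eq_mul, abs_inv, abs_neg, abs_of_pos (by positivity), mul_comm L]
  refine mul_le_mul_of_nonneg_left ?_ (by positivity)
  rw [inv_mul_le_iff₀ (by positivity)]
  exact hb

/-- By Plancherel, compare f with f₀ through the low-frequency part of f; the part lost is a Sobolev
tail. Read backwards, separation of f from f₀ forces a large mean of the statistic. -/
lemma truncBias_null_le {β L : ℝ} (hβ : 0 < β) (hL : 0 ≤ L) {f f₀ : ℝ → ℝ}
    (hf : f ∈ sobolevClass β L) (hf₀ : IsDensity f₀) (hf₀2 : MemLp f₀ 2) {h : ℝ} (hh : 0 < h) :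
    ∫ x, (f x - f₀ x) ^ 2 ≤ 2 * truncBias f f₀ h + 2 * (L * h ^ (2 * β)) := by
  have hF := memLp_cf hf.1 hf.2.1
  have hF0 := memLp_cf hf₀ hf₀2
  have hi : Integrable (fun x => ((f x - f₀ x : ℝ) : ℂ)) :=
    (hf.1.integrable.sub hf₀.integrable).ofReal
  have hi2 : MemLp (fun x => ((f x - f₀ x : ℝ) : ℂ)) 2 := (hf.2.1.sub hf₀2).ofReal
  have hP := integral_norm_sq_fourier hi hi2
  have e1 : ∫ x, ‖((f x - f₀ x : ℝ) : ℂ)‖ ^ 2 = ∫ x, (f x - f₀ x) ^ 2 := by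
    simp only [Complex.norm_real, Real.norm_eq_abs, sq_abs]
  have e2 : ∀ v, 𝓕 (fun x => ((f x - f₀ x : ℝ) : ℂ)) v =
      cf f (-(2 * Real.pi * v)) - cf f₀ (-(2 * Real.pi * v)) := fun v => by
    rw [← fourier_ofReal_eq_cf, ← fourier_ofReal_eq_cf, Real.fourier_real_eq, Real.fourier_real_eq,
      Real.fourier_real_eq, ← integral_sub]
    · simp only [Complex.ofReal_sub, smul_sub]
    · exact (Real.fourierIntegral_convergent_iff v).2 hf.1.integrable.ofReal |>.congr
        (ae_of_all _ fun x => by simp [mul_comm])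
    · exact (Real.fourierIntegral_convergent_iff v).2 hf₀.integrable.ofReal |>.congr
        (ae_of_all _ fun x => by simp [mul_comm])
  rw [e1] at hP
  simp only [e2] at hP
  rw [← hP]
  refine le_trans ?_ (add_le_add le_rfl
    (mul_le_mul_of_nonneg_left (truncBias_self_le hβ hL hf hh) zero_le_two))
  have m1 := integrable_norm_sq ((memLp_cutoff_mul hF h).sub hF0)
  have m2 := integrable_norm_sq ((memLp_cutoff_mul hF h).sub hF)
  simp only [Pi.sub_apply] at m1 m2
  rw [truncBias, truncBias, ← integral_const_mul, ← integral_const_mul, ← integral_add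
    (m1.const_mul 2) (m2.const_mul 2)]
  refine integral_mono (integrable_norm_sq (hF.sub hF0)) ((m1.const_mul 2).add (m2.const_mul 2))
    fun v => ?_
  beta_reduce
  set a := cf f (-(2 * Real.pi * v))
  set b := cf f₀ (-(2 * Real.pi * v))
  set c := cutoff h v * a
  have h1 : ‖a - b‖ ≤ ‖c - b‖ + ‖c - a‖ := by
    rw [show a - b = (c - b) - (c - a) by ring]
    exact norm_sub_le _ _
  nlinarith [norm_nonneg (a - b), sq_nonneg (‖c - b‖ - ‖c - a‖)]

end SobolevTail

end NoisyTesting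

namespace NoisyTesting

/-! ### Arithmetic of the bandwidth and of the testing rate. -/

section Rates

variable {β σ : ℝ}

lemma bandwidth_pos {n : ℕ} (hn : 0 < n) : 0 < bandwidth β σ n :=
  Real.rpow_pos_of_pos (by exact_mod_cast hn) _

lemma testingRate_pos {n : ℕ} (hn : 0 < n) : 0 < testingRate β σ n :=
  Real.rpow_pos_of_pos (by exact_mod_cast hn) _

lemma bandwidth_le_one (hβ : 0 < β) (hσ : 0 < σ) {n : ℕ} (hn : 0 < n) : bandwidth β σ n ≤ 1 :=
  Real.rpow_le_one_of_one_le_of_nonpos (by exact_mod_cast hn)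
    (div_nonpos_of_nonpos_of_nonneg (by norm_num) (by positivity))

lemma bandwidth_rpow (a : ℝ) (n : ℕ) :
    bandwidth β σ n ^ a = (n : ℝ) ^ (-2 * a / (4 * β + 4 * σ + 1)) := by
  rw [bandwidth, ← Real.rpow_mul (Nat.cast_nonneg n)]
  congr 1
  ring

lemma testingRate_pow (k : ℕ) (n : ℕ) :
    testingRate β σ n ^ k = (n : ℝ) ^ (-(2 * k * β) / (4 * β + 4 * σ + 1)) := by
  rw [testingRate, ← Real.rpow_natCast, ← Real.rpow_mul (Nat.cast_nonneg n)]
  congr 1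
  ring

lemma bandwidth_rpow_two_mul (n : ℕ) : bandwidth β σ n ^ (2 * β) = testingRate β σ n ^ 2 := by
  rw [bandwidth_rpow, testingRate_pow]
  congr 1
  push_cast
  ring

/-- The exponents are -(4β+1)/E and -4β/E with E = 4β+4σ+1, so the linear variance has a margin
n^{-1/E}. -/
lemma inv_mul_bandwidth_le (hβ : 0 < β) (hσ : 0 < σ) {n : ℕ} (hn : 0 < n) :
    (n : ℝ)⁻¹ * (bandwidth β σ n ^ (-σ)) ^ 2 ≤ testingRate β σ n ^ 2 := by
  have hn1 : (1 : ℝ) ≤ n := by exact_mod_cast hn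
  rw [← Real.rpow_natCast (bandwidth β σ n ^ (-σ)) 2, ← Real.rpow_mul (bandwidth_pos hn).le,
    bandwidth_rpow, testingRate_pow, ← Real.rpow_neg_one, ← Real.rpow_add (by linarith)]
  refine Real.rpow_le_rpow_of_exponent_le hn1 ?_
  have hE : 0 < 4 * β + 4 * σ + 1 := by positivity
  rw [show (-1 : ℝ) = -(4 * β + 4 * σ + 1) / (4 * β + 4 * σ + 1) by field_simp, ← add_div]
  gcongr
  push_cast
  linarith

/-- Exact balance: the degenerate variance n⁻² h^{-4σ-1} equals the square of the squared bias
h^{2β}. This equation determines the bandwidth. -/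
lemma inv_sq_mul_bandwidth (hβ : 0 < β) (hσ : 0 < σ) {n : ℕ} (hn : 0 < n) :
    ((n : ℝ) ^ 2)⁻¹ * ((bandwidth β σ n ^ (-σ)) ^ 4 * (bandwidth β σ n)⁻¹) =
      testingRate β σ n ^ 4 := by
  have hn1 : (0 : ℝ) < n := by exact_mod_cast hn
  rw [← Real.rpow_natCast (bandwidth β σ n ^ (-σ)) 4, ← Real.rpow_mul (bandwidth_pos hn).le,
    ← Real.rpow_neg_one (bandwidth β σ n), ← Real.rpow_add (bandwidth_pos hn),
    bandwidth_rpow, testingRate_pow, ← Real.rpow_natCast (n : ℝ) 2, ← Real.rpow_neg hn1.le,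
    ← Real.rpow_add hn1]
  congr 1
  have hE : 0 < 4 * β + 4 * σ + 1 := by positivity
  field_simp
  push_cast
  ring

end Rates

/-! ### The U-statistic test attains the rate. -/

section UpperBound

/-- The constant is built from g alone and precedes f and n, which is what a supremum over the
alternative requires. -/
lemma exists_variance_bound {β σ : ℝ} (hβ : 0 < β) {g : ℝ → ℝ} (hg : IsPolynomialNoise σ g) :
    ∃ A : ℝ, 0 < A ∧ ∀ {f f₀ : ℝ → ℝ}, IsDensity f → IsDensity f₀ → MemLp f₀ 2 →
      ∀ {n : ℕ}, 2 ≤ n →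
      Integrable (fun Y => (testStat g f₀ (bandwidth β σ n) n Y -
        truncBias f f₀ (bandwidth β σ n)) ^ 2) (obsLaw g f n) ∧
      ∫ Y, (testStat g f₀ (bandwidth β σ n) n Y - truncBias f f₀ (bandwidth β σ n)) ^ 2
        ∂(obsLaw g f n) ≤
        A * testingRate β σ n ^ 4 + A * testingRate β σ n ^ 2 *
          truncBias f f₀ (bandwidth β σ n) := by
  obtain ⟨c, C, hc, -, hb⟩ := hg.exists_bounds
  have hσ : 0 < σ := lt_trans one_pos hg.one_lt
  set J := ∫ u, ‖cf g u‖ with hJ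
  have hJ0 : 0 ≤ J := integral_nonneg fun _ => norm_nonneg _
  set a := c⁻¹ * 2 ^ σ with ha
  have ha0 : 0 < a := by positivity
  refine ⟨8 * a ^ 2 * J + 8 * a ^ 4 * J + 1, by positivity, fun {f f₀} hf hf₀ hf₀2 {n} hn => ?_⟩
  have hn0 : 0 < n := by omega
  have hn2 : (2 : ℝ) ≤ n := by exact_mod_cast hn
  have hh := bandwidth_pos (β := β) (σ := σ) hn0
  obtain ⟨h1, h2⟩ := integral_testStat_sub_sq_le hg hc (fun u => (hb u).1) hf hf₀ hf₀2 hn hh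
    (bandwidth_le_one hβ hσ hn0)
  refine ⟨h1, h2.trans ?_⟩
  have hr1 := inv_mul_bandwidth_le hβ hσ hn0
  have hr2 := inv_sq_mul_bandwidth hβ hσ hn0
  set m := truncBias f f₀ (bandwidth β σ n) with hm
  have hm0 : 0 ≤ m := integral_nonneg fun _ => by positivity
  set b := bandwidth β σ n ^ (-σ) with hb'
  set t := testingRate β σ n with ht
  have ht0 : 0 < t := testingRate_pos hn0
  have e1 : 8 / (n : ℝ) * ((a * b) ^ 2 * m * J) ≤ 8 * a ^ 2 * J * (t ^ 2 * m) := by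
    calc 8 / (n : ℝ) * ((a * b) ^ 2 * m * J) = 8 * a ^ 2 * J * (((n : ℝ)⁻¹ * b ^ 2) * m) := by ring
      _ ≤ _ := by gcongr
  have e2 : 4 / ((n : ℝ) * (n - 1)) * ((a * b) ^ 4 * (bandwidth β σ n)⁻¹ * J) ≤
      8 * a ^ 4 * J * t ^ 4 := by
    -- For n ≥ 2, n - 1 ≥ n/2.
    have e3 : 4 / ((n : ℝ) * (n - 1)) ≤ 8 * ((n : ℝ) ^ 2)⁻¹ := by
      rw [← div_eq_mul_inv, div_le_div_iff₀ (by nlinarith) (by positivity)]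
      nlinarith
    calc 4 / ((n : ℝ) * (n - 1)) * ((a * b) ^ 4 * (bandwidth β σ n)⁻¹ * J)
        ≤ 8 * ((n : ℝ) ^ 2)⁻¹ * ((a * b) ^ 4 * (bandwidth β σ n)⁻¹ * J) := by gcongr
      _ = 8 * a ^ 4 * J * (((n : ℝ) ^ 2)⁻¹ * (b ^ 4 * (bandwidth β σ n)⁻¹)) := by ring
      _ = _ := by rw [hr2]
  have p1 : 0 ≤ 8 * a ^ 2 * J := by positivity
  have p2 : 0 ≤ 8 * a ^ 4 * J := by positivity
  have p3 : 0 ≤ t ^ 4 := by positivity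
  have p4 : 0 ≤ t ^ 2 * m := by positivity
  nlinarith [mul_nonneg p1 p3, mul_nonneg p2 p4]

/-- The test based on the U-statistic attains the rate `testingRate`. -/
theorem exists_attainsTestingRate {β σ L L₀ : ℝ} (hβ : 0 < β) (hL₀ : 0 < L₀) (hL : L₀ < L)
    {g : ℝ → ℝ} (hg : IsPolynomialNoise σ g) {f₀ : ℝ → ℝ} (hf₀ : f₀ ∈ sobolevClass β L₀)
    {ξ : ℝ} (hξ0 : 0 < ξ) :
    ∃ κ₀ : ℝ, 0 < κ₀ ∧ ∀ κ : ℝ, κ₀ ≤ κ →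
      AttainsTestingRate (sobolevClass β L) g f₀ ξ (testingRate β σ)
        (fun n => rejectionRegion g f₀ (bandwidth β σ n) (testingRate β σ n) κ n) := by
  obtain ⟨A, hA, hvar⟩ := exists_variance_bound hβ hg
  have hL0 : 0 < L := hL₀.trans hL
  have hf₀d := hf₀.1
  have hf₀2 := hf₀.2.1
  -- Under the null the mean is at most L₀ t² and the variance at most A(1 + L₀) t⁴, so Chebyshev
  -- needs (κ - L₀)² ≥ 2A(1 + L₀)/ξ. The extra 1 lets the square be bounded below by its base.
  refine ⟨L₀ + 1 + 2 * A * (1 + L₀) / ξ, by positivity, fun κ hκ => ⟨fun n =>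
    measurableSet_rejectionRegion hg.density hf₀d.measurable _ _ _ _, ?_⟩⟩
  have hκL : 1 + 2 * A * (1 + L₀) / ξ ≤ κ - L₀ := by linarith
  have hfr : 0 < 2 * A * (1 + L₀) / ξ := by positivity
  have hκ0 : 0 < κ := by linarith
  -- The mean m then exceeds (2κ + 1 + 16A/ξ) t². The terms serve in turn to put the threshold below
  -- m/2, to absorb t⁴ into t² m, and to make 2A t² m at most (ξ/2)(m/2)².
  refine ⟨2 * (L + 2 * κ + 1 + 16 * A / ξ), by positivity, fun C hC => ?_⟩
  refine limsup_le_of_le (by isBoundedDefault) ?_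
  filter_upwards [eventually_ge_atTop 2] with n hn
  have hn0 : 0 < n := by omega
  set h := bandwidth β σ n with hh
  set t := testingRate β σ n with ht
  have ht0 : 0 < t := testingRate_pos hn0
  have hh0 : 0 < h := bandwidth_pos hn0
  have hht : h ^ (2 * β) = t ^ 2 := bandwidth_rpow_two_mul n
  have hsplit : ENNReal.ofReal ξ = ENNReal.ofReal (ξ / 2) + ENNReal.ofReal (ξ / 2) := by
    rw [← ENNReal.ofReal_add (by positivity) (by positivity), add_halves]
  rw [testingRisk, hsplit]
  refine add_le_add ?_ (iSup₂_le fun f hf => ?_)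
  · obtain ⟨i1, v1⟩ := hvar hf₀d hf₀d hf₀2 hn
    have hm := truncBias_self_le hβ hL₀.le hf₀ hh0
    rw [hht] at hm
    have hm0 : 0 ≤ truncBias f₀ f₀ h := integral_nonneg fun _ => by positivity
    set m := truncBias f₀ f₀ h with hmdef
    have hδ : 0 < ((κ - L₀) * t ^ 2) ^ 2 := by
      have : 0 < κ - L₀ := by linarith
      positivity
    refine (measure_le_of_forall_sq_le i1 hδ fun Y hY => ?_).trans (ENNReal.ofReal_le_ofReal ?_)
    · have hY' : κ * t ^ 2 < |testStat g f₀ h n Y| := hY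
      rw [← sq_abs (testStat g f₀ h n Y - m)]
      refine pow_le_pow_left₀ (mul_nonneg (by linarith) (by positivity)) ?_ 2
      have := abs_sub_abs_le_abs_sub (testStat g f₀ h n Y) m
      rw [abs_of_nonneg hm0] at this
      linarith
    · rw [div_le_iff₀ hδ]
      have e1 : A * t ^ 4 + A * t ^ 2 * m ≤ A * (1 + L₀) * t ^ 4 := by
        have : A * t ^ 2 * m ≤ A * t ^ 2 * (L₀ * t ^ 2) := by gcongr
        nlinarith
      have e2 : A * (1 + L₀) ≤ ξ / 2 * (κ - L₀) ^ 2 := by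
        have h3 : 2 * A * (1 + L₀) / ξ ≤ (κ - L₀) ^ 2 := by nlinarith
        rw [div_le_iff₀ hξ0] at h3
        linarith
      calc _ ≤ A * (1 + L₀) * t ^ 4 := v1.trans e1
        _ ≤ ξ / 2 * (κ - L₀) ^ 2 * t ^ 4 := by gcongr
        _ = _ := by ring
  · obtain ⟨hfW, hfC⟩ := hf
    obtain ⟨i1, v1⟩ := hvar hfW.1 hf₀d hf₀2 hn
    have hm := truncBias_null_le hβ hL0.le hfW hf₀d hf₀2 hh0
    rw [hht] at hm
    set m := truncBias f f₀ h with hmdef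
    have hml : (2 * κ + 1 + 16 * A / ξ) * t ^ 2 ≤ m := by
      have : 2 * (L + 2 * κ + 1 + 16 * A / ξ) * t ^ 2 ≤ C * t ^ 2 := by gcongr
      nlinarith
    have hfr' : 0 < 16 * A / ξ := by positivity
    have ht2 : 0 < t ^ 2 := by positivity
    have hm1 : t ^ 2 ≤ m := by nlinarith
    have hm2 : 2 * κ * t ^ 2 ≤ m := by nlinarith
    have hm3 : 16 * A * t ^ 2 ≤ ξ * m := by
      have : 16 * A / ξ * t ^ 2 ≤ m := by nlinarith
      rw [div_mul_eq_mul_div, div_le_iff₀ hξ0] at this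
      linarith
    have hm0 : 0 < m := by linarith
    have hδ : 0 < (m / 2) ^ 2 := by positivity
    refine (measure_le_of_forall_sq_le i1 hδ fun Y hY => ?_).trans (ENNReal.ofReal_le_ofReal ?_)
    · have hY' : |testStat g f₀ h n Y| ≤ κ * t ^ 2 := not_lt.1 hY
      rw [← sq_abs (testStat g f₀ h n Y - m)]
      refine pow_le_pow_left₀ (by positivity) ?_ 2
      have := abs_sub_abs_le_abs_sub m (testStat g f₀ h n Y)
      rw [abs_of_pos hm0, abs_sub_comm] at this
      linarith
    · rw [div_le_iff₀ hδ]
      have e1 : A * t ^ 4 + A * t ^ 2 * m ≤ 2 * A * t ^ 2 * m := by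
        have : A * t ^ 2 * t ^ 2 ≤ A * t ^ 2 * m := by gcongr
        nlinarith
      calc _ ≤ 2 * A * t ^ 2 * m := v1.trans e1
        _ ≤ ξ / 2 * (m / 2) ^ 2 := by nlinarith

end UpperBound

end NoisyTesting

namespace NoisyTesting

/-! ### Testing a simple hypothesis against a mixture, via the χ²-divergence. -/

section Mixture

variable {X : Type*} [MeasurableSpace X] {μ : Measure X} [IsProbabilityMeasure μ] {n : ℕ}

lemma withDensity_ofReal_apply {Y : Type*} [MeasurableSpace Y] {P : Measure Y} {ρ : Y → ℝ}
    (hρ0 : ∀ y, 0 ≤ ρ y) (hρ : Integrable ρ P) {S : Set Y} (hS : MeasurableSet S) :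
    P.withDensity (fun y => ENNReal.ofReal (ρ y)) S = ENNReal.ofReal (∫ y in S, ρ y ∂P) := by
  rw [withDensity_apply _ hS, ofReal_integral_eq_lintegral_ofReal hρ.integrableOn
    (ae_of_all _ hρ0)]

/-- The product of measures with densities has the product density. -/
lemma pi_withDensity_ofReal {ρ : X → ℝ} (hρ0 : ∀ x, 0 ≤ ρ x) (hρ : Integrable ρ μ) :
    Measure.pi (fun _ : Fin n => μ.withDensity fun x => ENNReal.ofReal (ρ x)) =
      (Measure.pi fun _ : Fin n => μ).withDensity
        (fun y => ENNReal.ofReal (∏ k, ρ (y k))) := by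
  have : IsFiniteMeasure (μ.withDensity fun x => ENNReal.ofReal (ρ x)) :=
    isFiniteMeasure_withDensity_ofReal hρ.2
  refine Measure.pi_eq fun s hs => ?_
  rw [withDensity_ofReal_apply (fun y => Finset.prod_nonneg fun k _ => hρ0 _)
    (Integrable.fintype_prod fun _ => hρ) (MeasurableSet.univ_pi hs)]
  simp only [withDensity_ofReal_apply hρ0 hρ (hs _)]
  rw [← ENNReal.ofReal_prod_of_nonneg fun k _ => integral_nonneg fun x => hρ0 x]
  congr 1
  rw [← integral_indicator (MeasurableSet.univ_pi hs)]
  have e : ∀ y : Fin n → X, (Set.univ.pi s).indicator (fun y => ∏ k, ρ (y k)) y =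
      ∏ k, (s k).indicator ρ (y k) := by
    classical
    intro y
    by_cases hy : y ∈ Set.univ.pi s
    · rw [Set.indicator_of_mem hy]
      exact Finset.prod_congr rfl fun k _ => (Set.indicator_of_mem (hy k trivial) _).symm
    · rw [Set.indicator_of_notMem hy]
      simp only [Set.mem_pi, Set.mem_univ, true_implies, not_forall] at hy
      obtain ⟨k, hk⟩ := hy
      exact (Finset.prod_eq_zero (Finset.mem_univ k) (Set.indicator_of_notMem hk _)).symm
  simp only [e]
  rw [integral_fintype_prod_eq_prod (fun k => (s k).indicator ρ)]
  exact Finset.prod_congr rfl fun k _ => integral_indicator (hs k)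

lemma integral_abs_le_sqrt {P : Measure X} [IsProbabilityMeasure P] {Z : X → ℝ}
    (hZ : Integrable Z P) (hZ2 : Integrable (fun x => Z x ^ 2) P) :
    ∫ x, |Z x| ∂P ≤ Real.sqrt (∫ x, Z x ^ 2 ∂P) := by
  set s := ∫ x, |Z x| ∂P with hs
  refine Real.le_sqrt_of_sq_le ?_
  have h0 : 0 ≤ ∫ x, (|Z x| - s) ^ 2 ∂P := integral_nonneg fun x => sq_nonneg _
  have e : ∀ x, (|Z x| - s) ^ 2 = Z x ^ 2 - 2 * s * |Z x| + s ^ 2 := fun x => by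
    rw [sub_sq, sq_abs]; ring
  simp only [e] at h0
  rw [integral_add (by exact hZ2.sub (hZ.abs.const_mul _)) (integrable_const _),
    integral_sub hZ2 (hZ.abs.const_mul _), integral_const_mul, ← hs] at h0
  simp only [integral_const, probReal_univ, one_smul] at h0
  nlinarith

/-- Lower bound on the risk of testing a simple null hypothesis against a uniform mixture in terms
of the `χ²`-divergence. -/
lemma exists_risk_ge_of_chiSq_le {ι : Type*} [Fintype ι] [Nonempty ι] {ρ : ι → X → ℝ}
    (hρ0 : ∀ i x, 0 ≤ ρ i x) (hρ2 : ∀ i, MemLp (ρ i) 2 μ)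
    (hρ1 : ∀ i, ∫ x, ρ i x ∂μ = 1) {V : ℝ}
    (hV : ∑ i, ∑ j, (∫ x, ρ i x * ρ j x ∂μ) ^ n ≤ (Fintype.card ι : ℝ) ^ 2 * (1 + V))
    {R : Set (Fin n → X)} (hR : MeasurableSet R) :
    ∃ i, ENNReal.ofReal (1 - Real.sqrt V) ≤ (Measure.pi fun _ : Fin n => μ) R +
      (Measure.pi fun _ : Fin n => μ.withDensity fun x => ENNReal.ofReal (ρ i x)) Rᶜ := by
  set P := Measure.pi fun _ : Fin n => μ with hP
  have hρi : ∀ i, Integrable (ρ i) μ := fun i => (hρ2 i).integrable (by norm_num)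
  set ℓ : ι → (Fin n → X) → ℝ := fun i y => ∏ k, ρ i (y k) with hℓ
  have hℓ0 : ∀ i y, 0 ≤ ℓ i y := fun i y => Finset.prod_nonneg fun k _ => hρ0 _ _
  have hℓi : ∀ i, Integrable (ℓ i) P := fun i => Integrable.fintype_prod fun _ => hρi i
  have hℓ1 : ∀ i, ∫ y, ℓ i y ∂P = 1 := fun i => by
    rw [hℓ, hP, integral_fintype_prod_eq_prod fun _ => ρ i]
    simp [hρ1]
  have hℓℓ : ∀ i j y, ℓ i y * ℓ j y = ∏ k, (ρ i (y k) * ρ j (y k)) := fun i j y => by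
    rw [Finset.prod_mul_distrib]
  have hℓij : ∀ i j, Integrable (fun y => ℓ i y * ℓ j y) P := fun i j => by
    simp only [hℓℓ]
    exact Integrable.fintype_prod (f := fun _ x => ρ i x * ρ j x)
      fun _ => (hρ2 i).integrable_mul (hρ2 j)
  have hℓv : ∀ i j, ∫ y, ℓ i y * ℓ j y ∂P = (∫ x, ρ i x * ρ j x ∂μ) ^ n := fun i j => by
    simp only [hℓℓ]
    rw [hP, integral_fintype_prod_eq_prod fun _ x => ρ i x * ρ j x]
    simp
  set N : ℝ := (Fintype.card ι : ℝ) with hN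
  have hN0 : 0 < N := by rw [hN]; exact_mod_cast Fintype.card_pos
  -- Z is the likelihood ratio of the mixture minus 1; its second moment is the χ²-divergence, at
  -- most V.
  set Z : (Fin n → X) → ℝ := fun y => N⁻¹ * ∑ i, ℓ i y - 1 with hZ
  have hsum : Integrable (fun y => ∑ i, ℓ i y) P := integrable_finsetSum _ fun i _ => hℓi i
  have hZi : Integrable Z P := (hsum.const_mul _).sub (integrable_const _)
  have hZsq : ∀ y, Z y ^ 2 = N⁻¹ ^ 2 * ∑ i, ∑ j, ℓ i y * ℓ j y -
      2 * N⁻¹ * ∑ i, ℓ i y + 1 := fun y => by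
    rw [hZ, ← Finset.sum_mul_sum]; ring
  have hdd : Integrable (fun y => ∑ i, ∑ j, ℓ i y * ℓ j y) P :=
    integrable_finsetSum _ fun i _ => integrable_finsetSum _ fun j _ => hℓij i j
  have hZ2 : Integrable (fun y => Z y ^ 2) P := by
    simp only [hZsq]
    exact ((hdd.const_mul _).sub (hsum.const_mul _)).add (integrable_const _)
  have hZ2v : ∫ y, Z y ^ 2 ∂P ≤ V := by
    simp only [hZsq]
    rw [integral_add (by exact (hdd.const_mul _).sub (hsum.const_mul _)) (integrable_const _),
      integral_sub (hdd.const_mul _) (hsum.const_mul _), integral_const_mul, integral_const_mul,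
      integral_finsetSum _ fun i _ => hℓi i,
      integral_finsetSum _ fun i _ => integrable_finsetSum _ fun j _ => hℓij i j]
    simp only [integral_finsetSum _ fun j _ => hℓij _ j, hℓv, hℓ1, integral_const,
      probReal_univ, one_smul, Finset.sum_const, Finset.card_univ, nsmul_eq_mul, mul_one]
    rw [← hN]
    have h1 := mul_le_mul_of_nonneg_left hV (sq_nonneg N⁻¹)
    have h2 : N⁻¹ ^ 2 * (N ^ 2 * (1 + V)) = 1 + V := by field_simp
    have h3 : 2 * N⁻¹ * N = 2 := by field_simp
    rw [h3]
    linarith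
  have hRr : (P R).toReal = 1 - ∫ _y in Rᶜ, (1 : ℝ) ∂P := by
    rw [integral_const, smul_eq_mul, mul_one, measureReal_restrict_apply MeasurableSet.univ,
      Set.univ_inter, measureReal_compl hR, probReal_univ, measureReal_def]
    ring
  -- The total error of R against the mixture is 1 plus the integral of Z over Rᶜ, hence at least 1
  -- - ∫|Z|.
  have hbound : 1 - Real.sqrt V ≤ (P R).toReal + N⁻¹ * ∑ i, ∫ y in Rᶜ, ℓ i y ∂P := by
    have e1 : ∫ y in Rᶜ, Z y ∂P = N⁻¹ * ∑ i, (∫ y in Rᶜ, ℓ i y ∂P) - ∫ _y in Rᶜ, (1 : ℝ) ∂P := by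
      rw [hZ, integral_sub (hsum.integrableOn.const_mul _) (integrable_const _),
        integral_const_mul, integral_finsetSum _ fun i _ => (hℓi i).integrableOn]
    have e2 : -∫ y in Rᶜ, Z y ∂P ≤ ∫ y, |Z y| ∂P := by
      calc -∫ y in Rᶜ, Z y ∂P ≤ |∫ y in Rᶜ, Z y ∂P| := neg_le_abs _
        _ ≤ ∫ y in Rᶜ, |Z y| ∂P := abs_integral_le_integral_abs
        _ ≤ ∫ y, |Z y| ∂P := setIntegral_le_integral hZi.abs (ae_of_all _ fun y => abs_nonneg _)
    have e3 := (integral_abs_le_sqrt hZi hZ2).trans (Real.sqrt_le_sqrt hZ2v)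
    linarith
  -- The mixture bound is an average over i, so some component attains it.
  obtain ⟨i, -, hi⟩ := Finset.exists_le_of_sum_le (s := (Finset.univ : Finset ι))
    Finset.univ_nonempty (f := fun _ => 1 - Real.sqrt V - (P R).toReal)
    (g := fun i => ∫ y in Rᶜ, ℓ i y ∂P) (by
      rw [Finset.sum_const, Finset.card_univ, nsmul_eq_mul, ← hN]
      have := mul_le_mul_of_nonneg_left hbound hN0.le
      rw [mul_add, mul_inv_cancel_left₀ hN0.ne'] at this
      linarith)
  refine ⟨i, ?_⟩
  rw [pi_withDensity_ofReal (hρ0 i) (hρi i), withDensity_ofReal_apply (hℓ0 i) (hℓi i) hR.compl,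
    ← ENNReal.ofReal_toReal (measure_ne_top P R), ← ENNReal.ofReal_add ENNReal.toReal_nonneg
    (integral_nonneg fun y => hℓ0 i y)]
  exact ENNReal.ofReal_le_ofReal (by linarith)

end Mixture

/-! ### Exponential moments of random signs. -/

section SignSums

variable {M : ℕ}

/-- The sign vectors of length `M`. -/
noncomputable def signVectors (M : ℕ) : Finset (Fin M → ℝ) := Fintype.piFinset fun _ => {1, -1}

lemma card_signVectors (M : ℕ) : (signVectors M).card = 2 ^ M := by
  rw [signVectors, Fintype.card_piFinset]
  have : ({1, -1} : Finset ℝ).card = 2 := Finset.card_pair (by norm_num)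
  simp [this]

lemma sq_eq_one_of_mem_signVectors {θ : Fin M → ℝ} (h : θ ∈ signVectors M) (j : Fin M) :
    θ j ^ 2 = 1 := by
  have := Fintype.mem_piFinset.1 h j
  rw [Finset.mem_insert, Finset.mem_singleton] at this
  rcases this with h | h <;> rw [h] <;> norm_num

lemma sum_sq_of_mem_signVectors {θ : Fin M → ℝ} (h : θ ∈ signVectors M) :
    ∑ j, θ j ^ 2 = M := by
  simp [sq_eq_one_of_mem_signVectors h]

/-- The sum factorises over coordinates into terms 2 cosh(c_j), and cosh x ≤ e^{x²/2}. -/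
lemma sum_exp_signVectors_le (c : Fin M → ℝ) :
    ∑ θ ∈ signVectors M, Real.exp (∑ j, θ j * c j) ≤
      2 ^ M * Real.exp ((∑ j, c j ^ 2) / 2) := by
  have h1 : ∑ θ ∈ signVectors M, Real.exp (∑ j, θ j * c j) =
      ∏ j, ∑ s ∈ ({1, -1} : Finset ℝ), Real.exp (s * c j) := by
    rw [Finset.prod_univ_sum]
    simp only [Real.exp_sum]
    rfl
  rw [h1]
  have h2 : ∀ j, ∑ s ∈ ({1, -1} : Finset ℝ), Real.exp (s * c j) = 2 * Real.cosh (c j) := fun j => by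
    rw [Finset.sum_pair (by norm_num), Real.cosh_eq]
    ring_nf
  simp only [h2]
  calc ∏ j, (2 * Real.cosh (c j)) ≤ ∏ j, (2 * Real.exp (c j ^ 2 / 2)) :=
        Finset.prod_le_prod (fun j _ => by have := Real.cosh_pos (c j); positivity)
          fun j _ => mul_le_mul_of_nonneg_left (Real.cosh_le_exp_half_sq _) zero_le_two
    _ = _ := by
        rw [Finset.prod_mul_distrib, ← Real.exp_sum, ← Finset.sum_div]
        simp

/-- A sign average of exponentials of a positive semidefinite form `B ≤ λ`. -/
lemma sum_sum_exp_form_le {B : Fin M → Fin M → ℝ} (hsymm : ∀ i j, B i j = B j i)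
    (hpos : ∀ x : Fin M → ℝ, 0 ≤ ∑ i, ∑ j, x i * x j * B i j) {lam : ℝ} (hlam : 0 ≤ lam)
    (hle : ∀ x : Fin M → ℝ, ∑ i, ∑ j, x i * x j * B i j ≤ lam * ∑ i, x i ^ 2) (n : ℕ) :
    ∑ θ ∈ signVectors M, ∑ θ' ∈ signVectors M, Real.exp (n * ∑ i, ∑ j, θ i * θ' j * B i j) ≤
      (2 ^ M) ^ 2 * Real.exp (n ^ 2 * lam ^ 2 * M / 2) := by
  -- From 0 ≤ B ≤ λ follows |Bx| ≤ λ|x|. Without diagonalising: nonnegativity of the form at λx -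
  -- Bx, with the upper bound at x and at Bx, gives λ|Bx|² ≤ λ³|x|².
  have key : ∀ x : Fin M → ℝ, ∑ j, (∑ i, x i * B i j) ^ 2 ≤ lam ^ 2 * ∑ i, x i ^ 2 := by
    intro x
    set y : Fin M → ℝ := fun j => ∑ i, x i * B i j with hy
    set Nn := ∑ j, y j ^ 2 with hNn
    have hcross : ∑ i, ∑ j, x i * y j * B i j = Nn := by
      rw [Finset.sum_comm, hNn]
      refine Finset.sum_congr rfl fun j _ => ?_
      rw [sq]
      nth_rewrite 3 [hy]
      rw [Finset.mul_sum]
      exact Finset.sum_congr rfl fun i _ => by ring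
    have hcross' : ∑ i, ∑ j, y i * x j * B i j = Nn := by
      rw [← hcross, Finset.sum_comm]
      refine Finset.sum_congr rfl fun i _ => Finset.sum_congr rfl fun j _ => ?_
      rw [hsymm]; ring
    have hN0 : 0 ≤ Nn := Finset.sum_nonneg fun j _ => sq_nonneg _
    -- positivity of the form at `y - lam x`
    have h1 := hpos fun i => lam * x i - y i
    have e1 : ∑ i, ∑ j, (lam * x i - y i) * (lam * x j - y j) * B i j =
        lam ^ 2 * ∑ i, ∑ j, x i * x j * B i j - lam * ∑ i, ∑ j, x i * y j * B i j -
          lam * ∑ i, ∑ j, y i * x j * B i j + ∑ i, ∑ j, y i * y j * B i j := by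
      simp only [Finset.mul_sum, ← Finset.sum_sub_distrib, ← Finset.sum_add_distrib]
      exact Finset.sum_congr rfl fun i _ => Finset.sum_congr rfl fun j _ => by ring
    rw [e1, hcross, hcross'] at h1
    have h2 := hle x
    have h3 := hle y
    rw [← hNn] at h3
    have h4 : lam ^ 2 * ∑ i, ∑ j, x i * x j * B i j ≤ lam ^ 2 * (lam * ∑ i, x i ^ 2) :=
      mul_le_mul_of_nonneg_left h2 (sq_nonneg _)
    -- For λ = 0 there is nothing to divide by; the form vanishes identically, and polarising it at
    -- x and Bx gives Bx = 0.
    rcases hlam.eq_or_lt with h0 | h0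
    · have hz : ∀ z : Fin M → ℝ, ∑ i, ∑ j, z i * z j * B i j = 0 := fun z =>
        le_antisymm (by simpa [← h0] using hle z) (hpos z)
      have h5 := hz fun i => x i + y i
      have e2 : ∑ i, ∑ j, (x i + y i) * (x j + y j) * B i j =
          ∑ i, ∑ j, x i * x j * B i j + ∑ i, ∑ j, x i * y j * B i j +
          ∑ i, ∑ j, y i * x j * B i j + ∑ i, ∑ j, y i * y j * B i j := by
        simp only [← Finset.sum_add_distrib]
        exact Finset.sum_congr rfl fun i _ => Finset.sum_congr rfl fun j _ => by ring
      rw [e2, hz, hz, hcross, hcross'] at h5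
      have : Nn = 0 := by linarith
      rw [this, ← h0]
      simp
    · have h6 : lam * Nn ≤ lam * (lam ^ 2 * ∑ i, x i ^ 2) := by nlinarith
      exact le_of_mul_le_mul_left h6 h0
  -- With θ fixed the exponent is linear in θ' with coefficients n(Bθ)_j, whose squares sum to at
  -- most n²λ²M.
  have h1 : ∀ θ ∈ signVectors M,
      ∑ θ' ∈ signVectors M, Real.exp (n * ∑ i, ∑ j, θ i * θ' j * B i j) ≤
        2 ^ M * Real.exp (n ^ 2 * lam ^ 2 * M / 2) := by
    intro θ hθ
    have e : ∀ θ' : Fin M → ℝ, n * ∑ i, ∑ j, θ i * θ' j * B i j =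
        ∑ j, θ' j * (n * ∑ i, θ i * B i j) := fun θ' => by
      rw [Finset.sum_comm, Finset.mul_sum]
      refine Finset.sum_congr rfl fun j _ => ?_
      simp only [Finset.mul_sum]
      exact Finset.sum_congr rfl fun i _ => by ring
    simp only [e]
    refine (sum_exp_signVectors_le _).trans (mul_le_mul_of_nonneg_left
      (Real.exp_le_exp.2 ?_) (by positivity))
    have := key θ
    rw [sum_sq_of_mem_signVectors hθ] at this
    simp only [mul_pow, ← Finset.mul_sum]
    have h2 := mul_le_mul_of_nonneg_left this (sq_nonneg (n : ℝ))
    linarith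
  refine (Finset.sum_le_sum h1).trans (le_of_eq ?_)
  rw [Finset.sum_const, card_signVectors, nsmul_eq_mul]
  push_cast
  ring

end SignSums

end NoisyTesting

namespace NoisyTesting

open FourierTransform SchwartzMap

/-! ### Parseval for windowed trigonometric polynomials. -/

section TrigonometricPolynomials

variable {M : ℕ}

/-- The trigonometric polynomial `s ↦ ∑ j < M, c_j e^{-2πijs}`. -/
noncomputable def trigPoly (c : Fin M → ℂ) (s : ℝ) : ℂ := ∑ j, c j * expi (-(j * s))

@[fun_prop] lemma continuous_trigPoly (c : Fin M → ℂ) : Continuous (trigPoly c) := by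
  unfold trigPoly
  fun_prop

lemma hasDerivAt_expi_mul (a s : ℝ) :
    HasDerivAt (fun s : ℝ => expi (a * s)) (2 * Real.pi * a * Complex.I * expi (a * s)) s := by
  unfold expi
  have h1 : HasDerivAt (fun s : ℝ => ((2 * Real.pi * (a * s) : ℝ) : ℂ) * Complex.I)
      (((2 * Real.pi * a : ℝ) : ℂ) * Complex.I) s := by
    refine HasDerivAt.mul_const ?_ _
    refine HasDerivAt.ofReal_comp ?_
    have := ((hasDerivAt_id s).const_mul (2 * Real.pi * a))
    simpa [mul_assoc] using this
  convert! h1.cexp using 1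
  push_cast
  ring

lemma hasDerivAt_trigPoly (c : Fin M → ℂ) (s : ℝ) :
    HasDerivAt (trigPoly c)
      (trigPoly (fun j => -(2 * Real.pi * j * Complex.I) * c j) s) s := by
  unfold trigPoly
  refine HasDerivAt.fun_sum fun j _ => ?_
  have := (hasDerivAt_expi_mul (-(j : ℝ)) s).const_mul (c j)
  simp only [neg_mul] at this ⊢
  convert! this using 1
  push_cast
  ring

lemma intervalIntegral_expi (k : ℤ) (a : ℝ) :
    ∫ s in a..a + 1, expi (k * s) = if k = 0 then 1 else 0 := by
  split_ifs with hk
  · simp [hk]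
  · have hk' : (2 * Real.pi * (k : ℝ) * Complex.I : ℂ) ≠ 0 := by
      have hπ := Real.pi_ne_zero
      simp [hk, hπ]
    have hd : ∀ s ∈ Set.uIcc a (a + 1), HasDerivAt
        (fun s : ℝ => (2 * Real.pi * (k : ℝ) * Complex.I : ℂ)⁻¹ * expi (k * s)) (expi (k * s)) s :=
      fun s _ => by
        have := (hasDerivAt_expi_mul (k : ℝ) s).const_mul
          ((2 * Real.pi * (k : ℝ) * Complex.I : ℂ)⁻¹)
        rwa [inv_mul_cancel_left₀ hk'] at this
    rw [intervalIntegral.integral_eq_sub_of_hasDerivAt hd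
      (Continuous.intervalIntegrable (by fun_prop) _ _)]
    have : expi ((k : ℝ) * (a + 1)) = expi (k * a) := by
      rw [mul_add, expi_add, mul_one]
      have : expi (k : ℝ) = 1 := by
        rw [expi]
        have := Complex.exp_int_mul_two_pi_mul_I k
        rw [← this]
        congr 1
        push_cast
        ring
      rw [this, mul_one]
    rw [this, sub_self]

/-- Parseval's identity for trigonometric polynomials. -/
lemma intervalIntegral_norm_sq_trigPoly (c : Fin M → ℂ) (a : ℝ) :
    ∫ s in a..a + 1, ‖trigPoly c s‖ ^ 2 = ∑ j, ‖c j‖ ^ 2 := by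
  have e : ∀ s : ℝ, ((‖trigPoly c s‖ ^ 2 : ℝ) : ℂ) =
      ∑ i, ∑ j, c i * (starRingEnd ℂ) (c j) * expi (((j : ℤ) - (i : ℤ) : ℤ) * s) := fun s => by
    push_cast
    rw [← Complex.mul_conj', trigPoly, map_sum, Finset.sum_mul_sum]
    refine Finset.sum_congr rfl fun i _ => Finset.sum_congr rfl fun j _ => ?_
    rw [map_mul, conj_expi, show ((j : ℝ) - (i : ℝ)) * s = -((i : ℝ) * s) + - -((j : ℝ) * s) by ring,
      expi_add]
    ring
  have hc : ((∫ s in a..a + 1, ‖trigPoly c s‖ ^ 2 : ℝ) : ℂ) = ((∑ j, ‖c j‖ ^ 2 : ℝ) : ℂ) := by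
    rw [← intervalIntegral.integral_ofReal]
    simp only [e]
    rw [intervalIntegral.integral_finsetSum
      (fun i _ => Continuous.intervalIntegrable (by fun_prop) _ _)]
    rw [Complex.ofReal_sum]
    refine Finset.sum_congr rfl fun i _ => ?_
    rw [intervalIntegral.integral_finsetSum
      (fun i _ => Continuous.intervalIntegrable (by fun_prop) _ _)]
    simp only [intervalIntegral.integral_const_mul, intervalIntegral_expi]
    rw [Finset.sum_eq_single i]
    · simp [Complex.mul_conj']
    · intro j _ hj
      rw [if_neg, mul_zero]
      intro h0
      apply hj
      ext
      omega
    · simp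
  exact_mod_cast hc

lemma integrable_of_support_Icc {ψ : ℝ → ℝ} (hψ : Continuous ψ) {a : ℝ}
    (hs : ∀ v, a < |v| → ψ v = 0) : Integrable ψ := by
  refine hψ.integrable_of_hasCompactSupport (HasCompactSupport.intro
    (isCompact_Icc (a := -a) (b := a)) fun v hv => hs v ?_)
  by_contra h
  exact hv (abs_le.1 (not_lt.1 h))

/-- The support lies in [-4, 4], which is eight periods. -/
lemma integral_sq_mul_trigPoly_le {ψ : ℝ → ℝ} (hψ : Continuous ψ) {B : ℝ}
    (hB : ∀ v, |ψ v| ≤ B) (hs : ∀ v, 4 < |v| → ψ v = 0) (c : Fin M → ℂ) :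
    Integrable (fun s => ψ s ^ 2 * ‖trigPoly c s‖ ^ 2) ∧
    ∫ s, ψ s ^ 2 * ‖trigPoly c s‖ ^ 2 ≤ 8 * B ^ 2 * ∑ j, ‖c j‖ ^ 2 := by
  have hcont : Continuous fun s => ψ s ^ 2 * ‖trigPoly c s‖ ^ 2 := by fun_prop
  have hi := integrable_of_support_Icc hcont (a := 4) fun v hv => by simp [hs v hv]
  refine ⟨hi, ?_⟩
  have hcP : Continuous fun s => ‖trigPoly c s‖ ^ 2 := by fun_prop
  have hsum := intervalIntegral.sum_integral_adjacent_intervals (f := fun s => ‖trigPoly c s‖ ^ 2)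
    (μ := volume) (a := fun k : ℕ => (-4 + k : ℝ)) (n := 8)
    (fun k _ => hcP.intervalIntegrable _ _)
  have hk : ∀ k : ℕ, ∫ s in (-4 + k : ℝ)..(-4 + (k + 1 : ℕ) : ℝ), ‖trigPoly c s‖ ^ 2 =
      ∑ j, ‖c j‖ ^ 2 := fun k => by
    rw [← intervalIntegral_norm_sq_trigPoly c (-4 + k)]
    congr 1
    push_cast
    ring
  simp only [hk, Finset.sum_const, Finset.card_range, nsmul_eq_mul] at hsum
  have hI : ∫ s in Set.Ioc (-4 : ℝ) 4, ‖trigPoly c s‖ ^ 2 = 8 * ∑ j, ‖c j‖ ^ 2 := by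
    rw [← intervalIntegral.integral_of_le (by norm_num)]
    norm_num at hsum
    rw [hsum]
  have hle : ∀ s, ψ s ^ 2 * ‖trigPoly c s‖ ^ 2 ≤
      (Set.Icc (-4 : ℝ) 4).indicator (fun s => B ^ 2 * ‖trigPoly c s‖ ^ 2) s := fun s => by
    by_cases h : s ∈ Set.Icc (-4 : ℝ) 4
    · rw [Set.indicator_of_mem h]
      refine mul_le_mul_of_nonneg_right ?_ (by positivity)
      rw [← sq_abs]
      exact pow_le_pow_left₀ (abs_nonneg _) (hB s) 2
    · rw [Set.indicator_of_notMem h, hs s]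
      · simp
      · by_contra h'
        exact h (abs_le.1 (not_lt.1 h'))
  have hi2 : Integrable ((Set.Icc (-4 : ℝ) 4).indicator fun s => B ^ 2 * ‖trigPoly c s‖ ^ 2) :=
    (integrable_indicator_iff measurableSet_Icc).2
      (Continuous.integrableOn_Icc (by fun_prop))
  refine (integral_mono hi hi2 hle).trans (le_of_eq ?_)
  rw [integral_indicator measurableSet_Icc, integral_Icc_eq_integral_Ioc, integral_const_mul, hI]
  ring

/-- The plateau [2, 3] is one full period, and Parseval is exact on it. -/
lemma le_integral_sq_mul_trigPoly {ψ : ℝ → ℝ} (hψ : Continuous ψ)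
    (hs : ∀ v, 4 < |v| → ψ v = 0) (h1 : ∀ v, 2 ≤ v → v ≤ 3 → ψ v = 1) (c : Fin M → ℂ) :
    ∑ j, ‖c j‖ ^ 2 ≤ ∫ s, ψ s ^ 2 * ‖trigPoly c s‖ ^ 2 := by
  have hcont : Continuous fun s => ψ s ^ 2 * ‖trigPoly c s‖ ^ 2 := by fun_prop
  have hi := integrable_of_support_Icc hcont (a := 4) fun v hv => by simp [hs v hv]
  have h2 := intervalIntegral_norm_sq_trigPoly c 2
  rw [intervalIntegral.integral_of_le (by norm_num)] at h2
  rw [← h2]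
  refine le_trans (le_of_eq ?_) (setIntegral_le_integral hi (ae_of_all _ fun s => by positivity)
    (s := Set.Ioc 2 (2 + 1)))
  refine setIntegral_congr_fun measurableSet_Ioc fun s hs' => ?_
  rw [h1 s hs'.1.le (by linarith [hs'.2]), one_pow, one_mul]

end TrigonometricPolynomials

/-! ### A band-limited smooth wavelet with fast decay. -/

section Window

/-- A smooth even window equal to one on `2 ≤ |v| ≤ 3` and supported in `1 ≤ |v| ≤ 4`. -/
noncomputable def window (v : ℝ) : ℝ :=
  -- In the variable v² the plateau is [4, 9] and the bump vanishes outside (1, 12); using v² makes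
  -- the window even, so its transform is real.
  (⟨5 / 2, 11 / 2, by norm_num, by norm_num⟩ : ContDiffBump (13 / 2 : ℝ)) (v ^ 2)

lemma contDiff_window : ContDiff ℝ (⊤ : ℕ∞) window := by
  unfold window
  exact (ContDiffBump.contDiff _).comp (contDiff_id.pow 2)

lemma continuous_window : Continuous window := contDiff_window.continuous

lemma window_neg (v : ℝ) : window (-v) = window v := by simp [window]

lemma window_nonneg (v : ℝ) : 0 ≤ window v := ContDiffBump.nonneg _

lemma window_le_one (v : ℝ) : window v ≤ 1 := ContDiffBump.le_one _

lemma abs_window_le_one (v : ℝ) : |window v| ≤ 1 := by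
  rw [abs_of_nonneg (window_nonneg v)]; exact window_le_one v

lemma window_eq_one {v : ℝ} (h2 : 2 ≤ v) (h3 : v ≤ 3) : window v = 1 := by
  refine ContDiffBump.one_of_mem_closedBall _ ?_
  rw [Metric.mem_closedBall, Real.dist_eq, abs_le]
  constructor <;> dsimp only <;> nlinarith

lemma window_eq_zero_of_lt {v : ℝ} (h : |v| < 1) : window v = 0 := by
  refine ContDiffBump.zero_of_le_dist _ ?_
  rw [Real.dist_eq, le_abs]
  right
  dsimp only
  rw [← sq_abs]
  nlinarith [abs_nonneg v]

lemma window_eq_zero_of_gt {v : ℝ} (h : 4 < |v|) : window v = 0 := by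
  refine ContDiffBump.zero_of_le_dist _ ?_
  rw [Real.dist_eq, le_abs]
  left
  dsimp only
  rw [← sq_abs]
  nlinarith [abs_nonneg v]

lemma hasCompactSupport_window : HasCompactSupport window :=
  HasCompactSupport.intro (isCompact_Icc (a := (-4 : ℝ)) (b := 4)) fun v hv =>
    window_eq_zero_of_gt (by
      by_contra h
      exact hv (abs_le.1 (not_lt.1 h)))

lemma deriv_window_eq_zero_of_gt {v : ℝ} (h : 4 < |v|) : deriv window v = 0 := by
  have : window =ᶠ[𝓝 v] fun _ => 0 := by
    filter_upwards [(isOpen_lt continuous_const continuous_abs).mem_nhds h] with w hw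
    exact window_eq_zero_of_gt hw
  rw [this.deriv_eq, deriv_const]

lemma deriv_window_eq_zero_of_lt {v : ℝ} (h : |v| < 1) : deriv window v = 0 := by
  have : window =ᶠ[𝓝 v] fun _ => 0 := by
    filter_upwards [(isOpen_lt continuous_abs continuous_const).mem_nhds h] with w hw
    exact window_eq_zero_of_lt hw
  rw [this.deriv_eq, deriv_const]

lemma continuous_deriv_window : Continuous (deriv window) :=
  contDiff_window.continuous_deriv (by simp)

lemma hasDerivAt_window (v : ℝ) : HasDerivAt window (deriv window v) v :=
  (contDiff_window.differentiable (by simp) v).hasDerivAt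

lemma exists_abs_deriv_window_le : ∃ B : ℝ, 0 < B ∧ ∀ v, |deriv window v| ≤ B := by
  obtain ⟨B, hB⟩ := (hasCompactSupport_window.deriv).exists_bound_of_continuous
    continuous_deriv_window
  exact ⟨max B 1, by positivity, fun v => (hB v).trans (le_max_left _ _)⟩

/-- The window as a Schwartz function. -/
noncomputable def windowS : 𝓢(ℝ, ℂ) :=
  HasCompactSupport.toSchwartzMap (f := fun v => (window v : ℂ))
    (hasCompactSupport_window.comp_left (g := fun x : ℝ => (x : ℂ)) Complex.ofReal_zero)
    (Complex.ofRealCLM.contDiff.comp contDiff_window)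

@[simp] lemma windowS_apply (v : ℝ) : windowS v = (window v : ℂ) := rfl

/-- The inverse Fourier transform of the window. -/
noncomputable def wavelet (x : ℝ) : ℝ := ((𝓕⁻ windowS : 𝓢(ℝ, ℂ)) x).re

lemma ofReal_wavelet (x : ℝ) : (wavelet x : ℂ) = (𝓕⁻ windowS : 𝓢(ℝ, ℂ)) x := by
  refine Complex.conj_eq_iff_re.1 ?_
  rw [SchwartzMap.fourierInv_coe, conj_fourierInv_of_real (fun v => by simp)]
  rw [fourierInv_real_eq, fourierInv_real_eq, ← integral_neg_eq_self]
  refine integral_congr_ae (ae_of_all _ fun v => ?_)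
  simp [window_neg]

lemma contDiff_wavelet : ContDiff ℝ (⊤ : ℕ∞) wavelet :=
  Complex.reCLM.contDiff.comp ((𝓕⁻ windowS : 𝓢(ℝ, ℂ)).smooth ⊤)

lemma integrable_wavelet : Integrable wavelet := (𝓕⁻ windowS : 𝓢(ℝ, ℂ)).integrable.re

lemma fourier_wavelet (v : ℝ) : 𝓕 (fun x => (wavelet x : ℂ)) v = window v := by
  simp only [ofReal_wavelet]
  rw [← windowS_apply]
  have : (𝓕 (𝓕⁻ windowS) : 𝓢(ℝ, ℂ)) = windowS := FourierTransform.fourier_fourierInv_eq _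
  conv_rhs => rw [← this]
  rw [SchwartzMap.fourier_coe]

/-- Of the two factors 1 + x², one matches the tail of f₀ and the other makes the sum over
translates converge. -/
lemma exists_abs_wavelet_le : ∃ K : ℝ, 0 < K ∧ ∀ x, (1 + x ^ 2) ^ 2 * |wavelet x| ≤ K := by
  obtain ⟨C0, hC0⟩ := (𝓕⁻ windowS : 𝓢(ℝ, ℂ)).decay 0 0
  obtain ⟨C4, hC4⟩ := (𝓕⁻ windowS : 𝓢(ℝ, ℂ)).decay 4 0
  refine ⟨2 * C0 + 2 * C4, by have := hC0.1; have := hC4.1; positivity, fun x => ?_⟩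
  have h0 := hC0.2 x
  have h4 := hC4.2 x
  rw [norm_iteratedFDeriv_zero] at h0 h4
  simp only [pow_zero, one_mul, Real.norm_eq_abs] at h0 h4
  have hx : |x| ^ 4 = x ^ 4 := by rw [← abs_pow]; exact abs_of_nonneg (by positivity)
  rw [hx] at h4
  have hw : |wavelet x| ≤ ‖(𝓕⁻ windowS : 𝓢(ℝ, ℂ)) x‖ := Complex.abs_re_le_norm _
  have hle : (1 + x ^ 2) ^ 2 ≤ 2 + 2 * x ^ 4 := by nlinarith [sq_nonneg (x ^ 2 - 1)]
  calc (1 + x ^ 2) ^ 2 * |wavelet x|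
      ≤ (2 + 2 * x ^ 4) * ‖(𝓕⁻ windowS : 𝓢(ℝ, ℂ)) x‖ := by gcongr
    _ ≤ _ := by linarith

end Window

end NoisyTesting

namespace NoisyTesting

open FourierTransform SchwartzMap

/-! ### A lattice sum bounded uniformly in its length. -/

section LatticeSum

/-- Each term is at most 3 times the integral of the same function over [j, j+1], since there 1 + (t
- y)² ≤ 3(1 + (y - j)²); the whole integral is π. -/
lemma sum_inv_one_add_sq_le (M : ℕ) (y : ℝ) :
    ∑ j : Fin M, (1 + (y - j) ^ 2)⁻¹ ≤ 3 * Real.pi := by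
  have hint : Integrable fun t : ℝ => (1 + (t - y) ^ 2)⁻¹ :=
    (integrable_inv_one_add_sq).comp_sub_right y
  have hc : Continuous fun t : ℝ => (1 + (t - y) ^ 2)⁻¹ :=
    Continuous.inv₀ (by fun_prop) fun t => by positivity
  have h1 : ∀ j : ℕ, (1 + (y - j) ^ 2)⁻¹ ≤
      3 * ∫ t in (j : ℝ)..((j + 1 : ℕ) : ℝ), (1 + (t - y) ^ 2)⁻¹ := by
    intro j
    have hle : ∫ _t in (j : ℝ)..((j + 1 : ℕ) : ℝ), (3 * (1 + (y - j) ^ 2))⁻¹ ≤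
        ∫ t in (j : ℝ)..((j + 1 : ℕ) : ℝ), (1 + (t - y) ^ 2)⁻¹ := by
      refine intervalIntegral.integral_mono_on (by push_cast; linarith)
        intervalIntegrable_const (hc.intervalIntegrable _ _) fun t ht => ?_
      refine inv_anti₀ (by positivity) ?_
      have ht1 := ht.1
      have ht2 := ht.2
      push_cast at ht2
      nlinarith [sq_nonneg (t + y - 2 * j)]
    rw [intervalIntegral.integral_const] at hle
    push_cast at hle ⊢
    rw [add_sub_cancel_left, one_smul, mul_inv] at hle
    linarith
  have h2 := intervalIntegral.sum_integral_adjacent_intervals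
    (f := fun t : ℝ => (1 + (t - y) ^ 2)⁻¹) (μ := volume) (a := fun k : ℕ => (k : ℝ)) (n := M)
    (fun k _ => hc.intervalIntegrable _ _)
  calc ∑ j : Fin M, (1 + (y - j) ^ 2)⁻¹ = ∑ j ∈ Finset.range M, (1 + (y - j) ^ 2)⁻¹ :=
        Fin.sum_univ_eq_sum_range (fun j : ℕ => (1 + (y - j) ^ 2)⁻¹) M
    _ ≤ ∑ j ∈ Finset.range M, 3 * ∫ t in (j : ℝ)..((j + 1 : ℕ) : ℝ), (1 + (t - y) ^ 2)⁻¹ :=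
        Finset.sum_le_sum fun j _ => h1 j
    _ = 3 * ∫ t in (0 : ℝ)..M, (1 + (t - y) ^ 2)⁻¹ := by
        rw [← Finset.mul_sum, h2]; simp
    _ ≤ 3 * Real.pi := by
        refine mul_le_mul_of_nonneg_left ?_ (by norm_num)
        rw [intervalIntegral.integral_of_le (Nat.cast_nonneg M), ← integral_univ_inv_one_add_sq,
          ← integral_sub_right_eq_self (fun t : ℝ => (1 + t ^ 2)⁻¹) y]
        exact setIntegral_le_integral hint (ae_of_all _ fun t => by positivity)

end LatticeSum

/-! ### The perturbations of the null density and their Fourier transforms. -/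

section Perturbation

variable {M : ℕ}

/-- The perturbation `x ↦ ∑ j < M, θ_j G(x/h - j)` of the null density. -/
noncomputable def pert (h : ℝ) (θ : Fin M → ℝ) (x : ℝ) : ℝ := ∑ j, θ j * wavelet (x / h - j)

/-- The Fourier transform of `pert`. -/
noncomputable def pertF (h : ℝ) (θ : Fin M → ℝ) (v : ℝ) : ℂ :=
  h * window (h * v) * trigPoly (fun j => (θ j : ℂ)) (h * v)

lemma contDiff_pert (h : ℝ) (θ : Fin M → ℝ) : ContDiff ℝ (⊤ : ℕ∞) (pert h θ) := by
  unfold pert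
  refine ContDiff.sum fun j _ => contDiff_const.mul (contDiff_wavelet.comp ?_)
  exact (contDiff_id.div_const h).sub contDiff_const

lemma continuous_pert (h : ℝ) (θ : Fin M → ℝ) : Continuous (pert h θ) :=
  (contDiff_pert h θ).continuous

lemma integrable_pert {h : ℝ} (hh : 0 < h) (θ : Fin M → ℝ) : Integrable (pert h θ) := by
  unfold pert
  refine integrable_finsetSum _ fun j _ => Integrable.const_mul ?_ _
  exact (integrable_wavelet.comp_sub_right (j : ℝ)).comp_div hh.ne'

/-- Since Mh ≤ 1 all translates are centred in [0, 1], so 1 + x² is at most 3 times the same weight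
in the local variable x/h - j. Against the tail condition this keeps f₀ plus a small perturbation
nonnegative, whatever M is. -/
lemma exists_abs_pert_le : ∃ K : ℝ, 0 < K ∧ ∀ {M : ℕ} {h a : ℝ} (θ : Fin M → ℝ), 0 < h → h ≤ 1 →
    M * h ≤ 1 → 0 ≤ a → (∀ j, |θ j| ≤ a) → ∀ x, (1 + x ^ 2) * |pert h θ x| ≤ K * a := by
  obtain ⟨K, hK, hw⟩ := exists_abs_wavelet_le
  refine ⟨9 * K * Real.pi, by have := Real.pi_pos; positivity, fun {M h a} θ hh h1 hM ha hθ x => ?_⟩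
  have hterm : ∀ j : Fin M, (1 + x ^ 2) * |θ j * wavelet (x / h - j)| ≤
      3 * K * a * (1 + (x / h - j) ^ 2)⁻¹ := by
    intro j
    set y := x / h - j with hy
    have hj : h * j ≤ 1 := by
      have : (j : ℝ) ≤ M := by exact_mod_cast j.2.le
      nlinarith
    have hj0 : 0 ≤ h * j := by positivity
    have hx : x = h * y + h * j := by rw [hy]; field_simp; ring
    have hx2 : 1 + x ^ 2 ≤ 3 * (1 + y ^ 2) := by
      have h2 : x ^ 2 ≤ 2 * (h * y) ^ 2 + 2 * (h * j) ^ 2 := by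
        rw [hx]; nlinarith [sq_nonneg (h * y - h * j)]
      have h3 : (h * y) ^ 2 ≤ y ^ 2 := by
        rw [mul_pow]; exact mul_le_of_le_one_left (sq_nonneg y) (by nlinarith)
      nlinarith
    have hy1 : 0 < 1 + y ^ 2 := by positivity
    rw [← div_eq_mul_inv, le_div_iff₀ hy1, abs_mul]
    calc (1 + x ^ 2) * (|θ j| * |wavelet y|) * (1 + y ^ 2)
        ≤ 3 * (1 + y ^ 2) * (a * |wavelet y|) * (1 + y ^ 2) := by
          gcongr
          exact hθ j
      _ = 3 * a * ((1 + y ^ 2) ^ 2 * |wavelet y|) := by ring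
      _ ≤ 3 * a * K := by gcongr; exact hw y
      _ = 3 * K * a := by ring
  calc (1 + x ^ 2) * |pert h θ x| ≤ (1 + x ^ 2) * ∑ j, |θ j * wavelet (x / h - j)| := by
        gcongr
        exact Finset.abs_sum_le_sum_abs _ _
    _ ≤ ∑ j : Fin M, 3 * K * a * (1 + (x / h - j) ^ 2)⁻¹ := by
        rw [Finset.mul_sum]
        exact Finset.sum_le_sum fun j _ => hterm j
    _ ≤ 3 * K * a * (3 * Real.pi) := by
        rw [← Finset.mul_sum]
        exact mul_le_mul_of_nonneg_left (sum_inv_one_add_sq_le M _) (by positivity)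
    _ = 9 * K * Real.pi * a := by ring

/-- Translates become phases, so all terms share one window and the coefficients form a
trigonometric polynomial. -/
lemma fourier_pert {h : ℝ} (hh : 0 < h) (θ : Fin M → ℝ) (v : ℝ) :
    𝓕 (fun x => (pert h θ x : ℂ)) v = pertF h θ v := by
  have hterm : ∀ j : Fin M, ∫ x : ℝ, expi (-(x * v)) * (wavelet (x / h - j) : ℂ) =
      h * (expi (-(j * (h * v))) * window (h * v)) := by
    intro j
    have h1 := integral_sub_right_eq_self (μ := volume)
      (fun y : ℝ => expi (-((y + j) * (h * v))) * (wavelet y : ℂ)) (j : ℝ)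
    have h2 := Measure.integral_comp_div
      (fun y : ℝ => expi (-((y - j + j) * (h * v))) * (wavelet (y - j) : ℂ)) h
    rw [h1, abs_of_pos hh] at h2
    have h3 : ∀ x : ℝ, expi (-((x / h - j + j) * (h * v))) * (wavelet (x / h - j) : ℂ) =
        expi (-(x * v)) * (wavelet (x / h - j) : ℂ) := fun x => by
      rw [sub_add_cancel]
      congr 3
      field_simp
    simp only [h3] at h2
    rw [h2, Complex.real_smul]
    congr 1
    rw [← fourier_wavelet, Real.fourier_real_eq, ← integral_const_mul]
    refine integral_congr_ae (ae_of_all _ fun y => ?_)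
    dsimp only
    rw [fourierChar_smul, ← mul_assoc (expi _) (expi _), ← expi_add]
    congr 2
    ring
  rw [Real.fourier_real_eq]
  simp only [fourierChar_smul, pert, Complex.ofReal_sum, Complex.ofReal_mul, Finset.mul_sum]
  rw [integral_finsetSum]
  · simp only [mul_left_comm _ (Complex.ofReal (θ _)), integral_const_mul, hterm]
    rw [pertF, trigPoly, Finset.mul_sum]
    exact Finset.sum_congr rfl fun j _ => by ring
  · intro j _
    refine Integrable.bdd_mul (c := 1) ?_ (Continuous.aestronglyMeasurable (by fun_prop))
      (ae_of_all _ fun x => by simp)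
    exact (((integrable_wavelet.comp_sub_right (j : ℝ)).comp_div hh.ne').ofReal).const_mul _

/-- The absence of low frequencies makes the perturbation integrate to zero and exposes all of it to
the damping h^σ of the noise. -/
lemma pertF_eq_zero_of_lt {h : ℝ} (hh : 0 < h) (θ : Fin M → ℝ) {v : ℝ} (hv : |v| < 1 / h) :
    pertF h θ v = 0 := by
  rw [pertF, window_eq_zero_of_lt]
  · simp
  · rw [abs_mul, abs_of_pos hh]
    rwa [lt_div_iff₀' hh] at hv

lemma pertF_eq_zero_of_gt {h : ℝ} (hh : 0 < h) (θ : Fin M → ℝ) {v : ℝ} (hv : 4 / h < |v|) :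
    pertF h θ v = 0 := by
  rw [pertF, window_eq_zero_of_gt]
  · simp
  · rw [abs_mul, abs_of_pos hh]
    rwa [div_lt_iff₀' hh] at hv

lemma continuous_pertF (h : ℝ) (θ : Fin M → ℝ) : Continuous (pertF h θ) := by
  unfold pertF
  have := continuous_window
  fun_prop

lemma integral_comp_scale {h : ℝ} (hh : 0 < h) (F : ℝ → ℝ) :
    ∫ v, F (h * v) = h⁻¹ * ∫ s, F s := by
  rw [Measure.integral_comp_mul_left, smul_eq_mul, abs_of_pos (by positivity)]

lemma norm_sq_pertF {h : ℝ} (θ : Fin M → ℝ) (v : ℝ) : ‖pertF h θ v‖ ^ 2 =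
    h ^ 2 * (window (h * v) ^ 2 * ‖trigPoly (fun j => (θ j : ℂ)) (h * v)‖ ^ 2) := by
  rw [pertF, norm_mul, norm_mul, Complex.norm_real, Complex.norm_real, mul_pow, mul_pow,
    Real.norm_eq_abs, Real.norm_eq_abs, sq_abs, sq_abs]
  ring

lemma integral_norm_sq_pertF_le {h : ℝ} (hh : 0 < h) (θ : Fin M → ℝ) :
    ∫ v, ‖pertF h θ v‖ ^ 2 ≤ 8 * h * ∑ j, θ j ^ 2 := by
  simp only [norm_sq_pertF]
  rw [integral_const_mul, integral_comp_scale hh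
    (fun s => window s ^ 2 * ‖trigPoly (fun j => (θ j : ℂ)) s‖ ^ 2)]
  have h1 := (integral_sq_mul_trigPoly_le continuous_window abs_window_le_one
    (fun v => window_eq_zero_of_gt) (fun j => (θ j : ℂ))).2
  simp only [Complex.norm_real, Real.norm_eq_abs, sq_abs] at h1
  calc h ^ 2 * (h⁻¹ * ∫ s, window s ^ 2 * ‖trigPoly (fun j => (θ j : ℂ)) s‖ ^ 2)
      ≤ h ^ 2 * (h⁻¹ * (8 * 1 ^ 2 * ∑ j, θ j ^ 2)) := by gcongr
    _ = _ := by field_simp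

lemma le_integral_norm_sq_pertF {h : ℝ} (hh : 0 < h) (θ : Fin M → ℝ) :
    h * ∑ j, θ j ^ 2 ≤ ∫ v, ‖pertF h θ v‖ ^ 2 := by
  simp only [norm_sq_pertF]
  rw [integral_const_mul, integral_comp_scale hh
    (fun s => window s ^ 2 * ‖trigPoly (fun j => (θ j : ℂ)) s‖ ^ 2)]
  have h1 := le_integral_sq_mul_trigPoly continuous_window
    (fun v => window_eq_zero_of_gt) (fun v => window_eq_one) (fun j => (θ j : ℂ))
  simp only [Complex.norm_real, Real.norm_eq_abs, sq_abs] at h1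
  calc h * ∑ j, θ j ^ 2 = h ^ 2 * (h⁻¹ * ∑ j, θ j ^ 2) := by field_simp
    _ ≤ _ := by gcongr

lemma integrable_of_continuous_of_support {w : ℝ → ℂ} (hw : Continuous w) {a : ℝ}
    (hs : ∀ v, a < |v| → w v = 0) : Integrable w ∧ MemLp w 2 := by
  have hc : HasCompactSupport w := HasCompactSupport.intro
    (isCompact_Icc (a := -a) (b := a)) fun v hv => hs v (by
      by_contra h
      exact hv (abs_le.1 (not_lt.1 h)))
  exact ⟨hw.integrable_of_hasCompactSupport hc, hw.memLp_of_hasCompactSupport hc⟩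

lemma integrable_pertF {h : ℝ} (hh : 0 < h) (θ : Fin M → ℝ) :
    Integrable (pertF h θ) ∧ MemLp (pertF h θ) 2 :=
  integrable_of_continuous_of_support (continuous_pertF h θ)
    (fun _ hv => pertF_eq_zero_of_gt hh θ hv)

lemma fourierInv_pertF {h : ℝ} (hh : 0 < h) (θ : Fin M → ℝ) :
    𝓕⁻ (pertF h θ) = fun x => (pert h θ x : ℂ) := by
  have e : 𝓕 (fun x => (pert h θ x : ℂ)) = pertF h θ := funext (fourier_pert hh θ)
  rw [← e]
  refine Continuous.fourierInv_fourier_eq ?_ (integrable_pert hh θ).ofReal ?_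
  · exact Complex.continuous_ofReal.comp (continuous_pert h θ)
  · rw [e]; exact (integrable_pertF hh θ).1

lemma memLp_ofReal_pert {h : ℝ} (hh : 0 < h) (θ : Fin M → ℝ) :
    MemLp (fun x => (pert h θ x : ℂ)) 2 := by
  rw [← fourierInv_pertF hh θ]
  exact memLp_fourierInv (integrable_pertF hh θ).1 (integrable_pertF hh θ).2

lemma memLp_pert {h : ℝ} (hh : 0 < h) (θ : Fin M → ℝ) : MemLp (pert h θ) 2 := by
  have := (memLp_ofReal_pert hh θ).re
  simpa using this

lemma integral_sq_pert {h : ℝ} (hh : 0 < h) (θ : Fin M → ℝ) :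
    ∫ x, pert h θ x ^ 2 = ∫ v, ‖pertF h θ v‖ ^ 2 := by
  rw [← integral_norm_sq_fourierInv (integrable_pertF hh θ).1 (integrable_pertF hh θ).2,
    fourierInv_pertF hh θ]
  simp only [Complex.norm_real, Real.norm_eq_abs, sq_abs]

lemma integral_pert {h : ℝ} (hh : 0 < h) (θ : Fin M → ℝ) : ∫ x, pert h θ x = 0 := by
  have h1 := fourier_pert hh θ 0
  rw [pertF_eq_zero_of_lt hh θ (by rw [abs_zero]; positivity), Real.fourier_real_eq] at h1
  simp only [mul_zero, neg_zero, fourierChar_smul, expi_zero, one_mul] at h1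
  rw [integral_complex_ofReal] at h1
  exact_mod_cast h1

lemma cf_pert {h : ℝ} (hh : 0 < h) (θ : Fin M → ℝ) (u : ℝ) :
    cf (pert h θ) u = pertF h θ (-(2 * Real.pi)⁻¹ * u) := by
  rw [← fourier_pert hh θ, fourier_ofReal_eq_cf]
  congr 1
  have := Real.pi_ne_zero
  field_simp

/-- The transform lives on |u| ≤ 8π/h, where the Sobolev weight is at most (8π/h)^{2β}; the rest is
the L² bound. -/
lemma integral_sobolev_pert_le {β h : ℝ} (hβ : 0 < β) (hh : 0 < h) (θ : Fin M → ℝ) :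
    Integrable (fun u => ‖cf (pert h θ) u‖ ^ 2 * |u| ^ (2 * β)) ∧
    ∫ u, ‖cf (pert h θ) u‖ ^ 2 * |u| ^ (2 * β) ≤
      2 * Real.pi * ((8 * Real.pi / h) ^ (2 * β) * (8 * h * ∑ j, θ j ^ 2)) := by
  have hπ := Real.pi_pos
  have hle : ∀ u, ‖cf (pert h θ) u‖ ^ 2 * |u| ^ (2 * β) ≤
      (8 * Real.pi / h) ^ (2 * β) * ‖pertF h θ (-(2 * Real.pi)⁻¹ * u)‖ ^ 2 := fun u => by
    rw [cf_pert hh, mul_comm]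
    by_cases hu : |u| ≤ 8 * Real.pi / h
    · gcongr
    · rw [pertF_eq_zero_of_gt hh]
      · simp
      · push Not at hu
        rw [abs_mul, abs_neg, abs_of_pos (by positivity), ← div_eq_inv_mul, lt_div_iff₀ (by positivity)]
        calc 4 / h * (2 * Real.pi) = 8 * Real.pi / h := by ring
          _ < |u| := hu
  have hi : Integrable fun u => (8 * Real.pi / h) ^ (2 * β) *
      ‖pertF h θ (-(2 * Real.pi)⁻¹ * u)‖ ^ 2 :=
    ((integrable_norm_sq (integrable_pertF hh θ).2).comp_mul_left'
      (R := -(2 * Real.pi)⁻¹) (by rw [neg_ne_zero]; positivity)).const_mul _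
  have hm : AEStronglyMeasurable (fun u => ‖cf (pert h θ) u‖ ^ 2 * |u| ^ (2 * β)) volume := by
    simp only [cf_pert hh]
    exact (((continuous_pertF h θ).measurable.comp (by fun_prop)).norm.pow_const 2
      |>.mul (measurable_id.abs.pow_const _)).aestronglyMeasurable
  have hi' := hi.mono' hm (ae_of_all _ fun u => by
    rw [Real.norm_of_nonneg (by positivity)]; exact hle u)
  refine ⟨hi', (integral_mono hi' hi hle).trans ?_⟩
  rw [integral_const_mul, Measure.integral_comp_mul_left (fun u => ‖pertF h θ u‖ ^ 2), smul_eq_mul,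
    abs_inv, abs_neg, abs_inv, inv_inv, abs_of_pos (by positivity)]
  have := integral_norm_sq_pertF_le hh θ
  calc (8 * Real.pi / h) ^ (2 * β) * (2 * Real.pi * ∫ u, ‖pertF h θ u‖ ^ 2)
      ≤ (8 * Real.pi / h) ^ (2 * β) * (2 * Real.pi * (8 * h * ∑ j, θ j ^ 2)) := by gcongr
    _ = _ := by ring

end Perturbation

end NoisyTesting

namespace NoisyTesting

open FourierTransform SchwartzMap

/-! ### Convolution of the perturbations with the noise. -/

section Smearing

/-- The convolution `q ∗ g`. -/
noncomputable def smear (g q : ℝ → ℝ) (x : ℝ) : ℝ := ∫ y, g y * q (x - y)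

lemma ofReal_smear_pert {M : ℕ} {g : ℝ → ℝ} (hg : IsDensity g) {h : ℝ} (hh : 0 < h)
    (θ : Fin M → ℝ) (x : ℝ) : (smear g (pert h θ) x : ℂ) =
      𝓕⁻ (fun v => cf g (-(2 * Real.pi * v)) * pertF h θ v) x := by
  have := hg.isProbabilityMeasure
  have h1 := integral_fourierInv_sub (μ := densityLaw g) (integrable_pertF hh θ).1 x
  rw [integral_densityLaw hg, fourierInv_pertF hh θ] at h1
  have e : (fun v => (starRingEnd ℂ) (chf (densityLaw g) v) * pertF h θ v) =
      fun v => cf g (-(2 * Real.pi * v)) * pertF h θ v := funext fun v => by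
    rw [chf, charFun_densityLaw hg, conj_cf]
  rw [e] at h1
  rw [← h1, smear, ← integral_complex_ofReal]
  simp only [Complex.ofReal_mul]

/-- A weighted Plancherel bound. -/
lemma integral_one_add_sq_mul_norm_sq_fourierInv_le {w w' : ℝ → ℂ}
    (hd : ∀ v, HasDerivAt w (w' v) v) (hw : Integrable w) (hw2 : MemLp w 2)
    (hw' : Integrable w') (hw'2 : MemLp w' 2) :
    Integrable (fun x => (1 + x ^ 2) * ‖𝓕⁻ w x‖ ^ 2) ∧
    ∫ x, (1 + x ^ 2) * ‖𝓕⁻ w x‖ ^ 2 ≤ (∫ v, ‖w v‖ ^ 2) + ∫ v, ‖w' v‖ ^ 2 := by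
  have hderiv : deriv w = w' := funext fun v => (hd v).deriv
  -- The weight x² is paid for by one derivative on the Fourier side; the factor (2π)² ≥ 1 is
  -- discarded.
  have hF : ∀ x, 𝓕⁻ w' x = (2 * Real.pi * Complex.I * ((-x : ℝ) : ℂ)) • 𝓕⁻ w x := fun x => by
    have h1 := Real.fourier_deriv hw (fun v => (hd v).differentiableAt) (by rwa [hderiv])
    rw [hderiv] at h1
    rw [Real.fourierInv_eq_fourier_neg, Real.fourierInv_eq_fourier_neg, h1]
  have i1 := integrable_norm_sq (memLp_fourierInv hw hw2)
  have i2 := integrable_norm_sq (memLp_fourierInv hw' hw'2)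
  have hle : ∀ x, (1 + x ^ 2) * ‖𝓕⁻ w x‖ ^ 2 ≤ ‖𝓕⁻ w x‖ ^ 2 + ‖𝓕⁻ w' x‖ ^ 2 := fun x => by
    rw [hF, norm_smul, mul_pow]
    have e : ‖(2 * Real.pi * Complex.I * ((-x : ℝ) : ℂ))‖ ^ 2 = (2 * Real.pi) ^ 2 * x ^ 2 := by
      rw [norm_mul, norm_mul, norm_mul, Complex.norm_I, Complex.norm_real, Complex.norm_real,
        Real.norm_eq_abs, Real.norm_eq_abs, abs_of_pos Real.pi_pos, abs_neg, Complex.norm_ofNat,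
        mul_one, mul_pow, sq_abs]
    rw [e, add_mul, one_mul]
    have h2 : 1 ≤ (2 * Real.pi) ^ 2 := one_le_pow₀ (by linarith [Real.pi_gt_three])
    have h3 : x ^ 2 ≤ (2 * Real.pi) ^ 2 * x ^ 2 := le_mul_of_one_le_left (sq_nonneg x) h2
    gcongr
  have hi : Integrable (fun x => (1 + x ^ 2) * ‖𝓕⁻ w x‖ ^ 2) :=
    (i1.add i2).mono' (by
      have := continuous_fourierInv hw
      exact Continuous.aestronglyMeasurable (by fun_prop)) (ae_of_all _ fun x => by
      rw [Real.norm_of_nonneg (by positivity)]; exact hle x)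
  refine ⟨hi, (integral_mono hi (i1.add i2) hle).trans ?_⟩
  simp only [Pi.add_apply]
  rw [integral_add i1 i2, integral_norm_sq_fourierInv hw hw2, integral_norm_sq_fourierInv hw' hw'2]

/-- The derivative of `pertF`. -/
noncomputable def pertF' {M : ℕ} (h : ℝ) (θ : Fin M → ℝ) (v : ℝ) : ℂ :=
  h ^ 2 * (deriv window (h * v) * trigPoly (fun j => (θ j : ℂ)) (h * v) +
    window (h * v) *
      trigPoly (fun j => -(2 * Real.pi * j * Complex.I) * (θ j : ℂ)) (h * v))

variable {M : ℕ}

lemma hasDerivAt_pertF (h : ℝ) (θ : Fin M → ℝ) (v : ℝ) :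
    HasDerivAt (pertF h θ) (pertF' h θ v) v := by
  have hlin : HasDerivAt (fun v : ℝ => h * v) h v := by
    simpa using (hasDerivAt_id v).const_mul h
  have h1 : HasDerivAt (fun v : ℝ => (window (h * v) : ℂ)) ((deriv window (h * v) * h : ℝ) : ℂ) v :=
    ((hasDerivAt_window (h * v)).comp v hlin).ofReal_comp
  have h2 := (hasDerivAt_trigPoly (fun j => (θ j : ℂ)) (h * v)).scomp v hlin
  have h3 := (h1.const_mul (h : ℂ)).mul h2
  refine (h3.congr_deriv ?_)
  rw [pertF', Complex.real_smul]
  push_cast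
  simp only [Function.comp]
  ring

lemma continuous_pertF' (h : ℝ) (θ : Fin M → ℝ) : Continuous (pertF' h θ) := by
  have := continuous_window
  have := continuous_deriv_window
  unfold pertF'
  fun_prop

lemma pertF'_eq_zero_of_lt {h : ℝ} (hh : 0 < h) (θ : Fin M → ℝ) {v : ℝ} (hv : |v| < 1 / h) :
    pertF' h θ v = 0 := by
  have : |h * v| < 1 := by
    rw [abs_mul, abs_of_pos hh]
    rwa [lt_div_iff₀' hh] at hv
  rw [pertF', window_eq_zero_of_lt this, deriv_window_eq_zero_of_lt this]
  simp

lemma pertF'_eq_zero_of_gt {h : ℝ} (hh : 0 < h) (θ : Fin M → ℝ) {v : ℝ} (hv : 4 / h < |v|) :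
    pertF' h θ v = 0 := by
  have : 4 < |h * v| := by
    rw [abs_mul, abs_of_pos hh]
    rwa [div_lt_iff₀' hh] at hv
  rw [pertF', window_eq_zero_of_gt this, deriv_window_eq_zero_of_gt this]
  simp

/-- Differentiation brings a factor h from the chain rule and at most 2πM from the phases. As Mh ≤
1, the derivative obeys a bound of the same order as the function. -/
lemma exists_integral_norm_sq_pertF'_le : ∃ K : ℝ, 0 < K ∧ ∀ {M : ℕ} {h : ℝ} (θ : Fin M → ℝ),
    0 < h → h ≤ 1 → M * h ≤ 1 → ∫ v, ‖pertF' h θ v‖ ^ 2 ≤ K * h * ∑ j, θ j ^ 2 := by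
  obtain ⟨B, hB, hBw⟩ := exists_abs_deriv_window_le
  have hπ := Real.pi_pos
  refine ⟨16 * B ^ 2 + 16 * (2 * Real.pi) ^ 2, by positivity, fun {M h} θ hh h1 hM => ?_⟩
  set c : Fin M → ℂ := fun j => (θ j : ℂ) with hc
  set c' : Fin M → ℂ := fun j => -(2 * Real.pi * j * Complex.I) * (θ j : ℂ) with hc'
  obtain ⟨i1, b1⟩ := integral_sq_mul_trigPoly_le continuous_deriv_window hBw
    (fun v => deriv_window_eq_zero_of_gt) c
  obtain ⟨i2, b2⟩ := integral_sq_mul_trigPoly_le continuous_window abs_window_le_one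
    (fun v => window_eq_zero_of_gt) c'
  set S := ∑ j, θ j ^ 2 with hS
  have hS0 : 0 ≤ S := Finset.sum_nonneg fun j _ => sq_nonneg _
  have s1 : ∑ j, ‖c j‖ ^ 2 = S := by
    simp only [hc, Complex.norm_real, Real.norm_eq_abs, sq_abs, hS]
  have s2 : ∑ j, ‖c' j‖ ^ 2 ≤ (2 * Real.pi) ^ 2 * (M : ℝ) ^ 2 * S := by
    rw [hS, Finset.mul_sum]
    refine Finset.sum_le_sum fun j _ => ?_
    have e : ‖c' j‖ ^ 2 = (2 * Real.pi) ^ 2 * (j : ℝ) ^ 2 * θ j ^ 2 := by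
      simp only [hc', norm_mul, norm_neg, Complex.norm_I, Complex.norm_real, Real.norm_eq_abs,
        Complex.norm_ofNat, Complex.norm_natCast, abs_of_pos Real.pi_pos, mul_one, mul_pow, sq_abs]
    rw [e]
    have : (j : ℝ) ≤ M := by exact_mod_cast j.2.le
    gcongr
  rw [s1] at b1
  have hle : ∀ v, ‖pertF' h θ v‖ ^ 2 ≤
      2 * h ^ 4 * ((deriv window (h * v)) ^ 2 * ‖trigPoly c (h * v)‖ ^ 2) +
      2 * h ^ 4 * (window (h * v) ^ 2 * ‖trigPoly c' (h * v)‖ ^ 2) := fun v => by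
    rw [pertF', norm_mul, mul_pow, norm_pow, Complex.norm_real, Real.norm_of_nonneg hh.le]
    have n1 : ‖((deriv window (h * v) : ℝ) : ℂ) * trigPoly c (h * v) +
        window (h * v) * trigPoly c' (h * v)‖ ^ 2 ≤
        2 * ((deriv window (h * v)) ^ 2 * ‖trigPoly c (h * v)‖ ^ 2) +
        2 * (window (h * v) ^ 2 * ‖trigPoly c' (h * v)‖ ^ 2) := by
      have t1 := norm_add_le (((deriv window (h * v) : ℝ) : ℂ) * trigPoly c (h * v))
        (window (h * v) * trigPoly c' (h * v))
      rw [norm_mul, norm_mul, Complex.norm_real, Complex.norm_real, Real.norm_eq_abs,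
        Real.norm_eq_abs] at t1
      rw [← sq_abs (deriv window (h * v)), ← sq_abs (window (h * v)), ← mul_pow, ← mul_pow]
      set X := |deriv window (h * v)| * ‖trigPoly c (h * v)‖
      set Y := |window (h * v)| * ‖trigPoly c' (h * v)‖
      calc _ ≤ (X + Y) ^ 2 := pow_le_pow_left₀ (norm_nonneg _) t1 2
        _ ≤ _ := by nlinarith [sq_nonneg (X - Y)]
    calc _ ≤ (h ^ 2) ^ 2 * _ := mul_le_mul_of_nonneg_left n1 (by positivity)
      _ = _ := by ring
  have j1 := (i1.comp_mul_left' hh.ne').const_mul (2 * h ^ 4)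
  have j2 := (i2.comp_mul_left' hh.ne').const_mul (2 * h ^ 4)
  have hi : Integrable fun v => ‖pertF' h θ v‖ ^ 2 := integrable_norm_sq
    (integrable_of_continuous_of_support (continuous_pertF' h θ)
      (fun _ hv => pertF'_eq_zero_of_gt hh θ hv)).2
  refine (integral_mono hi (j1.add j2) hle).trans ?_
  simp only [Pi.add_apply]
  rw [integral_add j1 j2, integral_const_mul, integral_const_mul,
    integral_comp_scale hh (fun s => (deriv window s) ^ 2 * ‖trigPoly c s‖ ^ 2),
    integral_comp_scale hh (fun s => window s ^ 2 * ‖trigPoly c' s‖ ^ 2)]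
  have b2' := b2.trans (mul_le_mul_of_nonneg_left s2 (by norm_num))
  have hMh : ((M : ℝ) * h) ^ 2 ≤ 1 := pow_le_one₀ (by positivity) hM
  have hh2 : h ^ 2 ≤ 1 := pow_le_one₀ hh.le h1
  calc 2 * h ^ 4 * (h⁻¹ * ∫ s, (deriv window s) ^ 2 * ‖trigPoly c s‖ ^ 2) +
        2 * h ^ 4 * (h⁻¹ * ∫ s, window s ^ 2 * ‖trigPoly c' s‖ ^ 2)
      ≤ 2 * h ^ 4 * (h⁻¹ * (8 * B ^ 2 * S)) +
        2 * h ^ 4 * (h⁻¹ * (8 * 1 ^ 2 * ((2 * Real.pi) ^ 2 * (M : ℝ) ^ 2 * S))) := by gcongr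
    _ = 16 * B ^ 2 * S * h * h ^ 2 + 16 * (2 * Real.pi) ^ 2 * S * h * ((M : ℝ) * h) ^ 2 := by
        field_simp
        ring
    _ ≤ 16 * B ^ 2 * S * h * 1 + 16 * (2 * Real.pi) ^ 2 * S * h * 1 := by gcongr
    _ = _ := by ring

/-- The noise damps the perturbation: weighted `L²` bound for `pert ∗ g`. -/
lemma exists_integral_smear_pert_le {σ : ℝ} {g : ℝ → ℝ} (hg : IsPolynomialNoise σ g)
    (hP : AssumptionP σ g) : ∃ K h₀ : ℝ, 0 < K ∧ 0 < h₀ ∧ h₀ ≤ 1 ∧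
    ∀ {M : ℕ} {h : ℝ} (θ : Fin M → ℝ), 0 < h → h ≤ h₀ → M * h ≤ 1 →
      Integrable (fun x => (1 + x ^ 2) * smear g (pert h θ) x ^ 2) ∧
      ∫ x, (1 + x ^ 2) * smear g (pert h θ) x ^ 2 ≤
        K * h ^ (2 * σ + 1) * ∑ j, θ j ^ 2 := by
  obtain ⟨c, C, -, hC, hb⟩ := hg.exists_bounds
  obtain ⟨hsm, A₁, A₂, u₀, u₁, u₂, -, hA₂, -, hu₁, -, -, hd1, -⟩ := hP
  obtain ⟨K, hK, hKb⟩ := exists_integral_norm_sq_pertF'_le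
  have hπ := Real.pi_pos
  have hσ : 0 < σ := lt_trans one_pos hg.one_lt
  -- For h ≤ 1/A₂ every frequency of the perturbation lies beyond A₂, where the derivative bound on
  -- Φ_g is available.
  refine ⟨8 * C ^ 2 + 2 * C ^ 2 * K + 16 * (2 * Real.pi * u₁) ^ 2, 1 / A₂, by positivity,
    by positivity, by rw [div_le_one (by linarith)]; exact hA₂.le, fun {M h} θ hh hh0 hM => ?_⟩
  have h1 : h ≤ 1 := hh0.trans (by rw [div_le_one (by linarith)]; exact hA₂.le)
  have hA : A₂ ≤ 1 / h := by
    rw [le_div_iff₀ (by linarith)] at hh0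
    rw [le_div_iff₀ hh]; linarith
  set γ : ℝ → ℂ := fun v => cf g (-(2 * Real.pi * v)) with hγ
  set γ' : ℝ → ℂ := fun v => -(2 * Real.pi) * deriv (cf g) (-(2 * Real.pi * v)) with hγ'
  have hγd : ∀ v, HasDerivAt γ (γ' v) v := fun v => by
    have e1 : HasDerivAt (fun v : ℝ => -(2 * Real.pi * v)) (-(2 * Real.pi)) v := by
      have := (hasDerivAt_id v).const_mul (-(2 * Real.pi))
      simpa using this
    have e2 : HasDerivAt (cf g) (deriv (cf g) (-(2 * Real.pi * v))) (-(2 * Real.pi * v)) :=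
      (hsm.differentiable (by norm_num) _).hasDerivAt
    refine (e2.scomp v e1).congr_deriv ?_
    rw [hγ', Complex.real_smul]
    push_cast
    ring
  have hγc : Continuous γ := (continuous_cf hg.density).comp (by fun_prop)
  have hγ'c : Continuous γ' := by
    have : Continuous (deriv (cf g)) := hsm.continuous_deriv (by norm_num)
    exact continuous_const.mul (this.comp (by fun_prop))
  have habs : ∀ {v : ℝ}, 1 / h ≤ |v| → 1 / h ≤ |-(2 * Real.pi * v)| := fun {v} hv => by
    rw [abs_neg, abs_mul, abs_of_pos (by positivity : 0 < 2 * Real.pi)]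
    have : |v| ≤ 2 * Real.pi * |v| :=
      le_mul_of_one_le_left (abs_nonneg v) (by linarith [Real.pi_gt_three])
    linarith
  have hinv : ∀ a : ℝ, (1 / h) ^ (-a) = h ^ a := fun a => by
    rw [one_div, Real.inv_rpow hh.le, Real.rpow_neg hh.le, inv_inv]
  have b0 : ∀ {v : ℝ}, 1 / h ≤ |v| → ‖γ v‖ ≤ C * h ^ σ := fun {v} hv => by
    refine (hb _).2.trans (mul_le_mul_of_nonneg_left ?_ hC.le)
    rw [← hinv]
    exact Real.rpow_le_rpow_of_nonpos (by positivity) ((habs hv).trans (by linarith)) (by linarith)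
  have b1 : ∀ {v : ℝ}, 1 / h ≤ |v| → ‖γ' v‖ ≤ 2 * Real.pi * u₁ * h ^ σ := fun {v} hv => by
    have e1 := hd1 (-(2 * Real.pi * v)) (hA.trans (habs hv))
    rw [iteratedDeriv_one] at e1
    have e2 : u₁ / |-(2 * Real.pi * v)| ^ (σ + 1) ≤ u₁ * h ^ σ := by
      rw [div_eq_mul_inv, ← Real.rpow_neg (abs_nonneg _)]
      refine mul_le_mul_of_nonneg_left ?_ hu₁.le
      calc |-(2 * Real.pi * v)| ^ (-(σ + 1)) ≤ (1 / h) ^ (-(σ + 1)) :=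
            Real.rpow_le_rpow_of_nonpos (by positivity) (habs hv) (by linarith)
        _ = h ^ (σ + 1) := hinv _
        -- One power of h is given away: h^σ already matches the undifferentiated term.
        _ ≤ h ^ σ := Real.rpow_le_rpow_of_exponent_ge hh h1 (by linarith)
    have e3 : ‖(-(2 * Real.pi) : ℂ)‖ = 2 * Real.pi := by
      rw [norm_neg, norm_mul, Complex.norm_real, Complex.norm_ofNat, Real.norm_of_nonneg hπ.le]
    simp only [hγ']
    rw [norm_mul, e3, mul_assoc (2 * Real.pi)]
    exact mul_le_mul_of_nonneg_left (e1.trans e2) (by positivity)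
  set w : ℝ → ℂ := fun v => γ v * pertF h θ v with hw
  set w' : ℝ → ℂ := fun v => γ' v * pertF h θ v + γ v * pertF' h θ v with hw'
  have hwd : ∀ v, HasDerivAt w (w' v) v := fun v => (hγd v).mul (hasDerivAt_pertF h θ v)
  have hwi := integrable_of_continuous_of_support (w := w) (hγc.mul (continuous_pertF h θ))
    (a := 4 / h) fun v hv => by simp [hw, pertF_eq_zero_of_gt hh θ hv]
  have hw'i := integrable_of_continuous_of_support (w := w')
    ((hγ'c.mul (continuous_pertF h θ)).add (hγc.mul (continuous_pertF' h θ)))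
    (a := 4 / h) fun v hv => by
      simp [hw', pertF_eq_zero_of_gt hh θ hv, pertF'_eq_zero_of_gt hh θ hv]
  obtain ⟨k1, k2⟩ := integral_one_add_sq_mul_norm_sq_fourierInv_le hwd hwi.1 hwi.2 hw'i.1 hw'i.2
  have hsme : ∀ x, ‖𝓕⁻ w x‖ ^ 2 = smear g (pert h θ) x ^ 2 := fun x => by
    rw [← ofReal_smear_pert hg.density hh, Complex.norm_real, Real.norm_eq_abs, sq_abs]
  simp only [hsme] at k1 k2
  refine ⟨k1, k2.trans ?_⟩
  set S := ∑ j, θ j ^ 2 with hS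
  have hS0 : 0 ≤ S := Finset.sum_nonneg fun j _ => sq_nonneg _
  have iQ := integrable_norm_sq (integrable_pertF hh θ).2
  have iQ' : Integrable fun v => ‖pertF' h θ v‖ ^ 2 := integrable_norm_sq
    (integrable_of_continuous_of_support (continuous_pertF' h θ)
      (fun _ hv => pertF'_eq_zero_of_gt hh θ hv)).2
  have wle : ∀ v, ‖w v‖ ^ 2 ≤ (C * h ^ σ) ^ 2 * ‖pertF h θ v‖ ^ 2 := fun v => by
    by_cases hv : 1 / h ≤ |v|
    · rw [hw, norm_mul, mul_pow]
      have := b0 hv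
      gcongr
    · simp [hw, pertF_eq_zero_of_lt hh θ (not_le.1 hv)]
  have w'le : ∀ v, ‖w' v‖ ^ 2 ≤ 2 * (2 * Real.pi * u₁ * h ^ σ) ^ 2 * ‖pertF h θ v‖ ^ 2 +
      2 * (C * h ^ σ) ^ 2 * ‖pertF' h θ v‖ ^ 2 := fun v => by
    by_cases hv : 1 / h ≤ |v|
    · have t1 : ‖w' v‖ ≤ 2 * Real.pi * u₁ * h ^ σ * ‖pertF h θ v‖ + C * h ^ σ * ‖pertF' h θ v‖ := by
        refine (norm_add_le _ _).trans (add_le_add ?_ ?_)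
        · rw [norm_mul]
          exact mul_le_mul_of_nonneg_right (b1 hv) (norm_nonneg _)
        · rw [norm_mul]
          exact mul_le_mul_of_nonneg_right (b0 hv) (norm_nonneg _)
      have t2 := pow_le_pow_left₀ (norm_nonneg _) t1 2
      nlinarith [sq_nonneg (2 * Real.pi * u₁ * h ^ σ * ‖pertF h θ v‖ - C * h ^ σ * ‖pertF' h θ v‖)]
    · rw [hw']
      simp only [pertF_eq_zero_of_lt hh θ (not_le.1 hv), pertF'_eq_zero_of_lt hh θ (not_le.1 hv)]
      simp
  have I1 := integral_mono (integrable_norm_sq hwi.2) (iQ.const_mul _) wle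
  have I2 := integral_mono (integrable_norm_sq hw'i.2)
    ((iQ.const_mul _).add (iQ'.const_mul _)) w'le
  simp only [Pi.add_apply] at I2
  rw [integral_const_mul] at I1
  rw [integral_add (iQ.const_mul _) (iQ'.const_mul _), integral_const_mul, integral_const_mul] at I2
  have q1 := integral_norm_sq_pertF_le hh θ
  have q2 := hKb θ hh h1 hM
  have hpow : (h ^ σ) ^ 2 * h = h ^ (2 * σ + 1) := by
    rw [Real.rpow_add hh, Real.rpow_one, mul_comm 2 σ, Real.rpow_mul hh.le]
    norm_num
  calc (∫ v, ‖w v‖ ^ 2) + ∫ v, ‖w' v‖ ^ 2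
      ≤ (C * h ^ σ) ^ 2 * (8 * h * S) + (2 * (2 * Real.pi * u₁ * h ^ σ) ^ 2 * (8 * h * S) +
        2 * (C * h ^ σ) ^ 2 * (K * h * S)) :=
        add_le_add (I1.trans (by gcongr)) (I2.trans (by gcongr))
    _ = (8 * C ^ 2 + 2 * C ^ 2 * K + 16 * (2 * Real.pi * u₁) ^ 2) * ((h ^ σ) ^ 2 * h) * S := by ring
    _ = _ := by rw [hpow]

end Smearing

end NoisyTesting

namespace NoisyTesting

/-! ### Likelihood ratios of noisy observations. -/

section DensityRatio

variable {g f₀ : ℝ → ℝ}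

/-- The density `g ∗ f` of a noisy observation, with values in `[0, ∞]`. -/
noncomputable def noisyDensity (g f : ℝ → ℝ) (x : ℝ) : ℝ≥0∞ :=
  ∫⁻ y, ENNReal.ofReal (g y) * ENNReal.ofReal (f (x - y))

/-- The relative perturbation `(g ∗ q) / (g ∗ f₀)` of the density of a noisy observation. -/
noncomputable def relPert (g f₀ q : ℝ → ℝ) (x : ℝ) : ℝ :=
  smear g q x / (noisyDensity g f₀ x).toReal

lemma measurable_noisyDensity {f : ℝ → ℝ} (hg : Measurable g) (hf : Measurable f) :
    Measurable (noisyDensity g f) := by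
  unfold noisyDensity
  have : Measurable fun p : ℝ × ℝ => ENNReal.ofReal (g p.2) * ENNReal.ofReal (f (p.1 - p.2)) := by
    fun_prop
  exact this.lintegral_prod_right'

lemma noisyLaw_eq_withDensity {f : ℝ → ℝ} (hg : IsDensity g) (hf : IsDensity f) :
    noisyLaw g f = volume.withDensity (noisyDensity g f) := by
  have := hg.isProbabilityMeasure
  have := hf.isProbabilityMeasure
  rw [noisyLaw, Measure.conv_comm, densityLaw, densityLaw, conv_withDensity_eq_lconvolution
    hg.measurable.ennreal_ofReal hf.measurable.ennreal_ofReal]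
  congr 1
  funext x
  simp only [lconvolution_def, noisyDensity, neg_add_eq_sub]

lemma ae_noisyDensity_lt_top {f : ℝ → ℝ} (hg : IsDensity g) (hf : IsDensity f) :
    ∀ᵐ x, noisyDensity g f x < ∞ := by
  have := isProbabilityMeasure_noisyLaw hg hf
  refine ae_lt_top (measurable_noisyDensity hg.measurable hf.measurable) ?_
  have h1 : noisyLaw g f Set.univ = 1 := measure_univ
  rw [noisyLaw_eq_withDensity hg hf, withDensity_apply _ MeasurableSet.univ,
    setLIntegral_univ] at h1
  rw [h1]
  exact ENNReal.one_ne_top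

/-- The heavy tail of `f₀` is inherited by `g ∗ f₀`. -/
lemma TailCondition.exists_le_noisyDensity (hg : IsDensity g) (h : TailCondition f₀) :
    ∃ c : ℝ, 0 < c ∧ ∀ x, ENNReal.ofReal (c / (1 + x ^ 2)) ≤ noisyDensity g f₀ x := by
  obtain ⟨c₀, hc₀, hle⟩ := h
  have := hg.isProbabilityMeasure
  obtain ⟨k, hk⟩ : ∃ k : ℕ, 0 < densityLaw g (Set.Icc (-(k : ℝ)) k) := by
    by_contra! hcon
    have h0 : densityLaw g (⋃ k : ℕ, Set.Icc (-(k : ℝ)) k) = 0 :=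
      measure_iUnion_null fun k => le_antisymm (hcon k) zero_le
    have hU : (⋃ k : ℕ, Set.Icc (-(k : ℝ)) k) = Set.univ := by
      refine Set.eq_univ_of_forall fun x => Set.mem_iUnion.2 ?_
      obtain ⟨k, hk⟩ := exists_nat_ge |x|
      exact ⟨k, abs_le.1 hk⟩
    rw [hU, measure_univ] at h0
    exact one_ne_zero h0
  have hm : 0 < (densityLaw g).real (Set.Icc (-(k : ℝ)) k) :=
    ENNReal.toReal_pos hk.ne' (measure_ne_top _ _)
  set m := (densityLaw g).real (Set.Icc (-(k : ℝ)) k) with hmdef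
  refine ⟨m * (c₀ / (2 * (1 + (k : ℝ) ^ 2))), by positivity, fun x => ?_⟩
  -- For |y| ≤ k, 1 + (x - y)² ≤ 2(1 + k²)(1 + x²), so a bounded piece of the noise keeps the tail
  -- up to a constant.
  have hfle : ∀ y ∈ Set.Icc (-(k : ℝ)) k,
      c₀ / (2 * (1 + (k : ℝ) ^ 2)) / (1 + x ^ 2) ≤ f₀ (x - y) := fun y hy => by
    refine le_trans ?_ (hle (x - y))
    rw [div_div]
    have hy2 : y ^ 2 ≤ (k : ℝ) ^ 2 := sq_le_sq' hy.1 hy.2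
    refine div_le_div_of_nonneg_left hc₀.le (by positivity) ?_
    rw [sq_abs]
    nlinarith [sq_nonneg (x + y), mul_nonneg (sq_nonneg (k : ℝ)) (sq_nonneg x)]
  calc ENNReal.ofReal (m * (c₀ / (2 * (1 + (k : ℝ) ^ 2))) / (1 + x ^ 2))
      = ENNReal.ofReal m * ENNReal.ofReal (c₀ / (2 * (1 + (k : ℝ) ^ 2)) / (1 + x ^ 2)) := by
        rw [← ENNReal.ofReal_mul hm.le, mul_div_assoc]
    _ = (∫⁻ y in Set.Icc (-(k : ℝ)) k, ENNReal.ofReal (g y)) *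
          ENNReal.ofReal (c₀ / (2 * (1 + (k : ℝ) ^ 2)) / (1 + x ^ 2)) := by
        rw [hmdef, measureReal_def, ENNReal.ofReal_toReal (measure_ne_top _ _), densityLaw,
          withDensity_apply _ measurableSet_Icc]
    _ = ∫⁻ y in Set.Icc (-(k : ℝ)) k, ENNReal.ofReal (g y) *
          ENNReal.ofReal (c₀ / (2 * (1 + (k : ℝ) ^ 2)) / (1 + x ^ 2)) :=
        (lintegral_mul_const _ hg.measurable.ennreal_ofReal).symm
    _ ≤ ∫⁻ y in Set.Icc (-(k : ℝ)) k, ENNReal.ofReal (g y) * ENNReal.ofReal (f₀ (x - y)) :=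
        setLIntegral_mono' measurableSet_Icc fun y hy =>
          mul_le_mul_right (ENNReal.ofReal_le_ofReal (hfle y hy)) _
    _ ≤ _ := setLIntegral_le_lintegral _ _

lemma integrable_mul_comp_sub {q : ℝ → ℝ} {K : ℝ} (hg : IsDensity g) (hq : Continuous q)
    (hK : ∀ x, |q x| ≤ K) (x : ℝ) : Integrable fun y => g y * q (x - y) := by
  have := hg.integrable.bdd_mul (f := fun y => q (x - y)) (c := K)
    (by exact Continuous.aestronglyMeasurable (by fun_prop)) (ae_of_all _ fun y => hK (x - y))
  simpa only [mul_comm] using this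

lemma measurable_smear {q : ℝ → ℝ} (hg : Measurable g) (hq : Measurable q) :
    Measurable (smear g q) := by
  have : StronglyMeasurable fun p : ℝ × ℝ => g p.2 * q (p.1 - p.2) :=
    (by fun_prop : Measurable fun p : ℝ × ℝ => g p.2 * q (p.1 - p.2)).stronglyMeasurable
  exact this.integral_prod_right'.measurable

lemma measurable_relPert {q : ℝ → ℝ} (hg : Measurable g) (hf₀ : Measurable f₀)
    (hq : Measurable q) : Measurable (relPert g f₀ q) :=
  (measurable_smear hg hq).div (measurable_noisyDensity hg hf₀).ennreal_toReal

/-- The density of a noisy observation under a perturbation of `f₀`. -/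
lemma noisyDensity_add {q : ℝ → ℝ} {K : ℝ} (hg : IsDensity g) (hf₀ : IsDensity f₀)
    (hq : Continuous q) (hK : ∀ x, |q x| ≤ K) (hpos : ∀ x, 0 ≤ f₀ x + q x) {x : ℝ}
    (hx : noisyDensity g f₀ x < ∞) :
    0 ≤ (noisyDensity g f₀ x).toReal + smear g q x ∧
    noisyDensity g (fun x => f₀ x + q x) x =
      ENNReal.ofReal ((noisyDensity g f₀ x).toReal + smear g q x) := by
  have hm : Measurable fun y => g y * f₀ (x - y) := by
    have := hg.measurable; have := hf₀.measurable; fun_prop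
  have hn : ∀ y, 0 ≤ g y * f₀ (x - y) := fun y => mul_nonneg (hg.nonneg y) (hf₀.nonneg _)
  have e : noisyDensity g f₀ x = ∫⁻ y, ENNReal.ofReal (g y * f₀ (x - y)) := by
    simp only [noisyDensity, ENNReal.ofReal_mul (hg.nonneg _)]
  have hi : Integrable fun y => g y * f₀ (x - y) :=
    (lintegral_ofReal_ne_top_iff_integrable hm.aestronglyMeasurable (ae_of_all _ hn)).1
      (e ▸ hx.ne)
  have e1 : (noisyDensity g f₀ x).toReal = ∫ y, g y * f₀ (x - y) := by
    rw [e, integral_eq_lintegral_of_nonneg_ae (ae_of_all _ hn) hm.aestronglyMeasurable]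
  have hi2 := integrable_mul_comp_sub hg hq hK x
  have e2 : (noisyDensity g f₀ x).toReal + smear g q x = ∫ y, g y * (f₀ (x - y) + q (x - y)) := by
    rw [e1, smear, ← integral_add hi hi2]
    simp only [mul_add]
  have hn' : ∀ y, 0 ≤ g y * (f₀ (x - y) + q (x - y)) := fun y =>
    mul_nonneg (hg.nonneg y) (hpos _)
  refine ⟨e2 ▸ integral_nonneg hn', ?_⟩
  have hi3 : Integrable fun y => g y * (f₀ (x - y) + q (x - y)) := by
    simp only [mul_add]
    exact hi.add hi2
  rw [e2, ofReal_integral_eq_lintegral_ofReal hi3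
    (ae_of_all _ hn')]
  simp only [noisyDensity, ENNReal.ofReal_mul (hg.nonneg _)]

variable {c : ℝ}

lemma toReal_noisyDensity_ge (hlow : ∀ x, ENNReal.ofReal (c / (1 + x ^ 2)) ≤ noisyDensity g f₀ x)
    {x : ℝ} (hx : noisyDensity g f₀ x < ∞) : c / (1 + x ^ 2) ≤ (noisyDensity g f₀ x).toReal :=
  (ENNReal.ofReal_le_iff_le_toReal hx.ne).1 (hlow x)

lemma one_add_relPert_nonneg {q : ℝ → ℝ} {K : ℝ} (hg : IsDensity g) (hf₀ : IsDensity f₀)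
    (hq : Continuous q) (hK : ∀ x, |q x| ≤ K) (hpos : ∀ x, 0 ≤ f₀ x + q x) (x : ℝ) :
    0 ≤ 1 + relPert g f₀ q x := by
  -- Where the real-valued density is 0, possibly because the extended one is infinite, the quotient
  -- is 0 by convention and the claim reads 0 ≤ 1. Hence nonnegativity holds at every point.
  rcases ENNReal.toReal_nonneg (a := noisyDensity g f₀ x) |>.eq_or_lt with h0 | h0
  · simp [relPert, ← h0]
  · have hx : noisyDensity g f₀ x < ∞ := (ENNReal.toReal_pos_iff.1 h0).2
    have := (noisyDensity_add hg hf₀ hq hK hpos hx).1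
    rw [relPert, ← div_self h0.ne', ← add_div]
    positivity

/-- The law of a noisy observation under a perturbation of `f₀` has density `1 + relPert` with
respect to the unperturbed one. -/
lemma noisyLaw_add_eq_withDensity {q : ℝ → ℝ} {K : ℝ} (hg : IsDensity g) (hf₀ : IsDensity f₀)
    (hc : 0 < c) (hlow : ∀ x, ENNReal.ofReal (c / (1 + x ^ 2)) ≤ noisyDensity g f₀ x)
    (hq : Continuous q) (hK : ∀ x, |q x| ≤ K) (hf : IsDensity fun x => f₀ x + q x) :
    noisyLaw g (fun x => f₀ x + q x) =
      (noisyLaw g f₀).withDensity fun x => ENNReal.ofReal (1 + relPert g f₀ q x) := by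
  have hm := measurable_noisyDensity hg.measurable hf₀.measurable
  have hr : Measurable fun x => ENNReal.ofReal (1 + relPert g f₀ q x) :=
    ((measurable_relPert hg.measurable hf₀.measurable hq.measurable).const_add 1).ennreal_ofReal
  rw [noisyLaw_eq_withDensity hg hf, noisyLaw_eq_withDensity hg hf₀,
    ← withDensity_mul _ hm hr]
  refine withDensity_congr_ae ?_
  filter_upwards [ae_noisyDensity_lt_top hg hf₀] with x hx
  have hp : 0 < (noisyDensity g f₀ x).toReal :=
    lt_of_lt_of_le (by positivity) (toReal_noisyDensity_ge hlow hx)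
  rw [(noisyDensity_add hg hf₀ hq hK hf.nonneg hx).2, Pi.mul_apply]
  nth_rw 2 [← ENNReal.ofReal_toReal hx.ne]
  rw [← ENNReal.ofReal_mul hp.le, relPert, mul_add, mul_one, mul_div_cancel₀ _ hp.ne']

/-- The chi-square size of the relative perturbation. -/
lemma integral_relPert_sq_le {q : ℝ → ℝ} (hg : IsDensity g) (hf₀ : IsDensity f₀)
    (hc : 0 < c) (hlow : ∀ x, ENNReal.ofReal (c / (1 + x ^ 2)) ≤ noisyDensity g f₀ x)
    (hq : Measurable q) (hi : Integrable fun x => (1 + x ^ 2) * smear g q x ^ 2) :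
    MemLp (relPert g f₀ q) 2 (noisyLaw g f₀) ∧
    ∫ x, relPert g f₀ q x ^ 2 ∂(noisyLaw g f₀) ≤ c⁻¹ * ∫ x, (1 + x ^ 2) * smear g q x ^ 2 := by
  have hm := measurable_noisyDensity hg.measurable hf₀.measurable
  have hr := measurable_relPert hg.measurable hf₀.measurable hq
  have hfin := ae_noisyDensity_lt_top hg hf₀
  have hle : ∀ x, (noisyDensity g f₀ x).toReal * relPert g f₀ q x ^ 2 ≤
      c⁻¹ * ((1 + x ^ 2) * smear g q x ^ 2) := fun x => by
    rcases ENNReal.toReal_nonneg (a := noisyDensity g f₀ x) |>.eq_or_lt with h0 | h0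
    · rw [← h0, zero_mul]
      positivity
    · have hx : noisyDensity g f₀ x < ∞ := (ENNReal.toReal_pos_iff.1 h0).2
      have h1 := toReal_noisyDensity_ge hlow hx
      have e : (noisyDensity g f₀ x).toReal * relPert g f₀ q x ^ 2 =
          smear g q x ^ 2 / (noisyDensity g f₀ x).toReal := by
        rw [relPert]; field_simp
      rw [e]
      calc _ ≤ smear g q x ^ 2 / (c / (1 + x ^ 2)) :=
            div_le_div_of_nonneg_left (sq_nonneg _) (by positivity) h1
        _ = _ := by field_simp
  have hI : Integrable fun x => (noisyDensity g f₀ x).toReal * relPert g f₀ q x ^ 2 :=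
    (hi.const_mul c⁻¹).mono' (by
      exact (hm.ennreal_toReal.mul (hr.pow_const 2)).aestronglyMeasurable) (ae_of_all _ fun x => by
        rw [Real.norm_of_nonneg (mul_nonneg ENNReal.toReal_nonneg (sq_nonneg _))]
        exact hle x)
  rw [noisyLaw_eq_withDensity hg hf₀]
  constructor
  · rw [memLp_two_iff_integrable_sq hr.aestronglyMeasurable,
      integrable_withDensity_iff_integrable_smul' hm hfin]
    exact hI
  · rw [integral_withDensity_eq_integral_toReal_smul hm hfin, ← integral_const_mul]
    exact integral_mono hI (hi.const_mul _) hle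

lemma integral_one_add_relPert {q : ℝ → ℝ} {K : ℝ} (hg : IsDensity g) (hf₀ : IsDensity f₀)
    (hc : 0 < c) (hlow : ∀ x, ENNReal.ofReal (c / (1 + x ^ 2)) ≤ noisyDensity g f₀ x)
    (hq : Continuous q) (hK : ∀ x, |q x| ≤ K) (hf : IsDensity fun x => f₀ x + q x) :
    ∫ x, (1 + relPert g f₀ q x) ∂(noisyLaw g f₀) = 1 := by
  have hp := isProbabilityMeasure_noisyLaw hg hf
  have h1 : noisyLaw g (fun x => f₀ x + q x) Set.univ = 1 := measure_univ
  rw [noisyLaw_add_eq_withDensity hg hf₀ hc hlow hq hK hf,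
    withDensity_apply _ MeasurableSet.univ, setLIntegral_univ] at h1
  rw [integral_eq_lintegral_of_nonneg_ae
    (ae_of_all _ (one_add_relPert_nonneg hg hf₀ hq hK hf.nonneg))
    ((measurable_relPert hg.measurable hf₀.measurable hq.measurable).const_add 1).aestronglyMeasurable,
    h1, ENNReal.toReal_one]

end DensityRatio

end NoisyTesting

namespace NoisyTesting

/-! ### The random-sign mixture and the minimax lower bound. -/

section LowerBound

variable {M : ℕ} {g f₀ : ℝ → ℝ} {h a : ℝ}

lemma exists_abs_pert_le_const (hh : 0 < h) (h1 : h ≤ 1) (hM : M * h ≤ 1) (θ : Fin M → ℝ) :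
    ∃ K, ∀ x, |pert h θ x| ≤ K := by
  obtain ⟨K, -, hK⟩ := exists_abs_pert_le
  refine ⟨K * ∑ j, |θ j|, fun x => le_trans ?_ (hK θ hh h1 hM
    (Finset.sum_nonneg fun j _ => abs_nonneg _)
    (fun j => Finset.single_le_sum (f := fun j => |θ j|) (fun i _ => abs_nonneg _)
      (Finset.mem_univ j)) x)⟩
  exact le_mul_of_one_le_left (abs_nonneg _) (by nlinarith [sq_nonneg x])

lemma pert_smul (h a : ℝ) (x : Fin M → ℝ) (y : ℝ) :
    pert h (fun i => a * x i) y = ∑ i, x i * pert h (Pi.single i a) y := by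
  have e : ∀ i : Fin M, pert h (Pi.single i a) y = a * wavelet (y / h - i) := fun i => by
    rw [pert, Finset.sum_eq_single i (fun j _ hj => by simp [hj]) (by simp), Pi.single_eq_same]
  simp only [e]
  exact Finset.sum_congr rfl fun i _ => by ring

/-- Linearity in the coefficients turns L² inner products of relative perturbations into a bilinear
form on sign vectors. -/
lemma relPert_pert_smul (hg : IsDensity g) (hh : 0 < h) (h1 : h ≤ 1) (hM : M * h ≤ 1)
    (x : Fin M → ℝ) (y : ℝ) : relPert g f₀ (pert h fun i => a * x i) y =
      ∑ i, x i * relPert g f₀ (pert h (Pi.single i a)) y := by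
  simp only [relPert, mul_div_assoc', ← Finset.sum_div]
  congr 1
  simp only [smear, pert_smul, ← integral_const_mul, Finset.mul_sum]
  rw [integral_finsetSum]
  · exact Finset.sum_congr rfl fun i _ => integral_congr_ae (ae_of_all _ fun z => by
      simp only; ring)
  · intro i _
    obtain ⟨K, hK⟩ := exists_abs_pert_le_const hh h1 hM (Pi.single i a)
    refine ((integrable_mul_comp_sub hg (continuous_pert h _) hK y).const_mul (x i)).congr
      (ae_of_all _ fun z => ?_)
    simp only
    ring

lemma sum_sum_mul_integral {X : Type*} [MeasurableSpace X] {μ : Measure X} {r : Fin M → X → ℝ}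
    (hr : ∀ i j, Integrable (fun t => r i t * r j t) μ) (x y : Fin M → ℝ) :
    ∑ i, ∑ j, x i * y j * ∫ t, r i t * r j t ∂μ =
      ∫ t, (∑ i, x i * r i t) * ∑ j, y j * r j t ∂μ := by
  have e : ∀ t, (∑ i, x i * r i t) * ∑ j, y j * r j t =
      ∑ i, ∑ j, x i * y j * (r i t * r j t) := fun t => by
    rw [Finset.sum_mul_sum]
    exact Finset.sum_congr rfl fun i _ => Finset.sum_congr rfl fun j _ => by ring
  simp only [e]
  rw [integral_finsetSum _ fun i _ => integrable_finsetSum _ fun j _ =>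
    (hr i j).const_mul (x i * y j)]
  refine Finset.sum_congr rfl fun i _ => ?_
  rw [integral_finsetSum _ fun j _ => (hr i j).const_mul (x i * y j)]
  exact Finset.sum_congr rfl fun j _ => (integral_const_mul _ _).symm

/-- Relative perturbations have mean zero, so only the cross term survives. -/
lemma integral_one_add_mul_one_add {X : Type*} [MeasurableSpace X] {μ : Measure X}
    [IsProbabilityMeasure μ] {r s : X → ℝ} (hr : MemLp r 2 μ) (hs : MemLp s 2 μ)
    (hr1 : ∫ x, (1 + r x) ∂μ = 1) (hs1 : ∫ x, (1 + s x) ∂μ = 1) :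
    ∫ x, (1 + r x) * (1 + s x) ∂μ = 1 + ∫ x, r x * s x ∂μ := by
  have ir : Integrable r μ := hr.integrable (by norm_num)
  have is : Integrable s μ := hs.integrable (by norm_num)
  have irs : Integrable (fun x => r x * s x) μ := hr.integrable_mul hs
  have i1 : Integrable (fun x => 1 + r x) μ := (integrable_const 1).add ir
  have hs0 : ∫ x, s x ∂μ = 0 := by
    rw [integral_add (integrable_const 1) is] at hs1
    simpa using hs1
  have e : ∀ x, (1 + r x) * (1 + s x) = (1 + r x) + (s x + r x * s x) := fun x => by ring
  have i2 : Integrable (fun x => s x + r x * s x) μ := is.add irs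
  simp only [e]
  rw [integral_add i1 i2, integral_add is irs, hr1, hs0, zero_add]

lemma exists_mem_risk_ge_of_chiSq_le {X α : Type*} [MeasurableSpace X] {μ : Measure X}
    [IsProbabilityMeasure μ] {n : ℕ} {S : Finset α} (hS : S.Nonempty) {ρ : α → X → ℝ}
    (hρ0 : ∀ i ∈ S, ∀ x, 0 ≤ ρ i x) (hρ2 : ∀ i ∈ S, MemLp (ρ i) 2 μ)
    (hρ1 : ∀ i ∈ S, ∫ x, ρ i x ∂μ = 1) {V : ℝ}
    (hV : ∑ i ∈ S, ∑ j ∈ S, (∫ x, ρ i x * ρ j x ∂μ) ^ n ≤ (S.card : ℝ) ^ 2 * (1 + V))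
    {R : Set (Fin n → X)} (hR : MeasurableSet R) :
    ∃ i ∈ S, ENNReal.ofReal (1 - √V) ≤ (Measure.pi fun _ : Fin n => μ) R +
      (Measure.pi fun _ : Fin n => μ.withDensity fun x => ENNReal.ofReal (ρ i x)) Rᶜ := by
  have : Nonempty S := hS.to_subtype
  obtain ⟨i, hi⟩ := exists_risk_ge_of_chiSq_le (n := n) (ρ := fun i : S => ρ i)
    (fun i => hρ0 i i.2) (fun i => hρ2 i i.2) (fun i => hρ1 i i.2) (V := V) (by
      rw [Fintype.card_coe]
      refine le_trans (le_of_eq ?_) hV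
      rw [← Finset.sum_coe_sort S]
      exact Finset.sum_congr rfl fun i _ =>
        Finset.sum_coe_sort S fun j => (∫ x, ρ i x * ρ j x ∂μ) ^ n) hR
  exact ⟨i, i.2, hi⟩

/-- The random-sign mixture bound for the minimax risk at a fixed sample size. -/
lemma exists_signVectors_risk_ge {c K : ℝ} (hg : IsDensity g) (hf₀ : IsDensity f₀) (hc : 0 < c)
    (hlow : ∀ x, ENNReal.ofReal (c / (1 + x ^ 2)) ≤ noisyDensity g f₀ x)
    (hh : 0 < h) (h1 : h ≤ 1) (hM : M * h ≤ 1) (hK : 0 ≤ K)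
    (hsm : ∀ θ : Fin M → ℝ, Integrable (fun x => (1 + x ^ 2) * smear g (pert h θ) x ^ 2) ∧
      ∫ x, (1 + x ^ 2) * smear g (pert h θ) x ^ 2 ≤ K * ∑ j, θ j ^ 2)
    (hf : ∀ θ ∈ signVectors M, IsDensity fun x => f₀ x + pert h (fun i => a * θ i) x)
    (n : ℕ) {R : Set (Fin n → ℝ)} (hR : MeasurableSet R) :
    ∃ θ ∈ signVectors M,
      ENNReal.ofReal (1 - √(Real.exp ((n : ℝ) ^ 2 * (c⁻¹ * (K * a ^ 2)) ^ 2 * M / 2) - 1)) ≤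
        obsLaw g f₀ n R + obsLaw g (fun x => f₀ x + pert h (fun i => a * θ i) x) n Rᶜ := by
  have hμ := isProbabilityMeasure_noisyLaw hg hf₀
  set μ := noisyLaw g f₀ with hμdef
  have hr2 : ∀ θ : Fin M → ℝ, MemLp (relPert g f₀ (pert h θ)) 2 μ := fun θ =>
    (integral_relPert_sq_le hg hf₀ hc hlow (continuous_pert h θ).measurable (hsm θ).1).1
  have hrr : ∀ i j, Integrable (fun x => relPert g f₀ (pert h (Pi.single i a)) x *
      relPert g f₀ (pert h (Pi.single j a)) x) μ := fun i j => (hr2 _).integrable_mul (hr2 _)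
  -- B is the Gram matrix of the relative perturbations by single terms of height a. Positivity is
  -- automatic, and the weighted L² bound on smeared perturbations gives the upper bound λ = c⁻¹ K
  -- a².
  obtain ⟨B, hB⟩ : ∃ B : Fin M → Fin M → ℝ, ∀ i j, B i j =
      ∫ x, relPert g f₀ (pert h (Pi.single i a)) x * relPert g f₀ (pert h (Pi.single j a)) x ∂μ :=
    ⟨_, fun i j => rfl⟩
  have hform : ∀ x y : Fin M → ℝ, ∑ i, ∑ j, x i * y j * B i j =
      ∫ t, relPert g f₀ (pert h fun i => a * x i) t *
        relPert g f₀ (pert h fun i => a * y i) t ∂μ := fun x y => by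
    simp only [hB, relPert_pert_smul hg hh h1 hM]
    exact sum_sum_mul_integral hrr x y
  have hsum := sum_sum_exp_form_le (B := B) (fun i j => by simp only [hB, mul_comm])
    (fun x => by
      rw [hform]
      exact integral_nonneg fun t => mul_self_nonneg _)
    (lam := c⁻¹ * (K * a ^ 2)) (by positivity) (fun x => by
      rw [hform]
      simp only [← pow_two]
      refine (integral_relPert_sq_le hg hf₀ hc hlow (continuous_pert h _).measurable
        (hsm fun i => a * x i).1).2.trans ?_
      rw [mul_assoc]
      refine mul_le_mul_of_nonneg_left ((hsm fun i => a * x i).2.trans_eq ?_) (by positivity)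
      simp only [mul_pow, ← Finset.mul_sum]
      ring) n
  have hbd : ∀ θ : Fin M → ℝ, ∃ Kb, ∀ x, |pert h (fun i => a * θ i) x| ≤ Kb := fun θ =>
    exists_abs_pert_le_const hh h1 hM _
  have hρ0 : ∀ θ ∈ signVectors M, ∀ x, 0 ≤ 1 + relPert g f₀ (pert h fun i => a * θ i) x :=
    fun θ hθ x => by
      obtain ⟨Kb, hKb⟩ := hbd θ
      exact one_add_relPert_nonneg hg hf₀ (continuous_pert h _) hKb (hf θ hθ).nonneg x
  have hρ1 : ∀ θ ∈ signVectors M, ∫ x, (1 + relPert g f₀ (pert h fun i => a * θ i) x) ∂μ = 1 :=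
    fun θ hθ => by
      obtain ⟨Kb, hKb⟩ := hbd θ
      exact integral_one_add_relPert hg hf₀ hc hlow (continuous_pert h _) hKb (hf θ hθ)
  have hρ2 : ∀ θ ∈ signVectors M,
      MemLp (fun x => 1 + relPert g f₀ (pert h fun i => a * θ i) x) 2 μ := fun θ _ =>
    MemLp.add (f := fun _ => (1 : ℝ)) (memLp_const 1) (hr2 fun i => a * θ i)
  -- The inequality 1 + t ≤ e^t may be raised to the power n because the left side is an integral of
  -- nonnegative densities, even when t is negative.
  have hterm : ∀ θ ∈ signVectors M, ∀ θ' ∈ signVectors M,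
      (∫ x, (1 + relPert g f₀ (pert h fun i => a * θ i) x) *
        (1 + relPert g f₀ (pert h fun i => a * θ' i) x) ∂μ) ^ n ≤
      Real.exp (n * ∑ i, ∑ j, θ i * θ' j * B i j) := fun θ hθ θ' hθ' => by
    have h0 : 0 ≤ ∫ x, (1 + relPert g f₀ (pert h fun i => a * θ i) x) *
        (1 + relPert g f₀ (pert h fun i => a * θ' i) x) ∂μ :=
      integral_nonneg fun x => mul_nonneg (hρ0 θ hθ x) (hρ0 θ' hθ' x)
    rw [integral_one_add_mul_one_add (hr2 _) (hr2 _) (hρ1 θ hθ) (hρ1 θ' hθ'), ← hform] at h0 ⊢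
    rw [Real.exp_nat_mul]
    refine pow_le_pow_left₀ h0 ?_ n
    rw [add_comm]
    exact Real.add_one_le_exp _
  have hcard : ((signVectors M).card : ℝ) = 2 ^ M := by
    rw [card_signVectors]
    push_cast
    rfl
  obtain ⟨θ, hθ, hrisk⟩ := exists_mem_risk_ge_of_chiSq_le (n := n) (μ := μ)
    (S := signVectors M) (Finset.card_pos.1 (by rw [card_signVectors]; positivity))
    (ρ := fun θ x => 1 + relPert g f₀ (pert h fun i => a * θ i) x)
    (V := Real.exp ((n : ℝ) ^ 2 * (c⁻¹ * (K * a ^ 2)) ^ 2 * M / 2) - 1)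
    hρ0 hρ2 hρ1 (by
      rw [hcard, add_sub_cancel]
      exact le_trans (Finset.sum_le_sum fun θ hθ => Finset.sum_le_sum fun θ' hθ' =>
        hterm θ hθ θ' hθ') hsum) hR
  obtain ⟨Kb, hKb⟩ := hbd θ
  have := noisyLaw_add_eq_withDensity hg hf₀ hc hlow (continuous_pert h _) hKb (hf θ hθ)
  refine ⟨θ, hθ, hrisk.trans_eq ?_⟩
  simp only [hμdef, ← this]
  rfl

lemma cf_add {f q : ℝ → ℝ} (hf : Integrable f) (hq : Integrable q) (u : ℝ) :
    cf (fun x => f x + q x) u = cf f u + cf q u := by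
  have hi : ∀ {p : ℝ → ℝ}, Integrable p →
      Integrable fun x : ℝ => Complex.exp (Complex.I * ((x * u : ℝ) : ℂ)) * ((p x : ℝ) : ℂ) :=
    fun hp => hp.ofReal.bdd_mul (c := 1)
      (by exact Continuous.aestronglyMeasurable (by fun_prop)) (ae_of_all _ fun x => by
        rw [mul_comm, Complex.norm_exp_ofReal_mul_I])
  simp only [cf, Complex.ofReal_add, mul_add]
  exact integral_add (hi hf) (hi hq)

lemma IsDensity.add_pert (hf₀ : IsDensity f₀) (hh : 0 < h) (θ : Fin M → ℝ)
    (hpos : ∀ x, |pert h θ x| ≤ f₀ x) : IsDensity fun x => f₀ x + pert h θ x where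
  measurable := hf₀.measurable.add (continuous_pert h θ).measurable
  nonneg x := by linarith [neg_abs_le (pert h θ x), hpos x]
  integral_eq_one := by
    rw [integral_add hf₀.integrable (integrable_pert hh θ), integral_pert hh, hf₀.integral_eq_one,
      add_zero]

/-- Small perturbations stay in the Sobolev class. -/
lemma add_pert_mem_smoothPerturbationClass {β L L₀ ε : ℝ} (hβ : 0 < β) (hL₀ : 0 < L₀)
    (hε : 0 < ε) (hf₀ : f₀ ∈ sobolevClass β L₀) (hh : 0 < h) (θ : Fin M → ℝ)
    (hpos : ∀ x, |pert h θ x| ≤ f₀ x)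
    (hL : (1 + ε) * L₀ + (1 + ε⁻¹) *
      ((8 * Real.pi / h) ^ (2 * β) * (8 * h * ∑ j, θ j ^ 2)) ≤ L) :
    (fun x => f₀ x + pert h θ x) ∈ smoothPerturbationClass β L f₀ := by
  have hπ := Real.pi_pos
  refine ⟨⟨hf₀.1.add_pert hh θ hpos, hf₀.2.1.add (memLp_pert hh θ), ?_⟩, ?_⟩
  · obtain ⟨i1, b1⟩ := integrable_of_mem_sobolevClass hL₀.le hf₀
    obtain ⟨i2, b2⟩ := integral_sobolev_pert_le hβ hh θ
    have hle : ∀ u, ‖cf (fun x => f₀ x + pert h θ x) u‖ ^ 2 * |u| ^ (2 * β) ≤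
        (1 + ε) * (‖cf f₀ u‖ ^ 2 * |u| ^ (2 * β)) +
        (1 + ε⁻¹) * (‖cf (pert h θ) u‖ ^ 2 * |u| ^ (2 * β)) := fun u => by
      rw [cf_add hf₀.1.integrable (integrable_pert hh θ)]
      have t := pow_le_pow_left₀ (norm_nonneg _) (norm_add_le (cf f₀ u) (cf (pert h θ) u)) 2
      -- Young's inequality with weight ε charges f₀ only 1 + ε, so the gap between L₀ and L can pay
      -- for the perturbation.
      have t2 : (‖cf f₀ u‖ + ‖cf (pert h θ) u‖) ^ 2 ≤
          (1 + ε) * ‖cf f₀ u‖ ^ 2 + (1 + ε⁻¹) * ‖cf (pert h θ) u‖ ^ 2 := by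
        have : 0 ≤ ε⁻¹ * (ε * ‖cf f₀ u‖ - ‖cf (pert h θ) u‖) ^ 2 := by positivity
        have e : ε⁻¹ * (ε * ‖cf f₀ u‖ - ‖cf (pert h θ) u‖) ^ 2 = ε * ‖cf f₀ u‖ ^ 2 -
            2 * (‖cf f₀ u‖ * ‖cf (pert h θ) u‖) + ε⁻¹ * ‖cf (pert h θ) u‖ ^ 2 := by
          field_simp
          ring
        nlinarith
      calc _ ≤ ((1 + ε) * ‖cf f₀ u‖ ^ 2 + (1 + ε⁻¹) * ‖cf (pert h θ) u‖ ^ 2) * |u| ^ (2 * β) :=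
            mul_le_mul_of_nonneg_right (t.trans t2) (by positivity)
        _ = _ := by ring
    have i3 := (i1.const_mul (1 + ε)).add (i2.const_mul (1 + ε⁻¹))
    refine (lintegral_mono fun u => ENNReal.ofReal_le_ofReal (hle u)).trans ?_
    refine (ofReal_integral_eq_lintegral_ofReal i3 (ae_of_all _ fun u => by
      simp only [Pi.zero_apply, Pi.add_apply]; positivity)).symm.trans_le ?_
    refine ENNReal.ofReal_le_ofReal ?_
    simp only [Pi.add_apply]
    rw [integral_add (i1.const_mul _) (i2.const_mul _), integral_const_mul, integral_const_mul]
    calc _ ≤ (1 + ε) * (2 * Real.pi * L₀) + (1 + ε⁻¹) * (2 * Real.pi *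
          ((8 * Real.pi / h) ^ (2 * β) * (8 * h * ∑ j, θ j ^ 2))) := by gcongr
      _ = 2 * Real.pi * ((1 + ε) * L₀ + (1 + ε⁻¹) *
          ((8 * Real.pi / h) ^ (2 * β) * (8 * h * ∑ j, θ j ^ 2))) := by ring
      _ ≤ _ := by gcongr
  · simpa only [add_sub_cancel_left] using contDiff_pert h θ

lemma tendsto_bandwidth {β σ : ℝ} (hβ : 0 < β) (hσ : 0 < σ) :
    Tendsto (bandwidth β σ) atTop (𝓝 0) := by
  have h1 := (tendsto_rpow_neg_atTop (y := 2 / (4 * β + 4 * σ + 1)) (by positivity)).comp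
    tendsto_natCast_atTop_atTop
  refine h1.congr fun n => ?_
  simp only [Function.comp, bandwidth, neg_div]

lemma testingRate_le_one {β σ : ℝ} (hβ : 0 < β) (hσ : 0 < σ) {n : ℕ} (hn : 0 < n) :
    testingRate β σ n ≤ 1 :=
  Real.rpow_le_one_of_one_le_of_nonpos (by exact_mod_cast hn)
    (div_nonpos_of_nonpos_of_nonneg (by linarith) (by positivity))

/-- This makes n²λ² of order C² h; multiplied by M ≤ 1/h terms, the χ² exponent is bounded by a
constant times C². -/
lemma sq_mul_testingRate_mul_bandwidth {β σ : ℝ} (hβ : 0 < β) (hσ : 0 < σ) {n : ℕ} (hn : 0 < n) :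
    (n : ℝ) ^ 2 * (testingRate β σ n ^ 4 * (bandwidth β σ n ^ (2 * σ + 1)) ^ 2) =
      bandwidth β σ n := by
  have hn1 : (0 : ℝ) < n := by exact_mod_cast hn
  rw [← Real.rpow_natCast (bandwidth β σ n ^ (2 * σ + 1)) 2, ← Real.rpow_mul (bandwidth_pos hn).le,
    bandwidth_rpow, testingRate_pow, bandwidth, ← Real.rpow_natCast (n : ℝ) 2,
    ← Real.rpow_add hn1, ← Real.rpow_add hn1]
  congr 1
  have hE : 4 * β + 4 * σ + 1 ≠ 0 := by positivity
  field_simp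
  push_cast
  ring

/-- The testing rate cannot be improved, even under smooth perturbations of `f₀`. -/
lemma testingLowerBound_smoothPerturbationClass {β σ L L₀ ξ : ℝ} (hβ : 0 < β) (hL₀ : 0 < L₀)
    (hL : L₀ < L) (hg : IsPolynomialNoise σ g) (hf₀ : f₀ ∈ sobolevClass β L₀) (hξ : ξ < 1)
    (hP : AssumptionP σ g) (hT : TailCondition f₀) :
    TestingLowerBound (smoothPerturbationClass β L f₀) g f₀ ξ (testingRate β σ) := by
  have hπ := Real.pi_pos
  have hσ : 0 < σ := lt_trans one_pos hg.one_lt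
  obtain ⟨c, hc, hlow⟩ := hT.exists_le_noisyDensity hg.density
  obtain ⟨c₀, hc₀, htail⟩ := hT
  obtain ⟨Kp, hKp, hpert⟩ := exists_abs_pert_le
  obtain ⟨K, h₀, hK, hh₀, hh₀1, hsm⟩ := exists_integral_smear_pert_le hg hP
  -- Chosen so that (1 + ε) L₀ = (L + L₀)/2, leaving half of the gap for the perturbation.
  set ε : ℝ := (L - L₀) / (2 * L₀) with hεdef
  have hε : 0 < ε := by have := sub_pos.2 hL; positivity
  set D : ℝ := 2 * K ^ 2 * c⁻¹ ^ 2 with hDdef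
  have hD : 0 < D := by positivity
  set E : ℝ := (1 + ε⁻¹) * (16 * (8 * Real.pi) ^ (2 * β)) with hEdef
  have hE : 0 < E := by positivity
  have hlog : 0 < Real.log (1 + (1 - ξ) ^ 2) :=
    Real.log_pos (by have := sub_pos.2 hξ; nlinarith [sq_pos_of_pos this])
  -- The three bounds on C ensure, respectively, nonnegativity of the perturbed density, membership
  -- in the Sobolev class, and χ²-divergence at most (1 - ξ)².
  refine ⟨min (min ((c₀ / Kp) ^ 2 / 2) ((L - L₀) / 2 / E)) (√(Real.log (1 + (1 - ξ) ^ 2) / D)),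
    lt_min (lt_min (by positivity) (by have := sub_pos.2 hL; positivity))
      (Real.sqrt_pos.2 (by positivity)), fun C hC hCl => ?_⟩
  obtain ⟨hC12, hC3⟩ := lt_min_iff.1 hCl
  obtain ⟨hC1, hC2⟩ := lt_min_iff.1 hC12
  have hC3' : D * C ^ 2 ≤ Real.log (1 + (1 - ξ) ^ 2) := by
    have := (Real.lt_sqrt hC.le).1 hC3
    rw [lt_div_iff₀ hD] at this
    linarith
  have hC2' : E * C ≤ (L - L₀) / 2 := by
    rw [lt_div_iff₀ hE] at hC2
    linarith
  have hC1' : Kp * √(2 * C) ≤ c₀ := by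
    have : √(2 * C) ≤ c₀ / Kp := Real.sqrt_le_iff.2 ⟨by positivity, by linarith⟩
    rwa [le_div_iff₀' hKp] at this
  refine le_liminf_of_le (by isBoundedDefault) ?_
  filter_upwards [eventually_gt_atTop 0,
    (tendsto_bandwidth hβ hσ).eventually (eventually_le_nhds hh₀)] with n hn hnh
  refine le_iInf fun R => ?_
  set h := bandwidth β σ n with hhdef
  set ψ := testingRate β σ n with hψdef
  have hh : 0 < h := bandwidth_pos hn
  have hψ : 0 < ψ := testingRate_pos hn
  have h1 : h ≤ 1 := bandwidth_le_one hβ hσ hn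
  have hψ1 : ψ ≤ 1 := testingRate_le_one hβ hσ hn
  set M := ⌊1 / h⌋₊ with hMdef
  have hM : M * h ≤ 1 := by
    have := Nat.floor_le (a := 1 / h) (by positivity)
    rwa [le_div_iff₀ hh] at this
  -- Rounding 1/h ≥ 1 down loses at most half; the factor 2 in a² = 2Cψ² compensates, so that the
  -- separation is at least Cψ².
  have hM2 : 1 ≤ 2 * (M * h) := by
    have t1 := Nat.lt_floor_add_one (1 / h)
    rw [div_lt_iff₀ hh] at t1
    have t2 : (1 : ℝ) ≤ M := by
      exact_mod_cast Nat.le_floor (by push_cast; rwa [le_div_iff₀ hh, one_mul])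
    nlinarith
  set a := √(2 * C) * ψ with hadef
  have ha : 0 ≤ a := by positivity
  have ha2 : a ^ 2 = 2 * C * ψ ^ 2 := by rw [hadef, mul_pow, Real.sq_sqrt (by positivity)]
  have hsumsq : ∀ θ ∈ signVectors M, ∑ j, (a * θ j) ^ 2 = M * a ^ 2 := fun θ hθ => by
    simp only [mul_pow, ← Finset.mul_sum, sum_sq_of_mem_signVectors hθ]
    ring
  have hpos : ∀ θ ∈ signVectors M, ∀ x, |pert h (fun i => a * θ i) x| ≤ f₀ x := fun θ hθ x => by
    have t := hpert (fun i => a * θ i) hh h1 hM ha (fun j => by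
      have : |θ j| = 1 := by
        have := sq_eq_one_of_mem_signVectors hθ j
        rw [← sq_abs] at this
        exact (pow_eq_one_iff_of_nonneg (abs_nonneg _) two_ne_zero).1 this
      rw [abs_mul, this, mul_one, abs_of_nonneg ha]) x
    refine le_trans ?_ (htail x)
    rw [sq_abs, le_div_iff₀ (by positivity), mul_comm]
    calc _ ≤ Kp * a := t
      _ = Kp * √(2 * C) * ψ := by rw [hadef]; ring
      _ ≤ Kp * √(2 * C) * 1 := by gcongr
      _ ≤ c₀ := by rw [mul_one]; exact hC1'
  have hpow : h ^ (2 * β) = ψ ^ 2 := bandwidth_rpow_two_mul n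
  have hmem : ∀ θ ∈ signVectors M, (fun x => f₀ x + pert h (fun i => a * θ i) x) ∈
      alternative (smoothPerturbationClass β L f₀) f₀ C ψ := fun θ hθ => by
    refine ⟨add_pert_mem_smoothPerturbationClass hβ hL₀ hε hf₀ hh _ (hpos θ hθ) ?_, ?_⟩
    · rw [hsumsq θ hθ, ha2, Real.div_rpow (by positivity) hh.le, hpow]
      have e1 : (1 + ε) * L₀ = (L + L₀) / 2 := by rw [hεdef]; field_simp; ring
      calc (1 + ε) * L₀ + (1 + ε⁻¹) * ((8 * Real.pi) ^ (2 * β) / ψ ^ 2 *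
            (8 * h * (M * (2 * C * ψ ^ 2)))) = (L + L₀) / 2 + E * C * (M * h) := by
            rw [e1, hEdef]; field_simp; ring
        _ ≤ (L + L₀) / 2 + E * C * 1 := by gcongr
        _ ≤ L := by linarith
    · simp only [add_sub_cancel_left]
      rw [integral_sq_pert hh]
      refine le_trans ?_ (le_integral_norm_sq_pertF hh _)
      rw [hsumsq θ hθ, ha2]
      nlinarith [mul_pos hC (pow_pos hψ 2)]
  obtain ⟨θ, hθ, hrisk⟩ := exists_signVectors_risk_ge (K := K * h ^ (2 * σ + 1)) (a := a)
    hg.density hf₀.1 hc hlow hh h1 hM (by positivity) (fun θ => hsm θ hh hnh hM)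
    (fun θ hθ => (hmem θ hθ).1.1.1) n R.2
  refine le_trans (le_trans (ENNReal.ofReal_le_ofReal ?_) hrisk)
    (add_le_add le_rfl (le_iSup₂_of_le _ (hmem θ hθ) le_rfl))
  have hV : (n : ℝ) ^ 2 * (c⁻¹ * (K * h ^ (2 * σ + 1) * a ^ 2)) ^ 2 * M / 2 ≤
      Real.log (1 + (1 - ξ) ^ 2) := by
    rw [ha2]
    calc _ = D * C ^ 2 * ((n : ℝ) ^ 2 * (ψ ^ 4 * (h ^ (2 * σ + 1)) ^ 2) * M) := by
          rw [hDdef]; ring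
      _ = D * C ^ 2 * (M * h) := by
          rw [sq_mul_testingRate_mul_bandwidth hβ hσ hn, mul_comm h]
      _ ≤ D * C ^ 2 * 1 := by gcongr
      _ ≤ _ := by rw [mul_one]; exact hC3'
  have hV2 : Real.exp ((n : ℝ) ^ 2 * (c⁻¹ * (K * h ^ (2 * σ + 1) * a ^ 2)) ^ 2 * M / 2) - 1 ≤
      (1 - ξ) ^ 2 := by
    have := Real.exp_le_exp.2 hV
    rw [Real.exp_log (by positivity)] at this
    linarith
  have := Real.sqrt_le_iff.2 ⟨by linarith, hV2⟩
  linarith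

/-- A larger class only enlarges the supremum in the risk. -/
lemma TestingLowerBound.mono {F G : Set (ℝ → ℝ)} {ξ : ℝ} {ψ : ℕ → ℝ} (hFG : F ⊆ G)
    (h : TestingLowerBound F g f₀ ξ ψ) : TestingLowerBound G g f₀ ξ ψ := by
  obtain ⟨Cl, hCl, H⟩ := h
  refine ⟨Cl, hCl, fun C h0 h1 => (H C h0 h1).trans (liminf_le_liminf (Eventually.of_forall fun n =>
    iInf_mono fun R => add_le_add le_rfl (biSup_mono fun f hf => ⟨hFG hf.1, hf.2⟩)))⟩

end LowerBound

end NoisyTesting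

theorem theorem5 (β σ L L₀ : ℝ) (hβ : 0 < β) (hL₀ : 0 < L₀) (hL : L₀ < L)
    (g : ℝ → ℝ) (hg : NoisyTesting.IsPolynomialNoise σ g)
    (f₀ : ℝ → ℝ) (hf₀ : f₀ ∈ NoisyTesting.sobolevClass β L₀)
    (ξ : ℝ) (hξ0 : 0 < ξ) (hξ1 : ξ < 1) :
    (∃ κ₀ : ℝ, 0 < κ₀ ∧ ∀ κ : ℝ, κ₀ ≤ κ →
      NoisyTesting.AttainsTestingRate (NoisyTesting.sobolevClass β L) g f₀ ξ
        (NoisyTesting.testingRate β σ)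
        (fun n => NoisyTesting.rejectionRegion g f₀ (NoisyTesting.bandwidth β σ n)
          (NoisyTesting.testingRate β σ n) κ n)) ∧
    (NoisyTesting.AssumptionP σ g → NoisyTesting.TailCondition f₀ →
      NoisyTesting.TestingLowerBound (NoisyTesting.sobolevClass β L) g f₀ ξ
        (NoisyTesting.testingRate β σ) ∧
      NoisyTesting.TestingLowerBound (NoisyTesting.smoothPerturbationClass β L f₀) g f₀ ξ
        (NoisyTesting.testingRate β σ)) := by
  refine ⟨NoisyTesting.exists_attainsTestingRate hβ hL₀ hL hg hf₀ hξ0, fun hP hT => ?_⟩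
  have h := NoisyTesting.testingLowerBound_smoothPerturbationClass hβ hL₀ hL hg hf₀ hξ1 hP hT
  exact ⟨h.mono fun f hf => hf.1, h⟩
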